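/- **Setup.** Let $\mathfrak H=\mathbb Q\langle e_0,e_1\rangle$, $\mathfrak H^1=\mathbb Q+e_1\mathfrak H$, $\mathfrak H^0=\mathbb Q+e_1\mathfrak H e_0$, and $e_k=e_1e_0^{k-1}$ for $k\ge 1$. An *index* is a finite (possibly empty) sequence $\mathbf k=(k_1,\dots,k_r)$ of positive integers; it is identified with the monomial $e_{k_1}\cdots e_{k_r}$. The indices form a $\mathbb Q$-basis of $\mathfrak H^1$, and the non-empty ones form a basis of $e_1\mathfrak H$. All operations below are extended $\mathbb Q$-(bi)linearly. * The shuffle product $\sqcup\!\sqcup$ on $\mathfrak H$: $1\mathbin{\sqcup\!\sqcup}w=w\mathbin{\sqcup\!\sqcup}1=w$ and $av\mathbin{\sqcup\!\sqcup}bw=a(v\mathbin{\sqcup\!\sqcup}bw)+b(av\mathbin{\sqcup\!\sqcup}w)$ for $a,b\in\{e_0,e_1\}$. * The harmonic product $*$ on $\mathfrak H^1$: $1*w=w*1=w$ and $e_kv*e_lw=e_k(v*e_lw)+e_l(e_kv*w)+e_{k+l}(v*w)$. The product $\bar *$ on $\mathfrak H^1$ is defined by the same recursion with $-e_{k+l}(v\,\bar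 *\,w)$ as the last term. * $\mathbf k^\star$ is the sum of the $2^{r-1}$ indices obtained from $(k_1,\dots,k_r)$ by replacing each comma by a comma or a plus sign, and $\varnothing^\star=\varnothing$. * $\circledast\colon e_1\mathfrak H\times e_1\mathfrak H\to e_1\mathfrak He_0$ is given by $ve_k\circledast we_l=(v*w)e_{k+l}$ for $v,w\in\mathfrak H^1$. * The Hoffman dual $\mathbf k^\vee$ of an index $\mathbf k$ of weight $k=k_1+\dots+k_r$ is the index of the same weight such that $\{1,\dots,k-1\}$ is the disjoint union of $\{k_1,k_1+k_2,\dots,k_1+\dots+k_{r-1}\}$ and the corresponding set of partial sums of $\mathbf k^\vee$. * $w\mapsto w^\dagger$ is the anti-automorphism of $\mathfrak H$ with $e_0^\dagger=e_1$, $e_1^\dagger=e_0$; it preserves $\mathfrak H^0$. * For a finite poset $X$ with a label map $\delta\colon X\to\{0,1\}$, put $W(X)=\sum e_{\delta(x_1)}\cdots e_{\delta(x_n)}$, summed over all linear extensions $x_1<\dots<x_n$ of the order of $X$. For non-empty $\mathbf k=(k_1,\dots,k_r)$ and $\mathbf l=(l_1,\dots,l_s)$, put $\mu(\mathbf k,\mathbf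 l)=W(X)\in\mathfrak H^0$, where $X$ is the following zigzag. Start with a chain whose labels, going upwards, are $1,0^{k_1-1},1,0^{k_2-1},\dots,1,0^{k_r-1}$, continued upwards by $l_s$ elements labelled $0$. Then, for $i=s-1,\dots,1$ in this order, append a block consisting of one element labelled $1$, lying below the last element so far, followed upwards by $l_i-1$ elements labelled $0$. Let $Z\colon\mathfrak H^0\to\mathbb R$ be a $\mathbb Q$-linear map. It satisfies * the *double shuffle relation* if $Z(1)=1$ and $Z(v\mathbin{\sqcup\!\sqcup}w)=Z(v*w)=Z(v)Z(w)$ for all $v,w\in\mathfrak H^0$; * the *integral-series identity* (Int-Ser) if $Z(\mu(\mathbf k,\mathbf l))=Z(\mathbf k\circledast\mathbf l^\star)$ for all non-empty indices $\mathbf k,\mathbf l$; * the *duality relation* if $Z(w)=Z(w^\dagger)$ for all $w\in\mathfrak H^0$; * *Kawashima's relation* if, for all non-empty indices $\mathbf k,\mathbf l$ and all integers $m\ge 1$, $$\sum_{\substack{p,q\ge 1\\ p+q=m}} Z\bigl((\underbrace{1,\dots,1}_{p})\circledast(\mathbf k^\vee)^\star\bigr)\,Z\bigl((\underbrace{1,\dots,1}_{q})\circledast(\mathbf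 l^\vee)^\star\bigr)=-Z\bigl((\underbrace{1,\dots,1}_{m})\circledast((\mathbf k\,\bar *\,\mathbf l)^\vee)^\star\bigr).$$ If $Z$ satisfies the double shuffle relation, let $Z_{\sqcup\!\sqcup},Z_*\colon\mathfrak H^1\to\mathbb R[T]$ be the unique $\mathbb Q$-algebra homomorphisms, for $\sqcup\!\sqcup$ and for $*$ respectively, that extend $Z$ and send $e_1$ to $T$. Let $\rho_Z$ be the $\mathbb R$-linear endomorphism of $\mathbb R[T]$ determined coefficientwise by $\rho_Z(e^{Tu})=A_Z(u)e^{Tu}$, where $A_Z(u)=\exp\bigl(\sum_{n\ge2}\frac{(-1)^n}{n}Z(e_n)u^n\bigr)$. Then $Z$ satisfies the *regularization theorem* (Reg) if $Z_{\sqcup\!\sqcup}(\mathbf k)=\rho_Z(Z_*(\mathbf k))$ for every index $\mathbf k$. **Theorem.** Let $Z\colon\mathfrak H^0\to\mathbb R$ be a $\mathbb Q$-linear map that satisfies the double shuffle relation. Then $Z$ satisfies the regularization theorem if and only if it satisfies the integral-series identity. If $Z$ satisfies these two equivalent conditions and the duality relation, then $Z$ satisfies Kawashima's relation. -/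

import Mathlib

/-! Multiple zeta values, algebraic setup: words, indices, products. -/

namespace MZV

/-- The noncommutative polynomial algebra `ℚ⟨e₀, e₁⟩`. -/
abbrev H : Type := FreeAlgebra ℚ (Fin 2)

/-- The two indeterminates `e₀`, `e₁`. -/
noncomputable def e (a : Fin 2) : H := FreeAlgebra.ι ℚ a

/-- The monomial `e_{a₁} ⋯ e_{aₙ}` of a word. -/
noncomputable def word (w : List (Fin 2)) : H := (w.map e).prod

@[simp] theorem word_nil : word [] = 1 := rfl

@[simp] theorem word_cons (a : Fin 2) (w : List (Fin 2)) : word (a :: w) = e a * word w := by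
  simp [word]

@[simp] theorem word_append (v w : List (Fin 2)) : word (v ++ w) = word v * word w := by
  simp [word]

/-- The words form a basis of `ℚ⟨e₀, e₁⟩`. -/
noncomputable def wordBasis : Module.Basis (List (Fin 2)) ℚ H :=
  (FreeAlgebra.basisFreeMonoid ℚ (Fin 2)).reindex FreeMonoid.toList

@[simp] theorem wordBasis_apply (w : List (Fin 2)) : wordBasis w = word w := by
  simp [wordBasis, FreeAlgebra.basisFreeMonoid, FreeAlgebra.equivMonoidAlgebraFreeMonoid,
    word, FreeMonoid.lift_apply]
  rfl

theorem span_word : Submodule.span ℚ (Set.range word) = ⊤ := by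
  rw [← wordBasis.span_eq]; congr 1; ext x; simp

/-! ### The subspaces `𝔥⁰ ⊆ 𝔥¹` -/

/-- The subspace `e₁ 𝔥`. -/
noncomputable def e1H : Submodule ℚ H := LinearMap.range (LinearMap.mulLeft ℚ (e 1))

/-- The subspace `e₁ 𝔥 e₀`. -/
noncomputable def e1He0 : Submodule ℚ H :=
  LinearMap.range (LinearMap.mulLeft ℚ (e 1) ∘ₗ LinearMap.mulRight ℚ (e 0))

/-- `𝔥¹ = ℚ + e₁ 𝔥`. -/
noncomputable def H1 : Submodule ℚ H := 1 ⊔ e1H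

/-- `𝔥⁰ = ℚ + e₁ 𝔥 e₀`. -/
noncomputable def H0 : Submodule ℚ H := 1 ⊔ e1He0

theorem mem_e1H {x : H} : x ∈ e1H ↔ ∃ y, x = e 1 * y := by
  simp [e1H, eq_comm]

theorem mem_e1He0 {x : H} : x ∈ e1He0 ↔ ∃ y, x = e 1 * (y * e 0) := by
  simp [e1He0, eq_comm]

theorem e1He0_le_e1H : e1He0 ≤ e1H := by
  intro x hx
  obtain ⟨y, rfl⟩ := mem_e1He0.1 hx
  exact mem_e1H.2 ⟨_, rfl⟩

theorem H0_le_H1 : H0 ≤ H1 := sup_le_sup_left e1He0_le_e1H 1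

theorem one_mem_H0 : (1 : H) ∈ H0 := Submodule.mem_sup_left (Submodule.one_le.1 le_rfl)

theorem one_mem_H1 : (1 : H) ∈ H1 := Submodule.mem_sup_left (Submodule.one_le.1 le_rfl)

/-- The inclusion of `𝔥⁰` in `𝔥¹`. -/
noncomputable def incl : H0 →ₗ[ℚ] H1 := Submodule.inclusion H0_le_H1

/-! ### Indices -/

/-- The word `e₁ e₀^{k-1}`, as a list of letters. -/
def letterWord (k : ℕ+) : List (Fin 2) := 1 :: List.replicate ((k : ℕ) - 1) 0

/-- The word of an index `(k₁, …, k_r)`, as a list of letters. -/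
def indexWord (k : List ℕ+) : List (Fin 2) := k.flatMap letterWord

@[simp] theorem indexWord_nil : indexWord [] = [] := rfl

@[simp] theorem indexWord_cons (k : ℕ+) (l : List ℕ+) :
    indexWord (k :: l) = letterWord k ++ indexWord l := rfl

/-- `e_k = e₁ e₀^{k-1}`. -/
noncomputable def eK (k : ℕ+) : H := e 1 * e 0 ^ ((k : ℕ) - 1)

theorem word_replicate (n : ℕ) (a : Fin 2) : word (List.replicate n a) = e a ^ n := by
  simp [word]

theorem word_letterWord (k : ℕ+) : word (letterWord k) = eK k := by
  simp [letterWord, eK, word_replicate]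

theorem word_indexWord (k : List ℕ+) : word (indexWord k) = (k.map eK).prod := by
  induction k with
  | nil => simp
  | cons a k ih => simp [ih, word_letterWord]

theorem eK_mul_mem (k : ℕ+) (x : H) : eK k * x ∈ e1H :=
  mem_e1H.2 ⟨e 0 ^ ((k : ℕ) - 1) * x, by simp [eK, mul_assoc]⟩

theorem indexWord_mem (k : List ℕ+) : word (indexWord k) ∈ H1 := by
  cases k with
  | nil => exact one_mem_H1
  | cons a k =>
    rw [indexWord_cons, word_append, word_letterWord]
    exact Submodule.mem_sup_right (eK_mul_mem a _)

theorem indexWord_injective : Function.Injective indexWord := by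
  have key : ∀ (m n : ℕ) (v w : List (Fin 2)), (∀ a ∈ v.head?, a = 1) → (∀ a ∈ w.head?, a = 1) →
      List.replicate m 0 ++ v = List.replicate n 0 ++ w → m = n ∧ v = w := by
    intro m
    induction m with
    | zero =>
      intro n v w hv hw h
      cases n with
      | zero => simpa using h
      | succ n =>
        simp only [List.replicate_zero, List.nil_append, List.replicate_succ,
          List.cons_append] at h
        subst h
        simp at hv
    | succ m ih =>
      intro n v w hv hw h
      cases n with
      | zero =>
        simp only [List.replicate_zero, List.nil_append, List.replicate_succ,
          List.cons_append] at h
        subst h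
        simp at hw
      | succ n =>
        simp only [List.replicate_succ, List.cons_append, List.cons.injEq, true_and] at h
        obtain ⟨h1, h2⟩ := ih n v w hv hw h
        exact ⟨by omega, h2⟩
  have head : ∀ k : List ℕ+, ∀ a ∈ (indexWord k).head?, a = 1 := by
    intro k
    cases k <;> simp [letterWord]
  intro k
  induction k with
  | nil => intro l h; cases l <;> simp_all [letterWord]
  | cons a k ih =>
    intro l h
    cases l with
    | nil => simp [letterWord] at h
    | cons b l =>
      simp only [indexWord_cons, letterWord, List.cons_append, List.cons.injEq, true_and] at h
      obtain ⟨h1, h2⟩ := key _ _ _ _ (head k) (head l) h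
      have ha := a.pos
      have hb := b.pos
      rw [ih h2, PNat.eq (show (a : ℕ) = b by omega)]

theorem exists_index (w : List (Fin 2)) : ∃ (n : ℕ) (k : List ℕ+),
    w = List.replicate n 0 ++ indexWord k := by
  induction w with
  | nil => exact ⟨0, [], rfl⟩
  | cons a w ih =>
    obtain ⟨n, k, rfl⟩ := ih
    match a with
    | 0 => exact ⟨n + 1, k, by simp [List.replicate_succ]⟩
    | 1 => exact ⟨0, n.succPNat :: k, by simp [letterWord]⟩

theorem exists_index_of_head (w : List (Fin 2)) : ∃ k : List ℕ+, k ≠ [] ∧ 1 :: w = indexWord k := by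
  obtain ⟨n, k, rfl⟩ := exists_index w
  exact ⟨n.succPNat :: k, by simp, by simp [letterWord]⟩

/-- The monomial `e_{k₁} ⋯ e_{k_r}` of an index, an element of `𝔥¹`. -/
noncomputable def mono (k : List ℕ+) : H1 := ⟨word (indexWord k), indexWord_mem k⟩

@[simp] theorem coe_mono (k : List ℕ+) : (mono k : H) = word (indexWord k) := rfl

theorem linearIndependent_mono : LinearIndependent ℚ mono := by
  refine LinearIndependent.of_comp H1.subtype ?_
  have := wordBasis.linearIndependent.comp indexWord indexWord_injective
  convert this using 1
  ext k
  simp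

theorem e1H_le_span : e1H ≤ Submodule.span ℚ ((fun k => word (indexWord k)) '' {k | k ≠ []}) := by
  rw [e1H, LinearMap.range_eq_map, ← span_word, Submodule.map_span, Submodule.span_le]
  rintro _ ⟨_, ⟨w, rfl⟩, rfl⟩
  obtain ⟨k, hk, h⟩ := exists_index_of_head w
  refine Submodule.subset_span ⟨k, hk, ?_⟩
  simp [← h]

theorem span_mono : ⊤ ≤ Submodule.span ℚ (Set.range mono) := by
  have h : H1 ≤ (Submodule.span ℚ (Set.range mono)).map H1.subtype := by
    rw [Submodule.map_span]
    refine sup_le ?_ (e1H_le_span.trans (Submodule.span_mono ?_))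
    · rw [Submodule.one_le]
      exact Submodule.subset_span ⟨mono [], ⟨[], rfl⟩, rfl⟩
    · rintro _ ⟨k, -, rfl⟩
      exact ⟨mono k, ⟨k, rfl⟩, rfl⟩
  intro x _
  obtain ⟨y, hy, hyx⟩ := h x.2
  rwa [← Subtype.ext hyx]

/-- The monomials of all indices form a basis of `𝔥¹`. -/
noncomputable def indexBasis : Module.Basis (List ℕ+) ℚ H1 :=
  Module.Basis.mk linearIndependent_mono span_mono

@[simp] theorem indexBasis_apply (k : List ℕ+) : indexBasis k = mono k := by
  simp [indexBasis]

/-- An index is admissible if it is empty or its last component is at least `2`. -/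
def Admissible (k : List ℕ+) : Prop := ∀ a ∈ k.getLast?, 2 ≤ (a : ℕ)

/-! ### Shuffle product -/

/-- The shuffle product of two words. -/
noncomputable def shuffleWord : List (Fin 2) → List (Fin 2) → H
  | [], w => word w
  | a :: v, [] => word (a :: v)
  | a :: v, b :: w => e a * shuffleWord v (b :: w) + e b * shuffleWord (a :: v) w
termination_by v w => v.length + w.length

/-- The shuffle product on `𝔥`. -/
noncomputable def shuffle : H →ₗ[ℚ] H →ₗ[ℚ] H :=
  wordBasis.constr ℚ fun v => wordBasis.constr ℚ fun w => shuffleWord v w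

theorem shuffle_word (v w : List (Fin 2)) : shuffle (word v) (word w) = shuffleWord v w := by
  rw [← wordBasis_apply, ← wordBasis_apply, shuffle, Module.Basis.constr_basis,
    Module.Basis.constr_basis]

theorem shuffleWord_nil_right (v : List (Fin 2)) : shuffleWord v [] = word v := by
  cases v <;> simp [shuffleWord]

theorem e1H_eq_span : e1H = Submodule.span ℚ (Set.range fun w => word (1 :: w)) := by
  rw [e1H, LinearMap.range_eq_map, ← span_word, Submodule.map_span, ← Set.range_comp]
  congr 1

theorem e1He0_eq_span :
    e1He0 = Submodule.span ℚ (Set.range fun w => word (1 :: (w ++ [0]))) := by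
  rw [e1He0, LinearMap.range_eq_map, ← span_word, Submodule.map_span, ← Set.range_comp]
  congr 1
  ext x
  simp

theorem H1_eq_span : H1 = Submodule.span ℚ (insert 1 (Set.range fun w => word (1 :: w))) := by
  rw [Submodule.span_insert, ← e1H_eq_span, ← Submodule.one_eq_span, H1]

theorem H0_eq_span :
    H0 = Submodule.span ℚ (insert 1 (Set.range fun w => word (1 :: (w ++ [0])))) := by
  rw [Submodule.span_insert, ← e1He0_eq_span, ← Submodule.one_eq_span, H0]

theorem shuffle_mem_H1 {x y : H} (hx : x ∈ H1) (hy : y ∈ H1) : shuffle x y ∈ H1 := by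
  rw [H1_eq_span] at hx hy
  refine LinearMap.BilinMap.apply_apply_mem_of_mem_span _ _ _ shuffle ?_ x y hx hy
  rintro _ (rfl | ⟨v, rfl⟩) _ (rfl | ⟨w, rfl⟩)
  · rw [← word_nil, shuffle_word, shuffleWord]
    exact one_mem_H1
  · rw [← word_nil, shuffle_word, shuffleWord, word_cons]
    exact Submodule.mem_sup_right (mem_e1H.2 ⟨_, rfl⟩)
  · rw [← word_nil, shuffle_word, shuffleWord, word_cons]
    exact Submodule.mem_sup_right (mem_e1H.2 ⟨_, rfl⟩)
  · simp only [shuffle_word, shuffleWord, ← mul_add]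
    exact Submodule.mem_sup_right (mem_e1H.2 ⟨_, rfl⟩)

theorem shuffleWord_end (v w : List (Fin 2)) (hv : ∀ a ∈ v.getLast?, a = 0)
    (hw : ∀ a ∈ w.getLast?, a = 0) (hvw : v ≠ [] ∨ w ≠ []) : ∃ y, shuffleWord v w = y * e 0 := by
  have last : ∀ u : List (Fin 2), (∀ a ∈ u.getLast?, a = 0) → u ≠ [] → ∃ y, word u = y * e 0 := by
    intro u hu hne
    obtain ⟨u, a, rfl⟩ := List.eq_nil_or_concat u |>.resolve_left hne
    have : a = 0 := hu a (by simp)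
    exact ⟨word u, by simp [this]⟩
  have tail : ∀ (a : Fin 2) (u : List (Fin 2)), (∀ c ∈ (a :: u).getLast?, c = 0) →
      ∀ c ∈ u.getLast?, c = 0 := by
    intro a u h c hc
    cases u with
    | nil => simp at hc
    | cons b u => exact h c (by simpa [List.getLast?_cons_cons] using hc)
  fun_induction shuffleWord v w with
  | case1 w => exact last w hw (by simpa using hvw)
  | case2 a v => exact last _ hv (by simp)
  | case3 a v b w ih1 ih2 =>
    obtain ⟨y, hy⟩ := ih1 (tail a v hv) hw (by simp)
    obtain ⟨z, hz⟩ := ih2 hv (tail b w hw) (by simp)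
    exact ⟨e a * y + e b * z, by rw [hy, hz, add_mul, mul_assoc, mul_assoc]⟩

theorem getLast_cons_concat (w : List (Fin 2)) : (1 :: (w ++ [0])).getLast? = some 0 := by
  rw [← List.cons_append, List.getLast?_append]
  rfl

theorem shuffle_mem_H0 {x y : H} (hx : x ∈ H0) (hy : y ∈ H0) : shuffle x y ∈ H0 := by
  rw [H0_eq_span] at hx hy
  refine LinearMap.BilinMap.apply_apply_mem_of_mem_span _ _ _ shuffle ?_ x y hx hy
  have h1 : ∀ v : List (Fin 2), word (1 :: (v ++ [0])) ∈ H0 := fun v =>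
    Submodule.mem_sup_right (mem_e1He0.2 ⟨word v, by simp⟩)
  rintro _ (rfl | ⟨v, rfl⟩) _ (rfl | ⟨w, rfl⟩)
  · rw [← word_nil, shuffle_word, shuffleWord]
    exact one_mem_H0
  · rw [← word_nil, shuffle_word, shuffleWord]
    exact h1 w
  · rw [← word_nil, shuffle_word, shuffleWord]
    exact h1 v
  · simp only [shuffle_word, shuffleWord]
    obtain ⟨y, hy⟩ := shuffleWord_end (v ++ [0]) (1 :: (w ++ [0])) (by simp)
      (by rw [getLast_cons_concat]; simp) (by simp)
    obtain ⟨z, hz⟩ := shuffleWord_end (1 :: (v ++ [0])) (w ++ [0])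
      (by rw [getLast_cons_concat]; simp) (by simp) (by simp)
    rw [hy, hz, ← mul_add, ← add_mul]
    exact Submodule.mem_sup_right (mem_e1He0.2 ⟨_, rfl⟩)

/-- The shuffle product restricted to `𝔥¹`. -/
noncomputable def shuffle1 (x y : H1) : H1 := ⟨shuffle x y, shuffle_mem_H1 x.2 y.2⟩

/-- The shuffle product restricted to `𝔥⁰`. -/
noncomputable def shuffle0 (x y : H0) : H0 := ⟨shuffle x y, shuffle_mem_H0 x.2 y.2⟩

/-! ### Harmonic products -/

/-- Left multiplication by `e_k` on `𝔥¹`. -/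
noncomputable def eMul (k : ℕ+) : H1 →ₗ[ℚ] H1 :=
  (LinearMap.mulLeft ℚ (eK k)).restrict fun x _ => Submodule.mem_sup_right (eK_mul_mem k x)

theorem coe_eMul (k : ℕ+) (x : H1) : (eMul k x : H) = eK k * x := rfl

@[simp] theorem eMul_mono (k : ℕ+) (l : List ℕ+) : eMul k (mono l) = mono (k :: l) :=
  Subtype.ext (by simp [coe_eMul, word_letterWord])

/-- The recursion
`e_k v ∘ e_l w = e_k (v ∘ e_l w) + e_l (e_k v ∘ w) + c e_{k+l} (v ∘ w)`
on indices; `c = 1` gives the harmonic product, `c = -1` its star version. -/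
noncomputable def harmIndex (c : ℚ) : List ℕ+ → List ℕ+ → H1
  | [], w => mono w
  | k :: v, [] => mono (k :: v)
  | k :: v, l :: w => eMul k (harmIndex c v (l :: w)) + eMul l (harmIndex c (k :: v) w)
      + c • eMul (k + l) (harmIndex c v w)
termination_by v w => v.length + w.length

/-- The bilinear extension of `harmIndex` to `𝔥¹`. -/
noncomputable def harmWith (c : ℚ) : H1 →ₗ[ℚ] H1 →ₗ[ℚ] H1 :=
  indexBasis.constr ℚ fun v => indexBasis.constr ℚ fun w => harmIndex c v w

theorem harmWith_mono (c : ℚ) (v w : List ℕ+) :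
    harmWith c (mono v) (mono w) = harmIndex c v w := by
  rw [← indexBasis_apply, ← indexBasis_apply, harmWith, Module.Basis.constr_basis,
    Module.Basis.constr_basis]

/-- The harmonic (stuffle) product `*` on `𝔥¹`. -/
noncomputable def harm : H1 →ₗ[ℚ] H1 →ₗ[ℚ] H1 := harmWith 1

/-- The star version of the harmonic product on `𝔥¹` (with `-e_{k+l}` in place of `e_{k+l}`). -/
noncomputable def starHarm : H1 →ₗ[ℚ] H1 →ₗ[ℚ] H1 := harmWith (-1)

theorem eK_mul_mem_e1He0 (k : ℕ+) {x : H} (hx : x ∈ e1He0) : eK k * x ∈ e1He0 := by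
  obtain ⟨y, rfl⟩ := mem_e1He0.1 hx
  exact mem_e1He0.2 ⟨e 0 ^ ((k : ℕ) - 1) * (e 1 * y), by simp [eK, mul_assoc]⟩

theorem mul_eK_mem_e1He0 {x : H} (hx : x ∈ H1) {k : ℕ+} (hk : 2 ≤ (k : ℕ)) :
    x * eK k ∈ e1He0 := by
  obtain ⟨n, hn⟩ : ∃ n, (k : ℕ) - 1 = n + 1 := ⟨(k : ℕ) - 2, by omega⟩
  obtain ⟨c, hc, y, hy, rfl⟩ := Submodule.mem_sup.1 hx
  obtain ⟨z, rfl⟩ := mem_e1H.1 hy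
  obtain ⟨q, rfl⟩ := Submodule.mem_one.1 hc
  rw [add_mul]
  refine add_mem (mem_e1He0.2 ⟨algebraMap ℚ H q * e 0 ^ n, ?_⟩)
    (mem_e1He0.2 ⟨z * e 1 * e 0 ^ n, ?_⟩)
  · rw [eK, hn, pow_succ, ← mul_assoc, Algebra.commutes q (e 1)]
    simp only [mul_assoc]
  · rw [eK, hn, pow_succ]
    simp only [mul_assoc]

theorem indexWord_mem_e1He0 {k : List ℕ+} (hk : Admissible k) (hne : k ≠ []) :
    word (indexWord k) ∈ e1He0 := by
  obtain ⟨l, a, rfl⟩ := List.eq_nil_or_concat k |>.resolve_left hne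
  have ha : 2 ≤ (a : ℕ) := hk a (by simp)
  have : word (indexWord (l.concat a)) = word (indexWord l) * eK a := by
    simp [indexWord, word_letterWord]
  rw [this]
  exact mul_eK_mem_e1He0 (indexWord_mem l) ha

theorem indexWord_mem_H0 {k : List ℕ+} (hk : Admissible k) : word (indexWord k) ∈ H0 := by
  by_cases hne : k = []
  · subst hne
    exact one_mem_H0
  · exact Submodule.mem_sup_right (indexWord_mem_e1He0 hk hne)

theorem H0_eq_span_index :
    H0 = Submodule.span ℚ ((fun k => word (indexWord k)) '' {k | Admissible k}) := by
  refine le_antisymm ?_ ?_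
  · rw [H0_eq_span, Submodule.span_le]
    rintro _ (rfl | ⟨w, rfl⟩)
    · exact Submodule.subset_span ⟨[], by simp [Admissible], by simp⟩
    · obtain ⟨k, hk, h⟩ := exists_index_of_head (w ++ [0])
      refine Submodule.subset_span ⟨k, ?_, by simp [← h]⟩
      obtain ⟨l, a, rfl⟩ := List.eq_nil_or_concat k |>.resolve_left hk
      intro b hb
      obtain rfl : a = b := by simpa using hb
      by_contra hlt
      have ha : (a : ℕ) - 1 = 0 := by omega
      have h2 := congrArg List.getLast? h
      rw [getLast_cons_concat] at h2
      simp [indexWord, letterWord, ha] at h2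
  · rw [Submodule.span_le]
    rintro _ ⟨k, hk, rfl⟩
    exact indexWord_mem_H0 hk

theorem Admissible.tail {a : ℕ+} {k : List ℕ+} (h : Admissible (a :: k)) : Admissible k := by
  cases k with
  | nil => simp [Admissible]
  | cons b k => simpa [Admissible, List.getLast?_cons_cons] using h

theorem harmIndex_mem (c : ℚ) (v w : List ℕ+) (hv : Admissible v) (hw : Admissible w)
    (hvw : v ≠ [] ∨ w ≠ []) : (harmIndex c v w : H) ∈ e1He0 := by
  fun_induction harmIndex c v w with
  | case1 w => exact indexWord_mem_e1He0 hw (by simpa using hvw)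
  | case2 k v => exact indexWord_mem_e1He0 hv (by simp)
  | case3 k v l w ih1 ih2 ih3 =>
    refine add_mem (add_mem ?_ ?_) (e1He0.smul_mem c ?_)
    · exact eK_mul_mem_e1He0 k (ih1 hv.tail hw (by simp))
    · exact eK_mul_mem_e1He0 l (ih2 hv hw.tail (by simp))
    · by_cases h : v ≠ [] ∨ w ≠ []
      · exact eK_mul_mem_e1He0 _ (ih3 hv.tail hw.tail h)
      · push Not at h
        obtain ⟨rfl, rfl⟩ := h
        have h1 := k.pos
        have h2 := l.pos
        have h3 : Admissible [k + l] := by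
          intro a ha
          obtain rfl : k + l = a := by simpa using ha
          rw [PNat.add_coe]
          omega
        simpa [harmIndex] using indexWord_mem_e1He0 h3 (by simp)

theorem harm_mem_H0 {x y : H1} (hx : (x : H) ∈ H0) (hy : (y : H) ∈ H0) :
    (harm x y : H) ∈ H0 := by
  have span : ∀ z : H1, (z : H) ∈ H0 → z ∈ Submodule.span ℚ (mono '' {k | Admissible k}) := by
    intro z hz
    rw [H0_eq_span_index] at hz
    have : (fun k => word (indexWord k)) '' {k | Admissible k}
        = H1.subtype '' (mono '' {k | Admissible k}) := by
      rw [Set.image_image]; rfl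
    rw [this, ← Submodule.map_span] at hz
    obtain ⟨z', h, h2⟩ := hz
    rwa [← Subtype.ext h2]
  refine LinearMap.BilinMap.apply_apply_mem_of_mem_span (H0.comap H1.subtype) _ _ harm ?_ x y
    (span x hx) (span y hy)
  rintro _ ⟨v, hv, rfl⟩ _ ⟨w, hw, rfl⟩
  rw [harm, harmWith_mono]
  by_cases h : v ≠ [] ∨ w ≠ []
  · exact Submodule.mem_sup_right (harmIndex_mem 1 v w hv hw h)
  · push Not at h
    obtain ⟨rfl, rfl⟩ := h
    rw [harmIndex]
    exact one_mem_H0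

/-- The harmonic product restricted to `𝔥⁰`. -/
noncomputable def harm0 (x y : H0) : H0 :=
  ⟨harm (incl x) (incl y), harm_mem_H0 (x := incl x) (y := incl y) x.2 y.2⟩

/-! ### Star, circled harmonic product, duals -/

/-- All `2^{r-1}` indices obtained from `(k₁, …, k_r)` by replacing commas by plus signs. -/
def merges : List ℕ+ → List (List ℕ+)
  | [] => [[]]
  | [k] => [[k]]
  | k :: l :: t => (merges (l :: t)).map (k :: ·) ++ merges ((k + l) :: t)
termination_by k => k.length

/-- The linear map `𝐤 ↦ 𝐤^⋆` on `𝔥¹`. -/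
noncomputable def star : H1 →ₗ[ℚ] H1 :=
  indexBasis.constr ℚ fun k => ((merges k).map mono).sum

/-- The circled harmonic product `v e_k ⊛ w e_l = (v * w) e_{k+l}` of two indices;
it is put to be `0` if one of the two is empty. -/
noncomputable def circIndex (k l : List ℕ+) : H0 :=
  match k.getLast?, l.getLast? with
  | some a, some b =>
    ⟨harm (mono k.dropLast) (mono l.dropLast) * eK (a + b),
      Submodule.mem_sup_right (mul_eK_mem_e1He0 (Subtype.prop _)
        (by rw [PNat.add_coe]; exact Nat.add_le_add a.pos b.pos))⟩
  | _, _ => 0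

/-- The circled harmonic product on `e₁ 𝔥`, with values in `e₁ 𝔥 e₀ ⊆ 𝔥⁰`. It is extended to
`𝔥¹ = ℚ ⊕ e₁ 𝔥` by zero on the summand `ℚ`. -/
noncomputable def circ : H1 →ₗ[ℚ] H1 →ₗ[ℚ] H0 :=
  indexBasis.constr ℚ fun k => indexBasis.constr ℚ fun l => circIndex k l

theorem circ_mono (v w : List ℕ+) (a b : ℕ+) :
    (circ (mono (v ++ [a])) (mono (w ++ [b])) : H) = harm (mono v) (mono w) * eK (a + b) := by
  rw [← indexBasis_apply, ← indexBasis_apply, circ, Module.Basis.constr_basis,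
    Module.Basis.constr_basis, circIndex]
  simp

/-- The weight of an index. -/
def weight (k : List ℕ+) : ℕ := (k.map PNat.val).sum

@[simp] theorem weight_nil : weight [] = 0 := rfl

@[simp] theorem weight_cons (a : ℕ+) (k : List ℕ+) : weight (a :: k) = a + weight k := by
  simp [weight]

/-- The set `{k₁, k₁ + k₂, …, k₁ + ⋯ + k_{r-1}}` of an index `(k₁, …, k_r)`. -/
def partialSums (k : List ℕ+) : Finset ℕ :=
  (Finset.Ico 1 k.length).image fun i => weight (k.take i)

/-- `𝐤'` is the Hoffman dual of `𝐤`: the weights agree and `{1, …, wt(𝐤) - 1}` is the disjoint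
union of the two sets of partial sums. -/
def IsHoffmanDual (k k' : List ℕ+) : Prop :=
  weight k' = weight k ∧ Disjoint (partialSums k) (partialSums k') ∧
    partialSums k ∪ partialSums k' = Finset.Ico 1 (weight k)

/-- Adds `1` to the first component of an index. -/
def incHead : List ℕ+ → List ℕ+
  | [] => [1]
  | a :: t => (a + 1) :: t

/-- The Hoffman dual of an index, computed recursively. It is characterised by
`isHoffmanDual_iff`. -/
def hoffmanIndex : List ℕ+ → List ℕ+
  | [] => []
  | k :: l => List.replicate ((k : ℕ) - 1) 1 ++ incHead (hoffmanIndex l)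

theorem length_indexWord (k : List ℕ+) : (indexWord k).length = weight k := by
  induction k with
  | nil => rfl
  | cons a k ih =>
    have := a.pos
    simp only [indexWord_cons, letterWord, List.length_append, List.length_cons,
      List.length_replicate, ih, weight_cons]
    omega

theorem indexWord_getElem?_eq_one (k : List ℕ+) (t : ℕ) :
    (indexWord k)[t]? = some 1 ↔ ∃ i < k.length, t = weight (k.take i) := by
  induction k generalizing t with
  | nil => simp
  | cons a k ih =>
    have ha := a.pos
    have hlen : (letterWord a).length = a := by
      simp only [letterWord, List.length_cons, List.length_replicate]
      omega
    rw [indexWord_cons]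
    by_cases ht : t < a
    · rw [List.getElem?_append_left (by omega)]
      have h1 : (letterWord a)[t]? = some 1 ↔ t = 0 := by
        cases t with
        | zero => simp [letterWord]
        | succ t =>
          simp [letterWord, List.getElem?_replicate]
      rw [h1]
      constructor
      · rintro rfl
        exact ⟨0, by simp, by simp [weight]⟩
      · rintro ⟨i, hi, h⟩
        cases i with
        | zero => simpa [weight] using h
        | succ i =>
          simp only [List.take_succ_cons, weight_cons] at h
          omega
    · rw [List.getElem?_append_right (by omega), hlen, ih]
      constructor
      · rintro ⟨i, hi, h⟩
        refine ⟨i + 1, by simpa using hi, ?_⟩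
        simp only [List.take_succ_cons, weight_cons] at h ⊢
        omega
      · rintro ⟨i, hi, h⟩
        cases i with
        | zero => simp only [List.take_zero, weight_nil] at h; omega
        | succ i =>
          refine ⟨i, by simpa using hi, ?_⟩
          simp only [List.take_succ_cons, weight_cons] at h ⊢
          omega

theorem mem_partialSums {k : List ℕ+} {t : ℕ} (ht : 1 ≤ t) :
    t ∈ partialSums k ↔ (indexWord k)[t]? = some 1 := by
  rw [indexWord_getElem?_eq_one]
  simp only [partialSums, Finset.mem_image, Finset.mem_Ico]
  constructor
  · rintro ⟨i, ⟨-, hi⟩, rfl⟩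
    exact ⟨i, hi, rfl⟩
  · rintro ⟨i, hi, rfl⟩
    refine ⟨i, ⟨?_, hi⟩, rfl⟩
    rcases Nat.eq_zero_or_pos i with rfl | h
    · simp [weight] at ht
    · exact h

theorem one_le_of_mem_partialSums {k : List ℕ+} {t : ℕ} (h : t ∈ partialSums k) : 1 ≤ t := by
  simp only [partialSums, Finset.mem_image, Finset.mem_Ico] at h
  obtain ⟨i, ⟨h1, h2⟩, rfl⟩ := h
  cases k with
  | nil => simp at h2
  | cons a k =>
    obtain ⟨j, rfl⟩ : ∃ j, i = j + 1 := ⟨i - 1, by omega⟩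
    have := a.pos
    simp only [List.take_succ_cons, weight_cons]
    omega

theorem indexWord_hoffmanIndex (a : ℕ+) (l : List ℕ+) :
    indexWord (hoffmanIndex (a :: l)) = 1 :: (indexWord (a :: l)).tail.map (1 - ·) := by
  have hrep : ∀ (n : ℕ) (m : List ℕ+), indexWord (List.replicate n 1 ++ m) =
      List.replicate n 1 ++ indexWord m := by
    intro n m
    induction n with
    | zero => rfl
    | succ n ih => simp [List.replicate_succ, ih, letterWord]
  have hcons : ∀ (n : ℕ) (u : List (Fin 2)),
      List.replicate n (1 : Fin 2) ++ 1 :: u = 1 :: (List.replicate n 1 ++ u) := by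
    intro n u
    induction n with
    | zero => rfl
    | succ n ih => simp [List.replicate_succ, ih]
  have hinc : ∀ (b : ℕ+) (u : List ℕ+), ∃ w, indexWord (b :: u) = 1 :: w ∧
      indexWord (incHead (b :: u)) = 1 :: 0 :: w := by
    intro b u
    obtain ⟨n, hn⟩ := Nat.exists_eq_succ_of_ne_zero b.ne_zero
    refine ⟨_, rfl, ?_⟩
    simp only [incHead, indexWord_cons, letterWord, PNat.add_coe, hn]
    simp [List.replicate_succ]
    rfl
  induction l generalizing a with
  | nil =>
    rw [hoffmanIndex, hrep]
    simp only [hoffmanIndex, incHead, indexWord_cons, indexWord_nil, letterWord]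
    simp
    simpa using hcons ((a : ℕ) - 1) []
  | cons b l ih =>
    rw [hoffmanIndex, hrep]
    obtain ⟨c, u, hcu⟩ : ∃ c u, hoffmanIndex (b :: l) = c :: u := by
      cases h : hoffmanIndex (b :: l) with
      | nil => have := ih b; simp [h] at this
      | cons c u => exact ⟨c, u, rfl⟩
    obtain ⟨w, hw1, hw2⟩ := hinc c u
    have h1 := ih b
    rw [hcu, hw1, List.cons.injEq] at h1
    rw [hcu, hw2, hcons, h1.2]
    simp [letterWord]

/-- `hoffmanIndex k` is the unique index which is a Hoffman dual of `k`. -/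
theorem isHoffmanDual_iff (k k' : List ℕ+) : IsHoffmanDual k k' ↔ k' = hoffmanIndex k := by
  have key : ∀ k', IsHoffmanDual k k' ↔ weight k' = weight k ∧
      ∀ t, 1 ≤ t → t < weight k →
        ((indexWord k')[t]? = some 1 ↔ ¬ (indexWord k)[t]? = some 1) := by
    intro k'
    have hlt : ∀ k : List ℕ+, ∀ t ∈ partialSums k, t < weight k := by
      intro k t ht
      have := (mem_partialSums (one_le_of_mem_partialSums ht)).1 ht
      rw [← length_indexWord]
      exact (List.getElem?_eq_some_iff.1 this).1
    refine and_congr_right fun hw => ⟨?_, ?_⟩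
    · rintro ⟨hd, hu⟩ t h1 h2
      rw [← mem_partialSums h1, ← mem_partialSums h1]
      have := Finset.ext_iff.1 hu t
      simp only [Finset.mem_union, Finset.mem_Ico] at this
      exact ⟨fun h h' => Finset.disjoint_left.1 hd h' h,
        fun h => (this.2 ⟨h1, h2⟩).resolve_left h⟩
    · intro h
      constructor
      · rw [Finset.disjoint_left]
        intro t ht ht'
        have h1 := one_le_of_mem_partialSums ht
        have := h t h1 (hlt k t ht)
        rw [← mem_partialSums h1, ← mem_partialSums h1] at this
        exact (this.1 ht') ht
      · ext t
        simp only [Finset.mem_union, Finset.mem_Ico]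
        constructor
        · rintro (ht | ht)
          · exact ⟨one_le_of_mem_partialSums ht, hlt k t ht⟩
          · exact ⟨one_le_of_mem_partialSums ht, hw ▸ hlt k' t ht⟩
        · rintro ⟨h1, h2⟩
          have := h t h1 h2
          rw [← mem_partialSums h1, ← mem_partialSums h1] at this
          tauto
  have hdual : IsHoffmanDual k (hoffmanIndex k) := by
    rw [key]
    cases k with
    | nil => simp [hoffmanIndex, weight]
    | cons a l =>
      have h := indexWord_hoffmanIndex a l
      have hne : indexWord (a :: l) = 1 :: (indexWord (a :: l)).tail := by simp [letterWord]
      constructor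
      · rw [← length_indexWord, h, ← length_indexWord]
        conv_rhs => rw [hne]
        simp
      · intro t h1 h2
        obtain ⟨s, rfl⟩ : ∃ s, t = s + 1 := ⟨t - 1, by omega⟩
        rw [h]
        rw [← length_indexWord] at h2
        rw [hne] at h2 ⊢
        generalize (indexWord (a :: l)).tail = u at h2
        simp only [List.length_cons, Nat.add_lt_add_iff_right] at h2
        simp only [List.getElem?_cons_succ, List.getElem?_map, List.getElem?_eq_getElem h2,
          List.tail_cons, Option.map_some, Option.some.injEq]
        generalize u[s] = x
        revert x
        decide
  constructor
  · intro h
    rw [key] at h hdual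
    apply indexWord_injective
    apply List.ext_getElem?
    intro t
    have hlen : (indexWord k').length = (indexWord (hoffmanIndex k)).length := by
      rw [length_indexWord, length_indexWord, h.1, hdual.1]
    by_cases ht : t < (indexWord k').length
    · have ht' := hlen ▸ ht
      have hone : (indexWord k')[t]? = some 1 ↔ (indexWord (hoffmanIndex k))[t]? = some 1 := by
        rcases Nat.eq_zero_or_pos t with rfl | hpos
        · have : ∀ m : List ℕ+, 0 < (indexWord m).length → (indexWord m)[0]? = some 1 := by
            intro m hm
            cases m with
            | nil => simp at hm
            | cons => simp [letterWord]
          simp only [this _ ht, this _ ht']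
        · have htw : t < weight k := by rw [← h.1, ← length_indexWord]; exact ht
          rw [h.2 t hpos htw, hdual.2 t hpos htw]
      rw [List.getElem?_eq_getElem ht, List.getElem?_eq_getElem ht'] at hone ⊢
      simp only [Option.some.injEq] at hone ⊢
      generalize (indexWord k')[t] = x at hone
      generalize (indexWord (hoffmanIndex k))[t] = y at hone
      revert x y
      decide
    · rw [List.getElem?_eq_none (by omega), List.getElem?_eq_none (by omega)]
  · rintro rfl
    exact hdual

/-- The linear extension `𝐤 ↦ 𝐤^∨` of the Hoffman dual to `𝔥¹`. -/
noncomputable def hoffman : H1 →ₗ[ℚ] H1 :=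
  indexBasis.constr ℚ fun k => mono (hoffmanIndex k)

/-- The anti-automorphism `†` of `𝔥` which interchanges `e₀` and `e₁`. -/
noncomputable def dagger : H →ₗ[ℚ] H :=
  (MulOpposite.opLinearEquiv ℚ).symm.toLinearMap ∘ₗ
    (FreeAlgebra.lift ℚ fun a : Fin 2 => MulOpposite.op (e (1 - a))).toLinearMap

theorem dagger_e (a : Fin 2) : dagger (e a) = e (1 - a) := by
  simp [dagger, e]

theorem dagger_one : dagger 1 = 1 := by
  simp [dagger]

theorem dagger_mul (x y : H) : dagger (x * y) = dagger y * dagger x := by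
  simp [dagger]

theorem dagger_mem_H0 {x : H} (hx : x ∈ H0) : dagger x ∈ H0 := by
  obtain ⟨c, hc, y, hy, rfl⟩ := Submodule.mem_sup.1 hx
  obtain ⟨z, rfl⟩ := mem_e1He0.1 hy
  obtain ⟨q, rfl⟩ := Submodule.mem_one.1 hc
  rw [map_add]
  refine Submodule.add_mem_sup ?_ (mem_e1He0.2 ⟨dagger z, ?_⟩)
  · rw [Algebra.algebraMap_eq_smul_one, map_smul, dagger_one]
    exact Submodule.smul_mem _ _ (Submodule.one_le.1 le_rfl)
  · rw [dagger_mul, dagger_mul, dagger_e, dagger_e, mul_assoc]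
    rfl

/-- The anti-automorphism `†` restricted to `𝔥⁰`. -/
noncomputable def dagger0 (x : H0) : H0 := ⟨dagger x, dagger_mem_H0 x.2⟩

/-! ### 2-posets -/

/-- A 2-poset: a finite poset whose elements are labelled by `0` and `1`. -/
structure TwoPoset where
  /-- the underlying set -/
  carrier : Type
  [fintype : Fintype carrier]
  [order : PartialOrder carrier]
  /-- the label map -/
  label : carrier → Fin 2

attribute [instance] TwoPoset.fintype TwoPoset.order

/-- A 2-poset is admissible if its maximal elements have label `0` and its minimal elements have
label `1`. -/
def TwoPoset.Admissible (X : TwoPoset) : Prop :=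
  (∀ x : X.carrier, IsMax x → X.label x = 0) ∧ (∀ x : X.carrier, IsMin x → X.label x = 1)

open Classical in
/-- The linear extensions of the order of a 2-poset, as increasing enumerations
`x₀, x₁, …, x_{n-1}` of its elements. -/
noncomputable def TwoPoset.linearExtensions (X : TwoPoset) :
    Finset (Fin (Fintype.card X.carrier) ≃ X.carrier) :=
  Finset.univ.filter fun σ => ∀ i j, σ i ≤ σ j → i ≤ j

/-- The element `W(X)` of `𝔥`: the sum of the words `e_{δ(x₀)} e_{δ(x₁)} ⋯ e_{δ(x_{n-1})}` over all
linear extensions `x₀ < x₁ < ⋯ < x_{n-1}` of the order of `X`. -/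
noncomputable def TwoPoset.W (X : TwoPoset) : H :=
  ∑ σ ∈ X.linearExtensions, word (List.ofFn fun i => X.label (σ i))

theorem TwoPoset.W_mem_H0 {X : TwoPoset} (hX : X.Admissible) : X.W ∈ H0 := by
  refine sum_mem fun σ hσ => ?_
  have hσ : ∀ i j, σ i ≤ σ j → i ≤ j := by
    simpa [TwoPoset.linearExtensions] using hσ
  rcases Nat.eq_zero_or_pos (Fintype.card X.carrier) with h0 | hpos
  · have : List.ofFn (fun i => X.label (σ i)) = [] := by
      rw [← List.length_eq_zero_iff, List.length_ofFn, h0]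
    rw [this]
    exact one_mem_H0
  · have hhead : X.label (σ ⟨0, hpos⟩) = 1 := by
      refine hX.2 _ fun y hy => ?_
      obtain ⟨j, rfl⟩ := σ.surjective y
      have h := hσ _ _ hy
      have : j = ⟨0, hpos⟩ := Fin.ext (Nat.le_zero.1 h)
      rw [this]
    have hlast : X.label (σ ⟨Fintype.card X.carrier - 1, by omega⟩) = 0 := by
      refine hX.1 _ fun y hy => ?_
      obtain ⟨j, rfl⟩ := σ.surjective y
      have h := hσ _ _ hy
      have : j = ⟨Fintype.card X.carrier - 1, by omega⟩ :=
        Fin.ext (le_antisymm (Nat.le_sub_one_of_lt j.2) h)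
      rw [this]
    have key : ∀ u : List (Fin 2), u.head? = some 1 → u.getLast? = some 0 → word u ∈ H0 := by
      intro u h1 h2
      match u, h1 with
      | 1 :: u, _ =>
        rcases List.eq_nil_or_concat u with rfl | ⟨v, a, rfl⟩
        · simp at h2
        · have ha : a = 0 := by
            rw [List.concat_eq_append, ← List.cons_append, List.getLast?_append] at h2
            simpa using h2
          exact Submodule.mem_sup_right (mem_e1He0.2 ⟨word v, by simp [ha]⟩)
    apply key
    · rw [List.head?_eq_getElem?, List.getElem?_ofFn, dif_pos hpos, hhead]
    · rw [List.getLast?_eq_getElem?, List.length_ofFn, List.getElem?_ofFn, dif_pos (by omega),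
        hlast]

/-- The relation `x_i ≤ x_j` in a zigzag `x₀, x₁, …, x_{n-1}`, where `x_t` lies above `x_{t-1}` if
`up t` is true and below `x_{t-1}` otherwise. -/
def zigzagLE (up : ℕ → Bool) (i j : ℕ) : Prop :=
  (i ≤ j ∧ ∀ t, i < t → t ≤ j → up t = true) ∨ (j ≤ i ∧ ∀ t, j < t → t ≤ i → up t = false)

/-- The partial order generated by the steps of a zigzag: two elements `x_i`, `x_j` are comparable
if and only if all steps between them go in the same direction. -/
abbrev zigzagOrder (n : ℕ) (up : ℕ → Bool) : PartialOrder (Fin n) where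
  le i j := zigzagLE up i j
  lt i j := zigzagLE up i j ∧ ¬ zigzagLE up j i
  le_refl i := Or.inl ⟨le_rfl, fun t h1 h2 => by omega⟩
  le_trans i j k := by
    rintro (⟨h1, h2⟩ | ⟨h1, h2⟩) (⟨h3, h4⟩ | ⟨h3, h4⟩)
    · exact Or.inl ⟨by omega, fun t ht1 ht2 => by
        by_cases h : t ≤ j.1
        · exact h2 t ht1 h
        · exact h4 t (by omega) ht2⟩
    · by_cases h : i.1 = j.1
      · exact Or.inr ⟨by omega, fun t ht1 ht2 => h4 t ht1 (by omega)⟩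
      · by_cases h' : j.1 = k.1
        · exact Or.inl ⟨by omega, fun t ht1 ht2 => h2 t ht1 (by omega)⟩
        · have ha := h2 j.1 (by omega) le_rfl
          have hb := h4 j.1 (by omega) le_rfl
          simp [ha] at hb
    · by_cases h : i.1 = j.1
      · exact Or.inl ⟨by omega, fun t ht1 ht2 => h4 t (by omega) ht2⟩
      · by_cases h' : j.1 = k.1
        · exact Or.inr ⟨by omega, fun t ht1 ht2 => h2 t (by omega) ht2⟩
        · have ha := h2 (j.1 + 1) (by omega) (by omega)
          have hb := h4 (j.1 + 1) (by omega) (by omega)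
          simp [ha] at hb
    · exact Or.inr ⟨by omega, fun t ht1 ht2 => by
        by_cases h : t ≤ j.1
        · exact h4 t ht1 h
        · exact h2 t (by omega) ht2⟩
  le_antisymm i j := by
    rintro (⟨h1, h2⟩ | ⟨h1, h2⟩) (⟨h3, h4⟩ | ⟨h3, h4⟩)
    · exact Fin.ext (le_antisymm h1 h3)
    · by_contra hne
      have hne : i.1 ≠ j.1 := fun h => hne (Fin.ext h)
      have ha := h2 j.1 (by omega) le_rfl
      have hb := h4 j.1 (by omega) le_rfl
      simp [ha] at hb
    · by_contra hne
      have hne : i.1 ≠ j.1 := fun h => hne (Fin.ext h)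
      have ha := h2 i.1 (by omega) le_rfl
      have hb := h4 i.1 (by omega) le_rfl
      simp [ha] at hb
    · exact Fin.ext (le_antisymm h3 h1)

/-- The 2-poset drawn by a zigzag diagram. The diagram is the list of its vertices from left to
right; a vertex is given by its label and by whether it lies above (`true`) or below (`false`) its
left neighbour. (The second entry of the first vertex plays no role.) -/
def zigzag (D : List (Fin 2 × Bool)) : TwoPoset where
  carrier := Fin D.length
  fintype := inferInstance
  order := zigzagOrder D.length fun i => (D[i]?.map Prod.snd).getD true
  label := fun i => D[i].1

/-- The totally ordered diagram of `𝐤 = (k₁, …, k_r)`: going upwards,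
one `•` and `k₁ - 1` times `∘`, …, one `•` and `k_r - 1` times `∘`. -/
def roundDiagram (k : List ℕ+) : List (Fin 2 × Bool) :=
  k.flatMap fun a => (1, true) :: List.replicate ((a : ℕ) - 1) (0, true)

/-- The blocks of a star diagram: each is a `•` below its left neighbour followed, going upwards,
by `∘`s. -/
def squareBlocks (l : List ℕ+) : List (Fin 2 × Bool) :=
  l.flatMap fun a => (1, false) :: List.replicate ((a : ℕ) - 1) (0, true)

/-- The diagram of `μ(𝐤, 𝐥)` for the *reversed* index `(l_s, …, l₁)` as second argument: the
totally ordered diagram of `𝐤`, continued upwards by `l_s` times `∘`, and then by the blocks of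
`l_{s-1}, …, l₁`. -/
def muDiagram (k : List ℕ+) : List ℕ+ → List (Fin 2 × Bool)
  | [] => roundDiagram k
  | a :: t => roundDiagram k ++ (List.replicate (a : ℕ) (0, true) ++ squareBlocks t)

/-- The 2-poset whose image under `W` is `μ(𝐤, 𝐥)`. -/
def muPoset (k l : List ℕ+) : TwoPoset := zigzag (muDiagram k l.reverse)

theorem zigzag_admissible (P Q : List (Fin 2 × Bool)) (hP : ∀ v ∈ P, v.2 = true)
    (hP1 : ∀ v ∈ P.head?, v.1 = 1) (hP2 : P ≠ []) (hQ : ∀ v ∈ Q, v ≠ (1, true))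
    (hQ0 : ∀ v ∈ Q, v.1 = 0 → v.2 = true) (hQ1 : ∃ v ∈ Q.head?, v.2 = true) :
    (zigzag (P ++ Q)).Admissible := by
  have hup : ∀ v ∈ P ++ Q, v.1 = 0 → v.2 = true := by
    intro v hv h
    rcases List.mem_append.1 hv with h' | h'
    · exact hP v h'
    · exact hQ0 v h' h
  constructor
  · intro (i : Fin (P ++ Q).length) hi
    by_contra hne
    change ¬ (P ++ Q)[i].1 = 0 at hne
    have hone : (P ++ Q)[i].1 = 1 := by
      generalize (P ++ Q)[i].1 = a at hne
      omega
    have hlen : i.1 < P.length + Q.length := List.length_append ▸ i.2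
    by_cases hiP : i.1 < P.length
    · obtain ⟨v, hv, hv2⟩ := hQ1
      have hQpos : 0 < Q.length := by
        cases Q with
        | nil => simp at hv
        | cons => simp
      let j : Fin (P ++ Q).length := ⟨i.1 + 1, by
        have : (P ++ Q).length = P.length + Q.length := List.length_append
        omega⟩
      have hj : (P ++ Q)[i.1 + 1]?.map Prod.snd = some true := by
        by_cases h : i.1 + 1 < P.length
        · rw [List.getElem?_append_left h, List.getElem?_eq_getElem h]
          simp [hP _ (List.getElem_mem h)]
        · have : i.1 + 1 - P.length = 0 := by omega
          rw [List.getElem?_append_right (by omega), this, ← List.head?_eq_getElem?]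
          rw [Option.mem_def.1 hv]
          simp [hv2]
      have hle := hi (b := j) (Or.inl ⟨Nat.le_succ _, fun t h1 h2 => by
        obtain rfl : t = i.1 + 1 := by
          change t ≤ i.1 + 1 at h2
          omega
        simp only [hj, Option.getD_some]⟩)
      have hlt : i.1 < j.1 := Nat.lt_succ_self _
      rcases hle with ⟨h1, -⟩ | ⟨-, h1⟩
      · omega
      · have := h1 (i.1 + 1) (by omega) le_rfl
        simp [hj] at this
    · have hdown : ((P ++ Q)[i.1]?.map Prod.snd) = some false := by
        have hmem : (P ++ Q)[i.1]? = some (P ++ Q)[i] := List.getElem?_eq_getElem i.2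
        have hQm : (P ++ Q)[i] ∈ Q := by
          have : (P ++ Q)[i] = Q[i.1 - P.length] := List.getElem_append_right (by omega)
          rw [this]
          exact List.getElem_mem _
        have := hQ _ hQm
        rw [hmem]
        rcases h : (P ++ Q)[i] with ⟨a, b⟩
        rw [h] at this hone
        simp only at hone
        subst hone
        cases b <;> simp_all
      have hP' : 0 < P.length := List.length_pos_iff.2 hP2
      let j : Fin (P ++ Q).length := ⟨i.1 - 1, by omega⟩
      have hji : j.1 = i.1 - 1 := rfl
      have hle := hi (b := j) (Or.inr ⟨by omega, fun t h1 h2 => by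
        obtain rfl : t = i.1 := by omega
        simp only [hdown, Option.getD_some]⟩)
      rcases hle with ⟨-, h1⟩ | ⟨h1, -⟩
      · have := h1 i.1 (by omega) le_rfl
        simp [hdown] at this
      · omega
  · intro (i : Fin (P ++ Q).length) hi
    by_contra hne
    change ¬ (P ++ Q)[i].1 = 1 at hne
    have hzero : (P ++ Q)[i].1 = 0 := by
      generalize (P ++ Q)[i].1 = a at hne
      omega
    have hmem : (P ++ Q)[i.1]? = some (P ++ Q)[i] := List.getElem?_eq_getElem i.2
    have hui : ((P ++ Q)[i.1]?.map Prod.snd) = some true := by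
      have h2 : (P ++ Q)[i].2 = true := hup _ (List.getElem_mem _) hzero
      rw [hmem, Option.map_some, h2]
    have hpos : 0 < i.1 := by
      by_contra h0
      have h0 : i.1 = 0 := by omega
      have hh : P.head? = some (P ++ Q)[i] := by
        rw [← hmem, h0, ← List.head?_eq_getElem?, List.head?_append_of_ne_nil _ hP2]
      exact hne (hP1 _ hh)
    let j : Fin (P ++ Q).length := ⟨i.1 - 1, by omega⟩
    have hji : j.1 = i.1 - 1 := rfl
    have hle := hi (b := j) (Or.inl ⟨by omega, fun t h1 h2 => by
      obtain rfl : t = i.1 := by omega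
      simp only [hui, Option.getD_some]⟩)
    rcases hle with ⟨h1, -⟩ | ⟨-, h1⟩
    · omega
    · have := h1 i.1 (by omega) le_rfl
      simp [hui] at this

theorem muPoset_admissible {k l : List ℕ+} (hk : k ≠ []) (hl : l ≠ []) :
    (muPoset k l).Admissible := by
  rw [muPoset]
  obtain ⟨a, t, h⟩ := List.exists_cons_of_ne_nil (List.reverse_ne_nil_iff.2 hl)
  rw [h, muDiagram]
  obtain ⟨n, hn⟩ := Nat.exists_eq_succ_of_ne_zero a.ne_zero
  obtain ⟨b, u, rfl⟩ := List.exists_cons_of_ne_nil hk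
  refine zigzag_admissible _ _ ?_ ?_ ?_ ?_ ?_ ?_
  · intro v hv
    simp only [roundDiagram, List.mem_flatMap, List.mem_cons, List.mem_replicate] at hv
    obtain ⟨c, -, rfl | ⟨-, rfl⟩⟩ := hv <;> rfl
  · simp [roundDiagram]
  · simp [roundDiagram]
  · intro v hv
    simp only [squareBlocks, List.mem_append, List.mem_flatMap, List.mem_cons,
      List.mem_replicate] at hv
    rcases hv with ⟨-, rfl⟩ | ⟨c, -, rfl | ⟨-, rfl⟩⟩ <;> simp
  · intro v hv
    simp only [squareBlocks, List.mem_append, List.mem_flatMap, List.mem_cons,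
      List.mem_replicate] at hv
    rcases hv with ⟨-, rfl⟩ | ⟨c, -, rfl | ⟨-, rfl⟩⟩ <;> simp
  · exact ⟨(0, true), by simp [hn, List.replicate_succ], rfl⟩

/-- The element `μ(𝐤, 𝐥)` of `𝔥⁰` for non-empty indices `𝐤`, `𝐥`. -/
noncomputable def mu (k l : List ℕ+) (hk : k ≠ []) (hl : l ≠ []) : H0 :=
  ⟨(muPoset k l).W, TwoPoset.W_mem_H0 (muPoset_admissible hk hl)⟩

/-! ### Properties of a linear map `Z : 𝔥⁰ → ℝ` -/

/-- The double shuffle relation: `Z` is a (unital) algebra homomorphism for both products. -/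
structure DoubleShuffle (Z : H0 →ₗ[ℚ] ℝ) : Prop where
  map_one : Z ⟨1, one_mem_H0⟩ = 1
  map_shuffle : ∀ v w : H0, Z (shuffle0 v w) = Z v * Z w
  map_harm : ∀ v w : H0, Z (harm0 v w) = Z v * Z w

/-- `f` is a homomorphism of `ℚ`-algebras from `𝔥¹` with the shuffle product to `ℝ[T]` which extends
`Z` and sends `e₁` to `T`. -/
structure IsShuffleReg (Z : H0 →ₗ[ℚ] ℝ) (f : H1 →ₗ[ℚ] Polynomial ℝ) : Prop where
  map_one : f (mono []) = 1
  map_mul : ∀ v w : H1, f (shuffle1 v w) = f v * f w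
  extends_Z : ∀ x : H0, f (incl x) = Polynomial.C (Z x)
  map_e1 : f (mono [1]) = Polynomial.X

/-- `f` is a homomorphism of `ℚ`-algebras from `𝔥¹` with the harmonic product to `ℝ[T]` which
extends `Z` and sends `e₁` to `T`. -/
structure IsHarmReg (Z : H0 →ₗ[ℚ] ℝ) (f : H1 →ₗ[ℚ] Polynomial ℝ) : Prop where
  map_one : f (mono []) = 1
  map_mul : ∀ v w : H1, f (harm v w) = f v * f w
  extends_Z : ∀ x : H0, f (incl x) = Polynomial.C (Z x)
  map_e1 : f (mono [1]) = Polynomial.X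

/-- The shuffle regularization of `Z`: for `Z` with the double shuffle relation, the unique map
with the property `IsShuffleReg Z`. -/
noncomputable def shuffleReg (Z : H0 →ₗ[ℚ] ℝ) : H1 →ₗ[ℚ] Polynomial ℝ :=
  Classical.epsilon (IsShuffleReg Z)

/-- The harmonic regularization of `Z`: for `Z` with the double shuffle relation, the unique map
with the property `IsHarmReg Z`. -/
noncomputable def harmReg (Z : H0 →ₗ[ℚ] ℝ) : H1 →ₗ[ℚ] Polynomial ℝ :=
  Classical.epsilon (IsHarmReg Z)

theorem admissible_singleton {n : ℕ} (h : 2 ≤ n) : Admissible [⟨n, by omega⟩] := by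
  intro a ha
  obtain rfl : (⟨n, by omega⟩ : ℕ+) = a := Option.some.inj ha
  exact h

/-- The power series `∑_{n ≥ 2} (-1)^n / n · Z(e_n) u^n`. -/
noncomputable def logA (Z : H0 →ₗ[ℚ] ℝ) : PowerSeries ℝ :=
  PowerSeries.mk fun n => if h : 2 ≤ n then
    (-1) ^ n / n * Z ⟨word (indexWord [⟨n, by omega⟩]), indexWord_mem_H0 (admissible_singleton h)⟩
  else 0

/-- `A_Z(u) = exp (∑_{n ≥ 2} (-1)^n / n · Z(e_n) u^n)`. -/
noncomputable def A (Z : H0 →ₗ[ℚ] ℝ) : PowerSeries ℝ :=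
  PowerSeries.subst (logA Z) (PowerSeries.exp ℝ)

theorem hasSubst_logA (Z : H0 →ₗ[ℚ] ℝ) : PowerSeries.HasSubst (logA Z) :=
  PowerSeries.HasSubst.of_constantCoeff_zero' (by simp [logA])

/-- The `ℝ`-linear map `ρ_Z` on `ℝ[T]` determined by `ρ_Z(e^{Tu}) = A_Z(u) e^{Tu}`, that is, by
`ρ_Z(T^n / n!) = ∑_{i+j=n} a_i T^j / j!`, where `A_Z(u) = ∑ a_i u^i`. -/
noncomputable def rho (Z : H0 →ₗ[ℚ] ℝ) : Polynomial ℝ →ₗ[ℝ] Polynomial ℝ :=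
  (Polynomial.basisMonomials ℝ).constr ℝ fun n =>
    (n.factorial : ℝ) • ∑ p ∈ Finset.HasAntidiagonal.antidiagonal n,
      (PowerSeries.coeff p.1 (A Z) / (p.2.factorial : ℝ)) • (Polynomial.X : Polynomial ℝ) ^ p.2

/-- The power series `e^{Tu}` in `ℝ[T][[u]]`. -/
noncomputable def expT : PowerSeries (Polynomial ℝ) :=
  PowerSeries.mk fun n => ((n.factorial : ℝ)⁻¹) • (Polynomial.X : Polynomial ℝ) ^ n

/-- The coefficientwise identity `ρ_Z(e^{Tu}) = A_Z(u) e^{Tu}`. -/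
theorem rho_expT (Z : H0 →ₗ[ℚ] ℝ) :
    PowerSeries.mk (fun n => rho Z (PowerSeries.coeff n expT)) =
      PowerSeries.map Polynomial.C (A Z) * expT := by
  ext1 n
  have h : rho Z (Polynomial.X ^ n) = (n.factorial : ℝ) • ∑ p ∈ Finset.HasAntidiagonal.antidiagonal n,
      (PowerSeries.coeff p.1 (A Z) / (p.2.factorial : ℝ)) •
        (Polynomial.X : Polynomial ℝ) ^ p.2 := by
    have hX : (Polynomial.X : Polynomial ℝ) ^ n = Polynomial.basisMonomials ℝ n := by
      rw [Polynomial.coe_basisMonomials, Polynomial.X_pow_eq_monomial]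
    rw [hX, rho, Module.Basis.constr_basis]
  have hn : (n.factorial : ℝ) ≠ 0 := Nat.cast_ne_zero.2 n.factorial_ne_zero
  rw [PowerSeries.coeff_mk, PowerSeries.coeff_mul, expT, PowerSeries.coeff_mk, map_smul, h,
    smul_smul, inv_mul_cancel₀ hn, one_smul]
  refine Finset.sum_congr rfl fun p _ => ?_
  rw [PowerSeries.coeff_map, PowerSeries.coeff_mk, ← Polynomial.smul_eq_C_mul, smul_smul,
    div_eq_mul_inv]

/-- The regularization theorem for `Z`: `Z_ш(𝐤; T) = ρ_Z(Z_*(𝐤; T))` for all indices `𝐤`. -/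
def Reg (Z : H0 →ₗ[ℚ] ℝ) : Prop :=
  ∀ k : List ℕ+, shuffleReg Z (mono k) = rho Z (harmReg Z (mono k))

/-- The integral-series identity for `Z`: `Z(μ(𝐤, 𝐥)) = Z(𝐤 ⊛ 𝐥^⋆)` for all non-empty indices. -/
def IntSer (Z : H0 →ₗ[ℚ] ℝ) : Prop :=
  ∀ (k l : List ℕ+) (hk : k ≠ []) (hl : l ≠ []),
    Z (mu k l hk hl) = Z (circ (mono k) (star (mono l)))

/-- The duality relation for `Z`. -/
def Duality (Z : H0 →ₗ[ℚ] ℝ) : Prop := ∀ w : H0, Z w = Z (dagger0 w)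

/-- The functional `x ↦ Z((1, …, 1) ⊛ (x^∨)^⋆)`, with `m` ones, on `𝔥¹`. -/
noncomputable def kawashimaTerm (Z : H0 →ₗ[ℚ] ℝ) (m : ℕ) (x : H1) : ℝ :=
  Z (circ (mono (List.replicate m 1)) (star (hoffman x)))

/-- Kawashima's relation for `Z`. -/
def Kawashima (Z : H0 →ₗ[ℚ] ℝ) : Prop :=
  ∀ (k l : List ℕ+) (m : ℕ), k ≠ [] → l ≠ [] → 1 ≤ m →
    ∑ p ∈ (Finset.HasAntidiagonal.antidiagonal m).filter (fun p => 1 ≤ p.1 ∧ 1 ≤ p.2),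
        kawashimaTerm Z p.1 (mono k) * kawashimaTerm Z p.2 (mono l) =
      -kawashimaTerm Z m (starHarm (mono k) (mono l))

end MZV

/-! Functions on indices form an algebra under the convolution `conv`, dual to deconcatenation. Let
f_ш and f_* be the constant terms of Z_ш and Z_* (`shuffleFn`, `harmFn`), and let f^- be the twist
of f by (-1)^length. Removing a trailing e₁ is a derivation of 𝔥¹ for both products; its kernel is
𝔥⁰, and both regularizations turn it into d/dT. Since ρ_Z = A_Z(d/dT), Reg says exactly that f_ш =
f_* ⋆ α, where α is supported on the indices (1, …, 1) and takes the coefficients of A_Z as values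
there (`reg_iff`).

The inverse of f_*^- is σ_*, the value of f_* at the star of the reversed index; the inverse of
f_ш^- is σ_ш, the value at the zigzag `squareBlocks` (`conv_star_eq_one`,
`conv_squareBlocks_eq_one`). The recursions behind this also compute both sides of Int-Ser. If k =
(u, a) and the reversal of l is (b, t), put c = a + b; then the two sides are f(u, c, ·)^- ⋆ σ at t,
with (f_ш, σ_ш) for the integral and (f_*, σ_*) for the series (`map_mu`, `map_joinMul_star`). Here
c ranges over all integers at least 2.

If Reg holds, then f_ш(u, c, ·) = f_*(u, c, ·) ⋆ α because α vanishes on indices containing c, and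
α^- ⋆ σ_ш = σ_*; so the two sides agree. Conversely, put β = σ_* ⋆ f_ш^-. Int-Ser forces β to vanish
on every index with a component different from 1. On (1, …, 1) it is determined by f_ш(1, …, 1) = 0
and Newton's identity (`mk_ones_mul_A`). Hence β = α^-, which is Reg.

For Kawashima's relation, Int-Ser and duality turn Z((1, …, 1) ⊛ (k^∨)^⋆), with p ones, into the
value of a dual zigzag. Up to sign it is the coefficient of u^p in (f_ш ∘ exp(uδ))^- ⋆ σ_ш at the
reversal of k, where δ is the derivation e_k ↦ k e_{k+1} of the harmonic product; the link is δ(e₁y)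
= e₁(e₀ ш y). As δ is also a coderivation and α ∘ δ = 0, Reg allows ш to be replaced by *. Now f_* ∘
exp(uδ) is a character of *, the sign twist makes it a character of the star version, and such
characters are closed under convolution, inversion and reversal. Multiplicativity of the resulting
generating series is Kawashima's relation. -/

namespace MZV

/-! ### Convolution of functions on words -/

section Conv

variable {S R : Type*} [CommRing R]

/-- The sum of `B l' l''` over all decompositions `l = l' ++ l''`. -/
def splitSum (B : List S → List S → R) : List S → R
  | [] => B [] []
  | a :: l => B [] (a :: l) + splitSum (fun x y => B (a :: x) y) l

theorem splitSum_add (B C : List S → List S → R) (l : List S) :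
    splitSum (fun x y => B x y + C x y) l = splitSum B l + splitSum C l := by
  induction l generalizing B C with
  | nil => rfl
  | cons a l ih => simp only [splitSum, ih]; ring

theorem mul_splitSum (r : R) (B : List S → List S → R) (l : List S) :
    splitSum (fun x y => r * B x y) l = r * splitSum B l := by
  induction l generalizing B with
  | nil => rfl
  | cons a l ih => simp only [splitSum, ih]; ring

theorem splitSum_mul (r : R) (B : List S → List S → R) (l : List S) :
    splitSum (fun x y => B x y * r) l = splitSum B l * r := by
  simp only [mul_comm _ r, mul_splitSum]

/-- The convolution product `(f ⋆ g)(l) = ∑ f(l') g(l'')` over all `l = l' ++ l''`. -/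
def conv (f g : List S → R) (l : List S) : R := splitSum (fun x y => f x * g y) l

@[simp] theorem conv_nil (f g : List S → R) : conv f g [] = f [] * g [] := rfl

theorem conv_cons (f g : List S → R) (a : S) (l : List S) :
    conv f g (a :: l) = f [] * g (a :: l) + conv (fun w => f (a :: w)) g l := rfl

theorem conv_add_left (f₁ f₂ g : List S → R) (l : List S) :
    conv (fun w => f₁ w + f₂ w) g l = conv f₁ g l + conv f₂ g l := by
  simp only [conv, add_mul, splitSum_add]

theorem conv_mul_left (r : R) (f g : List S → R) (l : List S) :
    conv (fun w => r * f w) g l = r * conv f g l := by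
  simp only [conv, mul_assoc, mul_splitSum]

theorem conv_neg_left (f g : List S → R) (l : List S) :
    conv (fun w => -f w) g l = -conv f g l := by
  simpa using conv_mul_left (-1) f g l

theorem conv_mul_right (r : R) (f g : List S → R) (l : List S) :
    conv f (fun w => r * g w) l = r * conv f g l := by
  simp only [conv, mul_left_comm _ r, mul_splitSum]

theorem conv_sub_right (f g₁ g₂ : List S → R) (l : List S) :
    conv f (fun w => g₁ w - g₂ w) l = conv f g₁ l - conv f g₂ l := by
  have := splitSum_add (fun x y => f x * (g₁ y - g₂ y)) (fun x y => f x * g₂ y) l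
  simp only [← mul_add, sub_add_cancel] at this
  rw [conv, conv, conv, this, add_sub_cancel_right]

theorem conv_assoc (f g h : List S → R) : conv (conv f g) h = conv f (conv g h) := by
  funext l
  induction l generalizing f with
  | nil => simp [mul_assoc]
  | cons a l ih =>
    rw [conv_cons, conv_cons f, ← ih]
    simp only [conv_cons f, conv_add_left, conv_mul_left, conv_nil]
    rw [conv_cons g]
    ring

/-- The unit of the convolution product. -/
def convOne (l : List S) : R := if l = [] then 1 else 0

@[simp] theorem convOne_nil : convOne ([] : List S) = (1 : R) := if_pos rfl

@[simp] theorem convOne_cons (a : S) (l : List S) : convOne (a :: l) = (0 : R) := if_neg (by simp)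

theorem conv_zero_left (g : List S → R) (l : List S) : conv (fun _ => 0) g l = 0 := by
  simpa using conv_mul_left 0 (fun _ => 0) g l

theorem conv_zero_right (f : List S → R) (l : List S) : conv f (fun _ => 0) l = 0 := by
  simpa using conv_mul_right 0 f (fun _ => 0) l

theorem convOne_conv (f : List S → R) : conv convOne f = f := by
  funext l
  cases l with
  | nil => simp
  | cons a l => simp [conv_cons, conv_zero_left]

theorem conv_convOne (f : List S → R) : conv f convOne = f := by
  funext l
  induction l generalizing f with
  | nil => simp
  | cons a l ih => simp [conv_cons, ih]

/-- The decompositions are sorted by whether the marked letter `a` falls into the second or the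
first factor. This isolates a component different from 1 when functions on indices are compared. -/
theorem conv_append (f g : List S → R) (u v : List S) (a : S) :
    conv f g (u ++ a :: v) =
      conv f (fun x => g (x ++ a :: v)) u + conv (fun y => f (u ++ a :: y)) g v := by
  induction u generalizing f with
  | nil => simp [conv_cons]
  | cons b u ih =>
    simp only [List.cons_append, conv_cons, ih]
    ring

theorem conv_concat (f g : List S → R) (u : List S) (a : S) :
    conv f g (u ++ [a]) = conv f (fun x => g (x ++ [a])) u + f (u ++ [a]) * g [] := by
  rw [conv_append, conv_nil]

theorem conv_eq_zero_of_right {h : List S → R} (f : List S → R) (l : List S)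
    (hh : ∀ w : List S, w.length ≤ l.length → h w = 0) : conv f h l = 0 := by
  induction l generalizing f with
  | nil => simp [hh]
  | cons a l ih =>
    rw [conv_cons, hh _ le_rfl, ih _ fun w hw => hh w (hw.trans (Nat.le_succ _))]
    ring

/-- Triangularity: the decomposition with empty first factor contributes `h l`, and all others
involve `h` on shorter words only. -/
theorem eq_zero_of_conv_eq_zero {f h : List S → R} (hf : f [] = 1) (hc : ∀ l, conv f h l = 0)
    (l : List S) : h l = 0 := by
  have key : ∀ n, ∀ w : List S, w.length ≤ n → h w = 0 := by
    intro n
    induction n with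
    | zero =>
      intro w hw
      obtain rfl := List.length_eq_zero_iff.1 (Nat.le_zero.1 hw)
      simpa [hf] using hc []
    | succ n ih =>
      intro w hw
      cases w with
      | nil => exact ih _ (Nat.zero_le _)
      | cons a w =>
        have := hc (a :: w)
        rwa [conv_cons, hf, one_mul, conv_eq_zero_of_right _ _ fun v hv =>
          ih v (hv.trans (Nat.le_of_succ_le_succ hw)), add_zero] at this
  exact key _ l le_rfl

theorem conv_left_cancel {f g h : List S → R} (hf : f [] = 1) (hc : conv f g = conv f h) :
    g = h := by
  funext l
  refine sub_eq_zero.1 (eq_zero_of_conv_eq_zero (h := fun w => g w - h w) hf (fun l => ?_) l)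
  rw [conv_sub_right, hc, sub_self]

/-- Associativity gives f ⋆ (g ⋆ f) = f = f ⋆ 1, and `f` can be cancelled on the left. -/
theorem conv_eq_one_comm {f g : List S → R} (hf : f [] = 1) (hc : conv f g = convOne) :
    conv g f = convOne := by
  refine conv_left_cancel hf ?_
  rw [← conv_assoc, hc, convOne_conv, conv_convOne]

/-- The twist of a function on words by the parity of the length. -/
def signTwist (f : List S → R) (l : List S) : R := (-1) ^ l.length * f l

@[simp] theorem signTwist_nil (f : List S → R) : signTwist f [] = f [] := by simp [signTwist]

theorem signTwist_cons (f : List S → R) (a : S) (l : List S) :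
    signTwist f (a :: l) = -signTwist (fun w => f (a :: w)) l := by
  simp [signTwist, pow_succ]

theorem signTwist_signTwist (f : List S → R) : signTwist (signTwist f) = f := by
  funext l
  rw [signTwist, signTwist, ← mul_assoc, ← mul_pow]
  simp

/-- Lengths add under concatenation, so the sign is multiplicative. -/
theorem signTwist_conv (f g : List S → R) :
    signTwist (conv f g) = conv (signTwist f) (signTwist g) := by
  funext l
  induction l generalizing f with
  | nil => simp
  | cons a l ih =>
    rw [conv_cons]
    simp only [signTwist_cons f, conv_neg_left, signTwist_nil]
    rw [← ih]
    simp only [signTwist, conv_cons, List.length_cons, pow_succ]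
    ring

end Conv

end MZV

namespace MZV

/-! ### Quasi-shuffle products on a module with a basis of words -/

section QuasiShuffle

variable {S M : Type*} [AddCommSemigroup S] [AddCommGroup M] [Module ℚ M]
  (b : Module.Basis (List S) ℚ M) (c : ℚ)

theorem word_induction {S M : Type*} [AddCommGroup M] [Module ℚ M]
    (b : Module.Basis (List S) ℚ M) {p : M → Prop} (x : M)
    (basis : ∀ w, p (b w)) (add : ∀ x y, p x → p y → p (x + y))
    (smul : ∀ (q : ℚ) x, p x → p (q • x)) : p x := by
  have hx : x ∈ Submodule.span ℚ (Set.range b) := by rw [b.span_eq]; trivial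
  induction hx using Submodule.span_induction with
  | mem x h => obtain ⟨i, rfl⟩ := h; exact basis i
  | zero => simpa using smul 0 _ (basis [])
  | add x y _ _ hx hy => exact add x y hx hy
  | smul q x _ hx => exact smul q x hx

/-- Prepending a letter. -/
noncomputable def consL {S M : Type*} [AddCommGroup M] [Module ℚ M]
    (b : Module.Basis (List S) ℚ M) (a : S) : M →ₗ[ℚ] M := b.constr ℚ fun w => b (a :: w)

/-- Appending a letter. -/
noncomputable def snocL {S M : Type*} [AddCommGroup M] [Module ℚ M]
    (b : Module.Basis (List S) ℚ M) (a : S) : M →ₗ[ℚ] M := b.constr ℚ fun w => b (w ++ [a])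

@[simp] theorem consL_basis {S M : Type*} [AddCommGroup M] [Module ℚ M]
    (b : Module.Basis (List S) ℚ M) (a : S) (w : List S) : consL b a (b w) = b (a :: w) := by
  simp [consL]

@[simp] theorem snocL_basis {S M : Type*} [AddCommGroup M] [Module ℚ M]
    (b : Module.Basis (List S) ℚ M) (a : S) (w : List S) : snocL b a (b w) = b (w ++ [a]) := by
  simp [snocL]

theorem consL_snocL {S M : Type*} [AddCommGroup M] [Module ℚ M]
    (b : Module.Basis (List S) ℚ M) (a a' : S) (x : M) :
    consL b a (snocL b a' x) = snocL b a' (consL b a x) := by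
  induction x using word_induction b with
  | basis w => simp
  | add x y hx hy => simp [hx, hy]
  | smul q x hx => simp [hx]

/-- The quasi-shuffle product of two words. -/
noncomputable def qword : List S → List S → M
  | [], w => b w
  | a :: v, [] => b (a :: v)
  | a :: v, x :: w => consL b a (qword v (x :: w)) + consL b x (qword (a :: v) w)
      + c • consL b (a + x) (qword v w)
termination_by v w => v.length + w.length

/-- The quasi-shuffle product. -/
noncomputable def qmul : M →ₗ[ℚ] M →ₗ[ℚ] M :=
  b.constr ℚ fun v => b.constr ℚ fun w => qword b c v w

theorem qmul_basis (v w : List S) : qmul b c (b v) (b w) = qword b c v w := by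
  rw [qmul, Module.Basis.constr_basis, Module.Basis.constr_basis]

@[simp] theorem one_qmul (x : M) : qmul b c (b []) x = x := by
  induction x using word_induction b with
  | basis w => rw [qmul_basis, qword]
  | add x y hx hy => simp [hx, hy]
  | smul q x hx => simp [hx]

@[simp] theorem qmul_one (x : M) : qmul b c x (b []) = x := by
  induction x using word_induction b with
  | basis w => rw [qmul_basis]; cases w <;> rw [qword]
  | add x y hx hy => simp [hx, hy]
  | smul q x hx => simp [hx]

theorem qmul_cons_cons (a a' : S) (x y : M) :
    qmul b c (consL b a x) (consL b a' y) = consL b a (qmul b c x (consL b a' y)) +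
      consL b a' (qmul b c (consL b a x) y) + c • consL b (a + a') (qmul b c x y) := by
  induction x using word_induction b with
  | basis v =>
    induction y using word_induction b with
    | basis w => simp only [consL_basis, qmul_basis]; rw [qword]
    | add y z hy hz => simp only [map_add, hy, hz]; module
    | smul q y hy => simp only [map_smul, hy]; module
  | add y z hy hz => simp only [map_add, LinearMap.add_apply, hy, hz]; module
  | smul q y hy => simp only [map_smul, LinearMap.smul_apply, hy]; module

theorem qmul_basis_cons (a a' : S) (v w : List S) :
    qmul b c (b (a :: v)) (b (a' :: w)) = consL b a (qmul b c (b v) (b (a' :: w))) +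
      consL b a' (qmul b c (b (a :: v)) (b w)) + c • consL b (a + a') (qmul b c (b v) (b w)) := by
  simpa using qmul_cons_cons b c a a' (b v) (b w)

theorem words_induction {S : Type*} {p : List S → List S → Prop} (v w : List S)
    (nil_left : ∀ w, p [] w) (nil_right : ∀ v, p v [])
    (cons : ∀ a v a' w, p v (a' :: w) → p (a :: v) w → p v w → p (a :: v) (a' :: w)) : p v w := by
  induction v generalizing w with
  | nil => exact nil_left w
  | cons a v ihv =>
    induction w with
    | nil => exact nil_right _
    | cons a' w ihw => exact cons a v a' w (ihv _) ihw (ihv _)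

theorem qmul_comm (x y : M) : qmul b c x y = qmul b c y x := by
  induction x using word_induction b with
  | basis v =>
    induction y using word_induction b with
    | basis w =>
      induction v, w using words_induction with
      | nil_left w => simp
      | nil_right v => simp
      | cons a v a' w h1 h2 h3 =>
        rw [qmul_basis_cons, qmul_basis_cons, h1, h2, h3, add_comm a a']
        abel
    | add y z hy hz => simp [hy, hz]
    | smul q y hy => simp [hy]
  | add y z hy hz => simp [hy, hz]
  | smul q y hy => simp [hy]

/-- Either bracketing expands into seven terms, one for each non-empty subset of the three first
letters, whose sum becomes the first letter of the product. Corresponding terms agree by induction.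
-/
theorem qmul_assoc_basis (u v w : List S) :
    qmul b c (qmul b c (b u) (b v)) (b w) = qmul b c (b u) (qmul b c (b v) (b w)) := by
  induction u generalizing v w with
  | nil => simp
  | cons a u ihu =>
    induction v generalizing w with
    | nil => simp
    | cons a' v ihv =>
      induction w with
      | nil => simp
      | cons a'' w ihw =>
        have h1 : qmul b c (qmul b c (b (a :: u)) (b (a' :: v))) (b (a'' :: w)) =
            consL b a (qmul b c (qmul b c (b u) (b (a' :: v))) (b (a'' :: w))) +
            consL b a' (qmul b c (qmul b c (b (a :: u)) (b v)) (b (a'' :: w))) +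
            c • consL b (a + a') (qmul b c (qmul b c (b u) (b v)) (b (a'' :: w))) +
            consL b a'' (qmul b c (qmul b c (b (a :: u)) (b (a' :: v))) (b w)) +
            c • consL b (a + a'') (qmul b c (qmul b c (b u) (b (a' :: v))) (b w)) +
            c • consL b (a' + a'') (qmul b c (qmul b c (b (a :: u)) (b v)) (b w)) +
            (c * c) • consL b (a + a' + a'') (qmul b c (qmul b c (b u) (b v)) (b w)) := by
          rw [qmul_basis_cons b c a a', ← consL_basis b a'']
          simp only [map_add, map_smul, LinearMap.add_apply, LinearMap.smul_apply, qmul_cons_cons]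
          module
        have h2 : qmul b c (b (a :: u)) (qmul b c (b (a' :: v)) (b (a'' :: w))) =
            consL b a (qmul b c (b u) (qmul b c (b (a' :: v)) (b (a'' :: w)))) +
            consL b a' (qmul b c (b (a :: u)) (qmul b c (b v) (b (a'' :: w)))) +
            c • consL b (a + a') (qmul b c (b u) (qmul b c (b v) (b (a'' :: w)))) +
            consL b a'' (qmul b c (b (a :: u)) (qmul b c (b (a' :: v)) (b w))) +
            c • consL b (a + a'') (qmul b c (b u) (qmul b c (b (a' :: v)) (b w))) +
            c • consL b (a' + a'') (qmul b c (b (a :: u)) (qmul b c (b v) (b w))) +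
            (c * c) • consL b (a + a' + a'') (qmul b c (b u) (qmul b c (b v) (b w))) := by
          rw [qmul_basis_cons b c a' a'', ← consL_basis b a]
          simp only [map_add, map_smul, qmul_cons_cons, add_assoc a]
          module
        rw [h1, h2, ihu, ihu, ihu, ihu, ihv, ihv, ihw]

theorem qmul_assoc (x y z : M) : qmul b c (qmul b c x y) z = qmul b c x (qmul b c y z) := by
  induction x using word_induction b with
  | basis u =>
    induction y using word_induction b with
    | basis v =>
      induction z using word_induction b with
      | basis w => exact qmul_assoc_basis b c u v w
      | add y z hy hz => simp [hy, hz]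
      | smul q y hy => simp [hy]
    | add y z hy hz => simp [hy, hz]
    | smul q y hy => simp [hy]
  | add y z hy hz => simp [hy, hz]
  | smul q y hy => simp [hy]

/-- Prepending and appending letters commute, so the recursion at the front gives the same recursion
at the end. The end of the word is where `circ`, the star and the removal of `e₁` operate. -/
theorem qmul_basis_snoc (a a' : S) (v w : List S) :
    qmul b c (b (v ++ [a])) (b (w ++ [a'])) = snocL b a (qmul b c (b v) (b (w ++ [a']))) +
      snocL b a' (qmul b c (b (v ++ [a])) (b w)) +
      c • snocL b (a + a') (qmul b c (b v) (b w)) := by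
  -- The case of a one-letter first factor is the base of the induction; commutativity turns it into
  -- the case of a one-letter second factor.
  have nil : ∀ (a a' : S) (w : List S),
      qmul b c (b [a]) (b (w ++ [a'])) = snocL b a (b (w ++ [a'])) +
        snocL b a' (qmul b c (b [a]) (b w)) + c • snocL b (a + a') (b w) := by
    intro a a' w
    induction w with
    | nil => simp [qmul_basis_cons]; abel
    | cons x w ih =>
      rw [List.cons_append, qmul_basis_cons, ih, qmul_basis_cons]
      simp only [map_add, map_smul, consL_snocL, one_qmul, consL_basis, snocL_basis,
        List.cons_append]
      abel
  induction v, w using words_induction with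
  | nil_left w => simpa using nil a a' w
  | nil_right v =>
    have := nil a' a v
    simp only [List.nil_append, qmul_one]
    rw [qmul_comm, this, qmul_comm b c (b v), add_comm a a']
    abel
  | cons x v x' w h1 h2 h3 =>
    simp only [List.cons_append] at h1 h2 ⊢
    rw [qmul_basis_cons, h1, h2, h3, qmul_basis_cons, qmul_basis_cons b c x x' (v ++ [a]) w,
      qmul_basis_cons]
    simp only [map_add, map_smul, consL_snocL, smul_add, smul_smul]
    module

theorem qmul_snoc_snoc (a a' : S) (x y : M) :
    qmul b c (snocL b a x) (snocL b a' y) = snocL b a (qmul b c x (snocL b a' y)) +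
      snocL b a' (qmul b c (snocL b a x) y) + c • snocL b (a + a') (qmul b c x y) := by
  induction x using word_induction b with
  | basis v =>
    induction y using word_induction b with
    | basis w => simpa only [snocL_basis] using qmul_basis_snoc b c a a' v w
    | add y z hy hz => simp only [map_add, hy, hz]; module
    | smul q y hy => simp only [map_smul, hy]; module
  | add y z hy hz => simp only [map_add, LinearMap.add_apply, hy, hz]; module
  | smul q y hy => simp only [map_smul, LinearMap.smul_apply, hy]; module

/-- Reversal of words. -/
noncomputable def reverseL {S M : Type*} [AddCommGroup M] [Module ℚ M]
    (b : Module.Basis (List S) ℚ M) : M →ₗ[ℚ] M := b.constr ℚ fun w => b w.reverse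

@[simp] theorem reverseL_basis {S M : Type*} [AddCommGroup M] [Module ℚ M]
    (b : Module.Basis (List S) ℚ M) (w : List S) : reverseL b (b w) = b w.reverse := by
  simp [reverseL]

theorem reverseL_consL {S M : Type*} [AddCommGroup M] [Module ℚ M]
    (b : Module.Basis (List S) ℚ M) (a : S) (x : M) :
    reverseL b (consL b a x) = snocL b a (reverseL b x) := by
  induction x using word_induction b with
  | basis w => simp
  | add x y hx hy => simp [hx, hy]
  | smul q x hx => simp [hx]

/-- Reversal exchanges the recursion at the front with the one at the end, and both define the same
product. -/
theorem reverseL_qmul (v w : List S) :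
    reverseL b (qmul b c (b v) (b w)) = qmul b c (b v.reverse) (b w.reverse) := by
  induction v, w using words_induction with
  | nil_left w => simp
  | nil_right v => simp
  | cons a v a' w h1 h2 h3 =>
    rw [qmul_basis_cons]
    simp only [map_add, map_smul, reverseL_consL, h1, h2, h3]
    simp only [List.reverse_cons, qmul_basis_snoc]

/-- The twist of an element by the parity of the length of words. -/
noncomputable def signL {S M : Type*} [AddCommGroup M] [Module ℚ M]
    (b : Module.Basis (List S) ℚ M) : M →ₗ[ℚ] M :=
  b.constr ℚ fun w => (-1 : ℚ) ^ w.length • b w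

@[simp] theorem signL_basis {S M : Type*} [AddCommGroup M] [Module ℚ M]
    (b : Module.Basis (List S) ℚ M) (w : List S) :
    signL b (b w) = (-1 : ℚ) ^ w.length • b w := by
  simp [signL]

theorem signL_consL {S M : Type*} [AddCommGroup M] [Module ℚ M]
    (b : Module.Basis (List S) ℚ M) (a : S) (x : M) :
    signL b (consL b a x) = -consL b a (signL b x) := by
  induction x using word_induction b with
  | basis w => simp [pow_succ]
  | add x y hx hy => simp [hx, hy]; abel
  | smul q x hx => simp [hx]

/-- Merging two letters lowers the length by one, so the twist changes the sign of exactly the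
merging term of the recursion. -/
theorem signL_qmul (v w : List S) :
    signL b (qmul b (-c) (b v) (b w)) = qmul b c (signL b (b v)) (signL b (b w)) := by
  induction v, w using words_induction with
  | nil_left w => simp
  | nil_right v => simp
  | cons a v a' w h1 h2 h3 =>
    have hs : ∀ (a : S) (w : List S), signL b (b (a :: w)) = -consL b a (signL b (b w)) := by
      intro a w
      rw [← consL_basis, signL_consL]
    rw [qmul_basis_cons]
    simp only [map_add, map_smul, signL_consL, h1, h2, h3, hs, map_neg, LinearMap.neg_apply,
      qmul_cons_cons]
    module

/-! #### Linear functionals and convolution -/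

variable {R : Type*} [CommRing R] [Algebra ℚ R]

/-- The linear extension of a function on words. -/
noncomputable def ext {S M : Type*} [AddCommGroup M] [Module ℚ M]
    (b : Module.Basis (List S) ℚ M) (f : List S → R) : M →ₗ[ℚ] R := b.constr ℚ f

@[simp] theorem ext_basis {S M : Type*} [AddCommGroup M] [Module ℚ M]
    (b : Module.Basis (List S) ℚ M) (f : List S → R) (w : List S) : ext b f (b w) = f w := by
  simp [ext]

theorem ext_consL {S M : Type*} [AddCommGroup M] [Module ℚ M]
    (b : Module.Basis (List S) ℚ M) (f : List S → R) (a : S) (x : M) :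
    ext b f (consL b a x) = ext b (fun w => f (a :: w)) x := by
  induction x using word_induction b with
  | basis w => simp
  | add x y hx hy => simp [hx, hy]
  | smul q x hx => simp [hx]

theorem ext_apply {S M : Type*} [AddCommGroup M] [Module ℚ M]
    (b : Module.Basis (List S) ℚ M) (f : M →ₗ[ℚ] R) (x : M) : ext b (fun w => f (b w)) x = f x := by
  induction x using word_induction b with
  | basis w => simp
  | add x y hx hy => simp [hx, hy]
  | smul q x hx => simp [hx]

theorem ext_conv_consL {S M : Type*} [AddCommGroup M] [Module ℚ M]
    (b : Module.Basis (List S) ℚ M) (f g : List S → R) (a : S) (x : M) :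
    ext b (conv f g) (consL b a x) =
      f [] * ext b g (consL b a x) + ext b (conv (fun w => f (a :: w)) g) x := by
  induction x using word_induction b with
  | basis w => simp [conv_cons]
  | add x y hx hy => simp [hx, hy]; ring
  | smul q x hx => simp [hx]

/-- Deconcatenation is compatible with the quasi-shuffle product. -/
theorem ext_conv_qmul (f g : List S → R) (v w : List S) :
    ext b (conv f g) (qmul b c (b v) (b w)) =
      splitSum (fun v' v'' => splitSum (fun w' w'' =>
        ext b f (qmul b c (b v') (b w')) * ext b g (qmul b c (b v'') (b w''))) w) v := by
  induction v, w using words_induction generalizing f with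
  | nil_left w => simp [splitSum, conv]
  | nil_right v => simp [splitSum, conv]
  | cons a v a' w h1 h2 h3 =>
    have e0 := qmul_basis_cons b c a a' v w
    -- The first summand collects the cuts with empty left part; in the others the first letter `a`,
    -- `a'` or `a + a'` belongs to the left part.
    have e1 : ext b (conv f g) (qmul b c (b (a :: v)) (b (a' :: w))) =
        f [] * ext b g (qmul b c (b (a :: v)) (b (a' :: w))) +
        ext b (conv (fun w => f (a :: w)) g) (qmul b c (b v) (b (a' :: w))) +
        ext b (conv (fun w => f (a' :: w)) g) (qmul b c (b (a :: v)) (b w)) +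
        c • ext b (conv (fun w => f ((a + a') :: w)) g) (qmul b c (b v) (b w)) := by
      rw [e0]
      simp only [map_add, map_smul, ext_conv_consL, mul_add, smul_add, mul_smul_comm]
      abel
    have e2 : ∀ v' w', ext b f (qmul b c (b (a :: v')) (b (a' :: w'))) =
        ext b (fun w => f (a :: w)) (qmul b c (b v') (b (a' :: w'))) +
        ext b (fun w => f (a' :: w)) (qmul b c (b (a :: v')) (b w')) +
        algebraMap ℚ R c * ext b (fun w => f ((a + a') :: w)) (qmul b c (b v') (b w')) := by
      intro v' w'
      rw [qmul_basis_cons]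
      simp only [map_add, map_smul, ext_consL, Algebra.smul_def]
    rw [e1, h1, h2, h3]
    simp only [splitSum, e2, one_qmul, qmul_one, ext_basis, splitSum_add, add_mul, mul_assoc,
      mul_splitSum, Algebra.smul_def]
    ring

/-- `f` is multiplicative for the quasi-shuffle product. -/
def IsChar (f : List S → R) : Prop :=
  f [] = 1 ∧ ∀ v w, ext b f (qmul b c (b v) (b w)) = f v * f w

variable {b c}

theorem IsChar.ext_qmul {f : List S → R} (hf : IsChar b c f) (x y : M) :
    ext b f (qmul b c x y) = ext b f x * ext b f y := by
  induction x using word_induction b with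
  | basis v =>
    induction y using word_induction b with
    | basis w => simp [hf.2]
    | add y z hy hz => simp [hy, hz, mul_add]
    | smul q y hy => simp [hy]
  | add y z hy hz => simp [hy, hz, add_mul]
  | smul q y hy => simp [hy]

/-- Words with the quasi-shuffle product and deconcatenation form a bialgebra, and `R` is
commutative. -/
theorem IsChar.conv {f g : List S → R} (hf : IsChar b c f) (hg : IsChar b c g) :
    IsChar b c (conv f g) := by
  refine ⟨by simp [hf.1, hg.1], fun v w => ?_⟩
  rw [ext_conv_qmul, MZV.conv, ← splitSum_mul]
  congr 1
  funext v' v''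
  rw [MZV.conv, ← mul_splitSum]
  congr 1
  funext w' w''
  rw [hf.2, hg.2]
  ring

/-- The unit `convOne` is a character. Hence the failure of `g` to be multiplicative is annihilated
by convolution with `f` in both variables, and `f` can be cancelled in each of them. -/
theorem IsChar.inv {f g : List S → R} (hf : IsChar b c f) (hfg : MZV.conv f g = convOne) :
    IsChar b c g := by
  have hg : g [] = 1 := by
    have := congrFun hfg []
    simpa [hf.1] using this
  refine ⟨hg, fun v w => sub_eq_zero.1 ?_⟩
  have hone : ∀ v w : List S, ext b (convOne : List S → R) (qmul b c (b v) (b w)) =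
      convOne v * convOne w := by
    intro v w
    have h0 : ∀ (a : S) (x : M), ext b (convOne : List S → R) (consL b a x) = 0 := by
      intro a x
      induction x using word_induction b with
      | basis w => simp
      | add x y hx hy => simp [hx, hy]
      | smul q x hx => simp [hx]
    cases v with
    | nil => simp
    | cons a v =>
      cases w with
      | nil => simp
      | cons a' w =>
        rw [qmul_basis_cons]
        simp [h0]
  -- The defect of multiplicativity of `g`.
  let h : List S → List S → R := fun v w => ext b g (qmul b c (b v) (b w)) - g v * g w
  have key : ∀ v w, MZV.conv f (fun v'' => MZV.conv f (h v'') w) v = 0 := by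
    intro v w
    have e1 := ext_conv_qmul b c f g v w
    rw [hfg, hone, ← hfg] at e1
    have e2 : MZV.conv f g v * MZV.conv f g w = splitSum (fun v' v'' => splitSum (fun w' w'' =>
        f v' * f w' * (g v'' * g w'')) w) v := by
      rw [MZV.conv, ← splitSum_mul]
      congr 1
      funext v' v''
      rw [MZV.conv, ← mul_splitSum]
      congr 1
      funext w' w''
      ring
    rw [e2] at e1
    simp only [hf.2] at e1
    simp only [h, conv_sub_right]
    rw [sub_eq_zero]
    simp only [MZV.conv, ← mul_splitSum, ← mul_assoc] at e1 ⊢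
    exact e1.symm
  exact eq_zero_of_conv_eq_zero hf.1 (fun w => eq_zero_of_conv_eq_zero hf.1
    (fun v => key v w) v) w

theorem IsChar.signTwist {f : List S → R} (hf : IsChar b c f) :
    IsChar b (-c) (signTwist f) := by
  refine ⟨by simp [hf.1], fun v w => ?_⟩
  have h : ∀ x, ext b (MZV.signTwist f) x = ext b f (signL b x) := by
    intro x
    induction x using word_induction b with
    | basis w => simp [MZV.signTwist, Algebra.smul_def]
    | add x y hx hy => simp [hx, hy]
    | smul q x hx => simp [hx]
  rw [h, signL_qmul, hf.ext_qmul, ← h, ← h, ext_basis, ext_basis]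

theorem IsChar.comp_reverse {f : List S → R} (hf : IsChar b c f) :
    IsChar b c (fun w => f w.reverse) := by
  refine ⟨by simp [hf.1], fun v w => ?_⟩
  have h : ∀ x, ext b (fun w => f w.reverse) x = ext b f (reverseL b x) := by
    intro x
    induction x using word_induction b with
    | basis w => simp
    | add x y hx hy => simp [hx, hy]
    | smul q x hx => simp [hx]
  rw [h, reverseL_qmul, hf.2]

end QuasiShuffle

end MZV

namespace MZV

/-! ### Regularization by means of a locally nilpotent derivation -/

section Taylor

open Polynomial

/-- The divided power `D^n / n!` of a linear endomorphism. -/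
noncomputable def divPow {M : Type*} [AddCommGroup M] [Module ℚ M] (D : M →ₗ[ℚ] M) (n : ℕ) :
    M →ₗ[ℚ] M := (n.factorial : ℚ)⁻¹ • D ^ n

theorem divPow_zero {M : Type*} [AddCommGroup M] [Module ℚ M] (D : M →ₗ[ℚ] M) (x : M) :
    divPow D 0 x = x := by
  simp [divPow]

theorem apply_divPow {M : Type*} [AddCommGroup M] [Module ℚ M] (D : M →ₗ[ℚ] M) (n : ℕ) (x : M) :
    D (divPow D n x) = ((n : ℚ) + 1) • divPow D (n + 1) x := by
  simp only [divPow, LinearMap.smul_apply, map_smul, smul_smul, Nat.factorial_succ, pow_succ',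
    Module.End.mul_apply]
  congr 1
  have : (n.factorial : ℚ) ≠ 0 := by exact_mod_cast n.factorial_ne_zero
  push_cast
  field_simp

theorem divPow_succ {M : Type*} [AddCommGroup M] [Module ℚ M] (D : M →ₗ[ℚ] M) (n : ℕ) (x : M) :
    divPow D (n + 1) x = ((n : ℚ) + 1)⁻¹ • D (divPow D n x) := by
  rw [apply_divPow, smul_smul, inv_mul_cancel₀ (by positivity), one_smul]

/-- The Leibniz rule for divided powers of a derivation. -/
theorem divPow_leibniz {M : Type*} [AddCommGroup M] [Module ℚ M] (mul : M →ₗ[ℚ] M →ₗ[ℚ] M)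
    (D : M →ₗ[ℚ] M) (hD : ∀ x y, D (mul x y) = mul (D x) y + mul x (D y)) (n : ℕ) (x y : M) :
    divPow D n (mul x y) =
      ∑ p ∈ Finset.HasAntidiagonal.antidiagonal n, mul (divPow D p.1 x) (divPow D p.2 y) := by
  induction n with
  | zero => simp [divPow_zero]
  | succ n ih =>
    rw [divPow_succ, ih, inv_smul_eq_iff₀ (by positivity), map_sum]
    simp only [hD, apply_divPow, map_smul, LinearMap.smul_apply, Finset.sum_add_distrib]
    have h : ((n : ℚ) + 1) • ∑ p ∈ Finset.HasAntidiagonal.antidiagonal (n + 1),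
          mul (divPow D p.1 x) (divPow D p.2 y) =
        ∑ p ∈ Finset.HasAntidiagonal.antidiagonal (n + 1),
          (p.1 : ℚ) • mul (divPow D p.1 x) (divPow D p.2 y) +
        ∑ p ∈ Finset.HasAntidiagonal.antidiagonal (n + 1),
          (p.2 : ℚ) • mul (divPow D p.1 x) (divPow D p.2 y) := by
      rw [Finset.smul_sum, ← Finset.sum_add_distrib]
      refine Finset.sum_congr rfl fun p hp => ?_
      rw [← add_smul]
      congr 1
      exact_mod_cast (Finset.HasAntidiagonal.mem_antidiagonal.1 hp).symm
    rw [h, Finset.Nat.sum_antidiagonal_succ, Finset.Nat.sum_antidiagonal_succ']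
    simp

variable {B : Type*} [CommRing B] [Algebra ℚ B]

/-- The map is exp(XD): local nilpotency makes its values polynomials, and the Leibniz rule makes it
multiplicative. -/
theorem exists_taylor (D : B →ₗ[ℚ] B) (hD : ∀ x y, D (x * y) = D x * y + x * D y)
    (hnil : ∀ x, ∃ N, (D ^ N) x = 0) :
    ∃ τ : B →ₐ[ℚ] B[X], ∀ x n, (τ x).coeff n = divPow D n x := by
  have h1 : D 1 = 0 := by simpa using hD 1 1
  have hpoly : ∀ x, ∃ p : B[X], ∀ n, p.coeff n = divPow D n x := by
    intro x
    obtain ⟨N, hN⟩ := hnil x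
    refine ⟨∑ n ∈ Finset.range N, monomial n (divPow D n x), fun n => ?_⟩
    simp only [finsetSum_coeff, coeff_monomial, Finset.sum_ite_eq', Finset.mem_range]
    split_ifs with h
    · rfl
    · have : (D ^ n) x = 0 := by
        obtain ⟨m, rfl⟩ := Nat.exists_eq_add_of_le (not_lt.1 h)
        rw [add_comm, pow_add, Module.End.mul_apply, hN, map_zero]
      simp [divPow, this]
  choose τ hτ using hpoly
  let τl : B →ₗ[ℚ] B[X] :=
    { toFun := τ
      map_add' := fun x y => by ext n; simp [hτ]
      map_smul' := fun q x => by ext n; simp [hτ] }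
  refine ⟨AlgHom.ofLinearMap τl ?_ ?_, hτ⟩
  · ext n
    change (τ 1).coeff n = _
    rw [hτ, coeff_one]
    cases n with
    | zero => simp [divPow]
    | succ n => simp [divPow, pow_succ, h1]
  · intro x y
    ext n
    change (τ (x * y)).coeff n = (τ x * τ y).coeff n
    rw [coeff_mul, hτ]
    simp only [hτ]
    exact divPow_leibniz (LinearMap.mul ℚ B) D hD n x y

/-- Substituting X = -t in exp(XD) gives a ring homomorphism onto the kernel of `D`. In effect, `B`
is the polynomial ring in `t` over that kernel. -/
theorem exists_projection (D : B →ₗ[ℚ] B) (hD : ∀ x y, D (x * y) = D x * y + x * D y)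
    (hnil : ∀ x, ∃ N, (D ^ N) x = 0) (t : B) (ht : D t = 1) :
    ∃ π : B →ₐ[ℚ] B, (∀ x, D (π x) = 0) ∧ (∀ x, D x = 0 → π x = x) ∧ π t = 0 ∧
      ∀ x N, (D ^ N) x = 0 → π x = ∑ n ∈ Finset.range N, (-t) ^ n * divPow D n x := by
  have h1 : D 1 = 0 := by simpa using hD 1 1
  obtain ⟨τ, hτ⟩ := exists_taylor D hD hnil
  let π : B →ₐ[ℚ] B := ((aeval (R := B) (-t)).restrictScalars ℚ).comp τ
  have hπ : ∀ x N, (D ^ N) x = 0 → π x = ∑ n ∈ Finset.range N, (-t) ^ n * divPow D n x := by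
    intro x N hN
    have hdeg : (τ x).natDegree < N ∨ τ x = 0 := by
      by_cases h0 : τ x = 0
      · exact Or.inr h0
      · refine Or.inl ((natDegree_lt_iff_degree_lt h0).2 ((degree_lt_iff_coeff_zero _ _).2 ?_))
        intro m hm
        obtain ⟨k, rfl⟩ := Nat.exists_eq_add_of_le hm
        rw [hτ, divPow, LinearMap.smul_apply, add_comm, pow_add, Module.End.mul_apply, hN]
        simp
    change aeval (-t) (τ x) = _
    rcases hdeg with h | h
    · rw [aeval_eq_sum_range' h]
      refine Finset.sum_congr rfl fun n _ => ?_
      rw [hτ, smul_eq_mul, mul_comm]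
    · rw [h, map_zero]
      refine (Finset.sum_eq_zero fun n _ => ?_).symm
      rw [← hτ, h, coeff_zero, mul_zero]
  refine ⟨π, fun x => ?_, fun x hx => ?_, ?_, hπ⟩
  · obtain ⟨N, hN⟩ := hnil x
    have hpow : ∀ n : ℕ, D ((-t) ^ n) = -((n : ℚ) • (-t) ^ (n - 1)) := by
      intro n
      induction n with
      | zero => simp [h1]
      | succ n ih =>
        rw [pow_succ, hD, ih, map_neg, ht]
        cases n with
        | zero => simp
        | succ n =>
          simp only [Nat.add_sub_cancel, Algebra.smul_def, pow_succ]
          push_cast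
          ring
    -- The derivative of each summand is a difference of consecutive terms, so the sum telescopes to
    -- a term containing D^N x = 0.
    have hg : ∀ n, D ((-t) ^ n * divPow D n x) =
        ((n + 1 : ℕ) : ℚ) • ((-t) ^ (n + 1 - 1) * divPow D (n + 1) x) -
          (n : ℚ) • ((-t) ^ (n - 1) * divPow D n x) := by
      intro n
      rw [hD, hpow, apply_divPow]
      simp only [Nat.add_sub_cancel, Algebra.smul_def]
      push_cast
      ring
    rw [hπ x N hN, map_sum, Finset.sum_congr rfl fun n _ => hg n,
      Finset.sum_range_sub fun n => (n : ℚ) • ((-t) ^ (n - 1) * divPow D n x)]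
    simp [divPow, hN]
  · rw [hπ x 1 (by simpa using hx)]
    simp [divPow_zero]
  · rw [hπ t 2 (by simp [pow_succ, ht, h1]), Finset.sum_range_succ, Finset.sum_range_one]
    simp [divPow, ht]

/-- The extension sends x to ∑ Z(π(Dⁿx / n!)) Xⁿ, where π is the projection to the kernel of `D`
along `t`. -/
theorem exists_extension (D : B →ₗ[ℚ] B) (hD : ∀ x y, D (x * y) = D x * y + x * D y)
    (hnil : ∀ x, ∃ N, (D ^ N) x = 0) (t : B) (ht : D t = 1) (Z : B →ₗ[ℚ] ℝ) (hZ1 : Z 1 = 1)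
    (hZ : ∀ x y, D x = 0 → D y = 0 → Z (x * y) = Z x * Z y) :
    ∃ f : B →ₐ[ℚ] ℝ[X], f t = X ∧ ∀ x, D x = 0 → f x = C (Z x) := by
  obtain ⟨τ, hτ⟩ := exists_taylor D hD hnil
  obtain ⟨π, hπ0, hπ, hπt, -⟩ := exists_projection D hD hnil t ht
  let z : B →ₐ[ℚ] ℝ := AlgHom.ofLinearMap (Z ∘ₗ π.toLinearMap) (by simp [hZ1])
    (fun x y => by simp [hZ _ _ (hπ0 x) (hπ0 y)])
  have hz : ∀ x, z x = Z (π x) := fun _ => rfl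
  have hc : ∀ x n, ((mapAlgHom z).comp τ x).coeff n = z (divPow D n x) := by
    intro x n
    simp [hτ]
  have h1 : D 1 = 0 := by simpa using hD 1 1
  refine ⟨(mapAlgHom z).comp τ, ?_, fun x hx => ?_⟩
  · ext n
    rw [hc, coeff_X]
    match n with
    | 0 => simp [divPow_zero, hz, hπt]
    | 1 => simp [divPow, ht]
    | n + 2 => simp [divPow, pow_succ, ht, h1]
  · ext n
    rw [hc, coeff_C]
    match n with
    | 0 => simp [divPow_zero, hz, hπ x hx]
    | n + 1 => simp [divPow, pow_succ, hx]

/-- Both d/dT ∘ f and f ∘ D are derivations along `f`. They agree on the kernel of `D` and on `t`,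
which together generate `B`. -/
theorem derivative_extension (D : B →ₗ[ℚ] B) (hD : ∀ x y, D (x * y) = D x * y + x * D y)
    (hnil : ∀ x, ∃ N, (D ^ N) x = 0) (t : B) (ht : D t = 1) (f : B →ₐ[ℚ] ℝ[X]) (hft : f t = X)
    (hf : ∀ x, D x = 0 → ∃ r, f x = C r) (x : B) : derivative (f x) = f (D x) := by
  obtain ⟨π, hπ0, -, -, hπ⟩ := exists_projection D hD hnil t ht
  have hker : ∀ x, D x = 0 → derivative (f x) = f (D x) := by
    intro x hx
    obtain ⟨r, hr⟩ := hf x hx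
    simp [hr, hx]
  have hmul : ∀ x y, derivative (f x) = f (D x) → derivative (f y) = f (D y) →
      derivative (f (x * y)) = f (D (x * y)) := by
    intro x y hx hy
    rw [hD, map_mul, derivative_mul, hx, hy, map_add, map_mul, map_mul]
  have hpow : ∀ n : ℕ, derivative (f ((-t) ^ n)) = f (D ((-t) ^ n)) := by
    intro n
    induction n with
    | zero => exact hker _ (by simpa using hD 1 1)
    | succ n ih =>
      rw [pow_succ]
      exact hmul _ _ ih (by simp [hft, ht])
  have key : ∀ N : ℕ, ∀ x, (D ^ N) x = 0 → derivative (f x) = f (D x) := by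
    intro N
    induction N with
    | zero => intro x hx; exact hker x (by simp [show x = 0 from hx])
    | succ N ih =>
      intro x hx
      have h := hπ x (N + 1) hx
      rw [Finset.sum_range_succ', pow_zero, one_mul, divPow_zero] at h
      -- The formula for the projection is solved for `x`; the divided powers that remain have a
      -- smaller order of nilpotency.
      have hx' : x = π x - ∑ n ∈ Finset.range N, (-t) ^ (n + 1) * divPow D (n + 1) x := by
        rw [h]; ring
      rw [hx']
      simp only [map_sub, map_sum]
      rw [hker _ (hπ0 x)]
      congr 1
      refine Finset.sum_congr rfl fun n _ => hmul _ _ (hpow _) (ih _ ?_)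
      rw [divPow, LinearMap.smul_apply, map_smul, ← Module.End.mul_apply, ← pow_add,
        show N + (n + 1) = n + (N + 1) by ring, pow_add, Module.End.mul_apply, hx, map_zero,
        smul_zero]
  obtain ⟨N, hN⟩ := hnil x
  exact key N x hN

/-- The commutative ring structure given by a bilinear product. -/
abbrev ringOfMul {M : Type*} [AddCommGroup M] [Module ℚ M] (mul : M →ₗ[ℚ] M →ₗ[ℚ] M) (one : M)
    (one_mul : ∀ x, mul one x = x) (mul_comm : ∀ x y, mul x y = mul y x)
    (mul_assoc : ∀ x y z, mul (mul x y) z = mul x (mul y z)) : CommRing M where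
  mul x y := mul x y
  one := one
  one_mul := one_mul
  mul_one x := (mul_comm x one).trans (one_mul x)
  mul_comm := mul_comm
  mul_assoc := mul_assoc
  left_distrib x y z := map_add (mul x) y z
  right_distrib x y z := by
    change mul (x + y) z = mul x z + mul y z
    rw [map_add, LinearMap.add_apply]
  zero_mul x := by
    change mul 0 x = 0
    rw [map_zero, LinearMap.zero_apply]
  mul_zero x := map_zero (mul x)
  zsmul := fun n x => n • x
  zsmul_zero' := SubNegMonoid.zsmul_zero'
  zsmul_succ' := SubNegMonoid.zsmul_succ'
  zsmul_neg' := SubNegMonoid.zsmul_neg'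
  sub_eq_add_neg := sub_eq_add_neg
  neg_add_cancel := neg_add_cancel

variable {M : Type*} [AddCommGroup M] [Module ℚ M] {mul : M →ₗ[ℚ] M →ₗ[ℚ] M} {one t : M}
    {D : M →ₗ[ℚ] M}

/-- A form for bilinear products, because 𝔥¹ carries two ring structures; each is installed only
locally. -/
theorem exists_extension_of_mul
    (one_mul : ∀ x, mul one x = x) (mul_comm : ∀ x y, mul x y = mul y x)
    (mul_assoc : ∀ x y z, mul (mul x y) z = mul x (mul y z))
    (hD : ∀ x y, D (mul x y) = mul (D x) y + mul x (D y))
    (hnil : ∀ x, ∃ N, (D ^ N) x = 0) (ht : D t = one) (Z : M →ₗ[ℚ] ℝ) (hZ1 : Z one = 1)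
    (hZ : ∀ x y, D x = 0 → D y = 0 → Z (mul x y) = Z x * Z y) :
    ∃ f : M →ₗ[ℚ] ℝ[X], f one = 1 ∧ (∀ x y, f (mul x y) = f x * f y) ∧ f t = X ∧
      ∀ x, D x = 0 → f x = C (Z x) := by
  let _ : CommRing M := ringOfMul mul one one_mul mul_comm mul_assoc
  let _ : Algebra ℚ M := Algebra.ofModule
    (fun r x y => by
      change mul (r • x) y = r • mul x y
      rw [map_smul, LinearMap.smul_apply])
    (fun r x y => map_smul (mul x) r y)
  obtain ⟨f, h1, h2⟩ := exists_extension D hD hnil t ht Z hZ1 hZ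
  exact ⟨f.toLinearMap, map_one f, map_mul f, h1, h2⟩

theorem derivative_extension_of_mul
    (one_mul : ∀ x, mul one x = x) (mul_comm : ∀ x y, mul x y = mul y x)
    (mul_assoc : ∀ x y z, mul (mul x y) z = mul x (mul y z))
    (hD : ∀ x y, D (mul x y) = mul (D x) y + mul x (D y))
    (hnil : ∀ x, ∃ N, (D ^ N) x = 0) (ht : D t = one) (f : M →ₗ[ℚ] ℝ[X]) (hf1 : f one = 1)
    (hfm : ∀ x y, f (mul x y) = f x * f y) (hft : f t = X)
    (hf : ∀ x, D x = 0 → ∃ r, f x = C r) (x : M) : derivative (f x) = f (D x) := by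
  let _ : CommRing M := ringOfMul mul one one_mul mul_comm mul_assoc
  let _ : Algebra ℚ M := Algebra.ofModule
    (fun r x y => by
      change mul (r • x) y = r • mul x y
      rw [map_smul, LinearMap.smul_apply])
    (fun r x y => map_smul (mul x) r y)
  exact derivative_extension D hD hnil t ht (AlgHom.ofLinearMap f hf1 hfm) hft hf x

end Taylor

end MZV

namespace MZV

/-! ### Sums over linear extensions of a relation -/

section LinearExtensions

open Classical in
/-- The sum of the words of labels over all enumerations of `ι` compatible with a relation. -/
noncomputable def relW {ι : Type*} [Fintype ι] (n : ℕ) (r : ι → ι → Prop) (δ : ι → Fin 2) : H :=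
  ∑ σ : Fin n ≃ ι with ∀ x y, r x y → σ.symm x < σ.symm y, word (List.ofFn fun i => δ (σ i))

theorem relW_equiv {ι κ : Type*} {_ : Fintype ι} {_ : Fintype κ} {n : ℕ} (e : ι ≃ κ) {r : ι → ι → Prop}
    {r' : κ → κ → Prop} {δ : ι → Fin 2} {δ' : κ → Fin 2} (hr : ∀ x y, r x y ↔ r' (e x) (e y))
    (hδ : ∀ x, δ x = δ' (e x)) : relW n r δ = relW n r' δ' := by
  classical
  refine Finset.sum_equiv ((Equiv.refl (Fin n)).equivCongr e) (fun σ => ?_) (fun σ _ => ?_)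
  · simp only [Finset.mem_filter, Finset.mem_univ, true_and]
    constructor
    · intro h x y hxy
      exact h _ _ ((hr _ _).2 (by simpa using hxy))
    · intro h x y hxy
      have := h _ _ ((hr _ _).1 hxy)
      simpa using this
  · simp [hδ]

theorem relW_equiv_of_eq {ι κ : Type*} {_ : Fintype ι} {_ : Fintype κ} {n m : ℕ} (h : n = m)
    (e : ι ≃ κ) {r : ι → ι → Prop} {r' : κ → κ → Prop} {δ : ι → Fin 2} {δ' : κ → Fin 2}
    (hr : ∀ x y, r x y ↔ r' (e x) (e y)) (hδ : ∀ x, δ x = δ' (e x)) :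
    relW n r δ = relW m r' δ' := by
  subst h
  exact relW_equiv e hr hδ

theorem relW_congr {ι : Type*} [Fintype ι] {n : ℕ} {r r' : ι → ι → Prop} {δ δ' : ι → Fin 2}
    (hr : ∀ x y, r x y ↔ r' x y) (hδ : ∀ x, δ x = δ' x) : relW n r δ = relW n r' δ' :=
  relW_equiv (Equiv.refl ι) hr hδ

/-- Every enumeration puts exactly one of two distinct elements before the other. -/
theorem relW_split {ι : Type*} [Fintype ι] {n : ℕ} (r : ι → ι → Prop) (δ : ι → Fin 2) {a b : ι}
    (hab : a ≠ b) :
    relW n r δ = relW n (fun x y => r x y ∨ (x = a ∧ y = b)) δ +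
      relW n (fun x y => r x y ∨ (x = b ∧ y = a)) δ := by
  classical
  rw [relW, relW, relW, ← Finset.sum_filter_add_sum_filter_not _ fun σ => σ.symm a < σ.symm b]
  congr 1
  · refine Finset.sum_congr (Finset.ext fun σ => ?_) fun _ _ => rfl
    simp only [Finset.mem_filter, Finset.mem_univ, true_and]
    constructor
    · rintro ⟨h1, h2⟩ x y (h | ⟨rfl, rfl⟩)
      · exact h1 x y h
      · exact h2
    · intro h
      exact ⟨fun x y hxy => h x y (Or.inl hxy), h a b (Or.inr ⟨rfl, rfl⟩)⟩
  · refine Finset.sum_congr (Finset.ext fun σ => ?_) fun _ _ => rfl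
    simp only [Finset.mem_filter, Finset.mem_univ, true_and]
    constructor
    · rintro ⟨h1, h2⟩ x y (h | ⟨rfl, rfl⟩)
      · exact h1 x y h
      · exact lt_of_le_of_ne (not_lt.1 h2) fun h => hab (σ.symm.injective h).symm
    · intro h
      exact ⟨fun x y hxy => h x y (Or.inl hxy), not_lt.2 (h b a (Or.inr ⟨rfl, rfl⟩)).le⟩

theorem relW_zero {ι : Type*} [Fintype ι] [IsEmpty ι] (r : ι → ι → Prop) (δ : ι → Fin 2) :
    relW 0 r δ = 1 := by
  rw [relW, Finset.sum_eq_single (Equiv.equivOfIsEmpty _ _)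
    (fun σ _ h => absurd (Subsingleton.elim _ _) h) (fun h => absurd (by simp) h)]
  simp

-- Enumerations are sorted by their first element, which has to be minimal for the relation; the
-- rest enumerates its complement.
open Classical in
theorem relW_succ {ι : Type*} [Fintype ι] (n : ℕ) (r : ι → ι → Prop) (δ : ι → Fin 2) :
    relW (n + 1) r δ = ∑ x with ∀ y, ¬ r y x,
      e (δ x) * relW n (fun y z : {y // y ≠ x} => r y z) (fun y => δ y) := by
  have hfib : ∀ x : ι, (∑ σ : Fin (n + 1) ≃ ι with
        (∀ x y, r x y → σ.symm x < σ.symm y) ∧ σ 0 = x,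
        word (List.ofFn fun i => δ (σ i))) =
      if ∀ y, ¬ r y x then
        e (δ x) * relW n (fun y z : {y // y ≠ x} => r y z) (fun y => δ y) else 0 := by
    intro x
    split_ifs with hx
    · rw [relW, Finset.mul_sum]
      have hext : ∀ τ : Fin n ≃ {y // y ≠ x}, ∃ σ : Fin (n + 1) ≃ ι, σ 0 = x ∧
          ∀ i, σ (Fin.succ i) = τ i := fun τ =>
        ⟨(finSuccEquiv n).trans ((Equiv.optionSubtype x).symm τ).1, by simp, by simp⟩
      choose F hF0 hFs using hext
      refine (Finset.sum_bij (fun τ _ => F τ) ?_ ?_ ?_ ?_).symm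
      · intro τ hτ
        simp only [Finset.mem_filter, Finset.mem_univ, true_and] at hτ ⊢
        refine ⟨fun y z hyz => ?_, hF0 τ⟩
        have hs : ∀ y : {y // y ≠ x}, (F τ).symm y = (τ.symm y).succ := by
          intro y
          rw [Equiv.symm_apply_eq, hFs, Equiv.apply_symm_apply]
        have h0 : (F τ).symm x = 0 := by rw [Equiv.symm_apply_eq, hF0]
        have hz : z ≠ x := by rintro rfl; exact hx _ hyz
        by_cases hy : y = x
        · subst hy
          rw [h0, hs ⟨z, hz⟩]
          exact Fin.succ_pos _
        · rw [hs ⟨y, hy⟩, hs ⟨z, hz⟩, Fin.succ_lt_succ_iff]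
          exact hτ ⟨y, hy⟩ ⟨z, hz⟩ hyz
      · intro τ _ τ' _ h
        ext i
        rw [← hFs, ← hFs, h]
      · intro σ hσ
        simp only [Finset.mem_filter, Finset.mem_univ, true_and] at hσ
        have hne : ∀ i : Fin n, σ i.succ ≠ x := by
          intro i h
          rw [← hσ.2] at h
          exact Fin.succ_ne_zero i (σ.injective h)
        let τ : Fin n ≃ {y // y ≠ x} := Equiv.ofBijective (fun i => ⟨σ i.succ, hne i⟩) (by
          constructor
          · intro i j h
            simpa using h
          · rintro ⟨y, hy⟩
            obtain ⟨j, rfl⟩ := σ.surjective y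
            have hj : j ≠ 0 := by rintro rfl; exact hy hσ.2
            obtain ⟨i, rfl⟩ := Fin.exists_succ_eq.2 hj
            exact ⟨i, rfl⟩)
        have hτ : ∀ i, (τ i : ι) = σ i.succ := fun _ => rfl
        have hτs : ∀ y : {y // y ≠ x}, σ.symm y = (τ.symm y).succ := by
          intro y
          rw [Equiv.symm_apply_eq, ← hτ, Equiv.apply_symm_apply]
        refine ⟨τ, ?_, ?_⟩
        · simp only [Finset.mem_filter, Finset.mem_univ, true_and]
          intro y z hyz
          have := hσ.1 _ _ hyz
          rwa [hτs, hτs, Fin.succ_lt_succ_iff] at this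
        · ext i
          refine Fin.cases ?_ (fun i => ?_) i
          · rw [hF0, hσ.2]
          · rw [hFs, hτ]
      · intro τ _
        rw [List.ofFn_succ, word_cons]
        simp [hF0, hFs]
    · refine Finset.sum_eq_zero fun σ hσ => ?_
      exfalso
      simp only [Finset.mem_filter, Finset.mem_univ, true_and] at hσ
      push Not at hx
      obtain ⟨y, hy⟩ := hx
      have := hσ.1 _ _ hy
      rw [← hσ.2, Equiv.symm_apply_apply] at this
      exact absurd this (Fin.not_lt_zero _)
  rw [Finset.sum_filter, ← Finset.sum_congr rfl fun x _ => hfib x, relW,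
    ← Finset.sum_fiberwise_of_maps_to (g := fun σ : Fin (n + 1) ≃ ι => σ 0)
      (t := Finset.univ) fun _ _ => Finset.mem_univ _]
  refine Finset.sum_congr rfl fun x _ => Finset.sum_congr ?_ fun _ _ => rfl
  ext σ
  simp

/-! ### Disjoint unions and the shuffle product. -/

theorem shuffle_e_mul (a a' : Fin 2) (x y : H) :
    shuffle (e a * x) (e a' * y) = e a * shuffle x (e a' * y) + e a' * shuffle (e a * x) y := by
  induction x using word_induction wordBasis with
  | basis v =>
    induction y using word_induction wordBasis with
    | basis w =>
      simp only [wordBasis_apply, ← word_cons, shuffle_word]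
      rw [shuffleWord]
    | add y z hy hz => simp only [mul_add, map_add, hy, hz]; abel
    | smul q y hy => simp only [mul_smul_comm, map_smul, hy, smul_add]
  | add y z hy hz => simp only [mul_add, map_add, LinearMap.add_apply, hy, hz]; abel
  | smul q y hy => simp only [mul_smul_comm, map_smul, LinearMap.smul_apply, hy, smul_add]

theorem one_shuffle (x : H) : shuffle 1 x = x := by
  induction x using word_induction wordBasis with
  | basis w => rw [wordBasis_apply, ← word_nil, shuffle_word, shuffleWord]
  | add y z hy hz => simp only [map_add, hy, hz]
  | smul q y hy => simp only [map_smul, hy]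

theorem shuffle_one (x : H) : shuffle x 1 = x := by
  induction x using word_induction wordBasis with
  | basis w => rw [wordBasis_apply, ← word_nil, shuffle_word, shuffleWord_nil_right]
  | add y z hy hz => simp only [map_add, LinearMap.add_apply, hy, hz]
  | smul q y hy => simp only [map_smul, LinearMap.smul_apply, hy]

/-- A minimal element of the disjoint union is a minimal element of one of the two parts; removing
it reproduces the recursion of the shuffle product. -/
theorem relW_sum {ι κ : Type} [Fintype ι] [Fintype κ] (m n : ℕ) (hm : Fintype.card ι = m)
    (hn : Fintype.card κ = n) (r : ι → ι → Prop) (s : κ → κ → Prop) (δ : ι → Fin 2)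
    (ε : κ → Fin 2) :
    relW (m + n) (Sum.LiftRel r s) (Sum.elim δ ε) = shuffle (relW m r δ) (relW n s ε) := by
  classical
  obtain ⟨N, hN⟩ : ∃ N, m + n = N := ⟨_, rfl⟩
  induction N generalizing ι κ m n with
  | zero =>
    obtain ⟨rfl, rfl⟩ : m = 0 ∧ n = 0 := by omega
    have := Fintype.card_eq_zero_iff.1 hm
    have := Fintype.card_eq_zero_iff.1 hn
    rw [relW_zero, relW_zero, relW_zero, one_shuffle]
  | succ N ih =>
    match m, n with
    | 0, n =>
      have := Fintype.card_eq_zero_iff.1 hm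
      rw [relW_zero r, one_shuffle, zero_add]
      refine relW_equiv (Equiv.emptySum ι κ) ?_ ?_
      · rintro (x | x) (y | y)
        · exact isEmptyElim x
        · exact isEmptyElim x
        · exact isEmptyElim y
        · simp
      · rintro (x | x)
        · exact isEmptyElim x
        · simp
    | m + 1, 0 =>
      have := Fintype.card_eq_zero_iff.1 hn
      rw [relW_zero s, shuffle_one, add_zero]
      refine relW_equiv (Equiv.sumEmpty ι κ) ?_ ?_
      · rintro (x | x) (y | y)
        · simp
        · exact isEmptyElim y
        · exact isEmptyElim x
        · exact isEmptyElim x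
      · rintro (x | x)
        · simp
        · exact isEmptyElim x
    | m + 1, n + 1 =>
      have hι : ∀ x : ι, Fintype.card {y // y ≠ x} = m := by
        intro x
        rw [Fintype.card_subtype_compl, hm]
        simp
      have hκ : ∀ x : κ, Fintype.card {y // y ≠ x} = n := by
        intro x
        rw [Fintype.card_subtype_compl, hn]
        simp
      have h1 : relW (m + 1 + (n + 1)) (Sum.LiftRel r s) (Sum.elim δ ε) =
          ∑ x with ∀ y, ¬ r y x, e (δ x) * relW (m + (n + 1))
            (Sum.LiftRel (fun y z : {y // y ≠ x} => r y z) s) (Sum.elim (fun y => δ y) ε) +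
          ∑ x with ∀ y, ¬ s y x, e (ε x) * relW (m + 1 + n)
            (Sum.LiftRel r (fun y z : {y // y ≠ x} => s y z)) (Sum.elim δ (fun y => ε y)) := by
        rw [← add_assoc, relW_succ, Finset.sum_filter, Fintype.sum_sum_type, Finset.sum_filter,
          Finset.sum_filter]
        congr 1
        · refine Finset.sum_congr rfl fun x _ => ?_
          have hiff : (∀ y, ¬ Sum.LiftRel r s y (Sum.inl x)) ↔ ∀ y, ¬ r y x := by
            constructor
            · intro h y hy
              exact h (Sum.inl y) (Sum.liftRel_inl_inl.2 hy)
            · rintro h (y | y)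
              · simpa using h y
              · simp
          simp only [hiff]
          refine if_congr Iff.rfl ?_ rfl
          rw [Sum.elim_inl, show m + (n + 1) = m + 1 + n by omega]
          congr 1
          refine relW_equiv (Equiv.subtypeSum.trans (Equiv.sumCongr (Equiv.subtypeEquivRight
            fun y => by simp) (Equiv.subtypeUnivEquiv fun y => by simp))) ?_ ?_
          · rintro ⟨y | y, hy⟩ ⟨z | z, hz⟩ <;> simp [Equiv.subtypeSum]
          · rintro ⟨y | y, hy⟩ <;> simp [Equiv.subtypeSum]
        · refine Finset.sum_congr rfl fun x _ => ?_
          have hiff : (∀ y, ¬ Sum.LiftRel r s y (Sum.inr x)) ↔ ∀ y, ¬ s y x := by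
            constructor
            · intro h y hy
              exact h (Sum.inr y) (Sum.liftRel_inr_inr.2 hy)
            · rintro h (y | y)
              · simp
              · simpa using h y
          simp only [hiff]
          refine if_congr Iff.rfl ?_ rfl
          rw [Sum.elim_inr]
          congr 1
          refine relW_equiv (Equiv.subtypeSum.trans (Equiv.sumCongr 
            (Equiv.subtypeUnivEquiv fun y => by simp) (Equiv.subtypeEquivRight
            fun y => by simp))) ?_ ?_
          · rintro ⟨y | y, hy⟩ ⟨z | z, hz⟩ <;> simp [Equiv.subtypeSum]
          · rintro ⟨y | y, hy⟩ <;> simp [Equiv.subtypeSum]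
      rw [h1]
      have h3 : ∀ x : ι, relW (m + (n + 1)) (Sum.LiftRel (fun y z : {y // y ≠ x} => r y z) s)
          (Sum.elim (fun y => δ y) ε) =
          shuffle (relW m (fun y z : {y // y ≠ x} => r y z) fun y => δ y) (relW (n + 1) s ε) :=
        fun x => ih _ _ (hι x) hn _ _ _ _ (by omega)
      have h4 : ∀ x : κ, relW (m + 1 + n) (Sum.LiftRel r (fun y z : {y // y ≠ x} => s y z))
          (Sum.elim δ (fun y => ε y)) =
          shuffle (relW (m + 1) r δ) (relW n (fun y z : {y // y ≠ x} => s y z) fun y => ε y) :=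
        fun x => ih _ _ hm (hκ x) _ _ _ _ (by omega)
      simp only [h3, h4]
      simp only [relW_succ m, relW_succ n, map_sum, LinearMap.sum_apply, shuffle_e_mul,
        Finset.mul_sum, Finset.sum_add_distrib]
      congr 1
      rw [Finset.sum_comm]

end LinearExtensions

end MZV

namespace MZV

/-! ### Zigzags -/

section Zigzag

/-- The direction of the step which leads to a vertex of a zigzag diagram. -/
def stepUp (D : List (Fin 2 × Bool)) (i : ℕ) : Bool := (D[i]?.map Prod.snd).getD true

/-- The generating relations of a zigzag. -/
def stepRel (up : ℕ → Bool) (i j : ℕ) : Prop :=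
  (j = i + 1 ∧ up j = true) ∨ (i = j + 1 ∧ up i = false)

/-- The sum of the words of all linear extensions of a zigzag diagram. -/
noncomputable def zigzagSum (D : List (Fin 2 × Bool)) : H :=
  relW D.length (fun i j : Fin D.length => stepRel (stepUp D) i j) fun i => D[i].1

/-- An enumeration respects the order of the zigzag as soon as it respects the comparisons of
neighbours, which generate it. -/
theorem zigzag_W (D : List (Fin 2 × Bool)) : (zigzag D).W = zigzagSum D := by
  classical
  have hcard : Fintype.card (zigzag D).carrier = D.length := Fintype.card_fin _
  have key : ∀ n, ∀ σ : Fin n ≃ Fin D.length,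
      (∀ i j, zigzagLE (stepUp D) (σ i) (σ j) → i ≤ j) ↔
        ∀ x y : Fin D.length, stepRel (stepUp D) x y → σ.symm x < σ.symm y := by
    intro n σ
    constructor
    · intro h x y hxy
      have hne : x ≠ y := by rintro rfl; rcases hxy with ⟨h, -⟩ | ⟨h, -⟩ <;> omega
      refine lt_of_le_of_ne (h _ _ ?_) fun h => hne (σ.symm.injective h)
      rw [σ.apply_symm_apply, σ.apply_symm_apply]
      rcases hxy with ⟨h1, h2⟩ | ⟨h1, h2⟩
      · exact Or.inl ⟨by omega, fun t h3 h4 => by rwa [show t = y by omega]⟩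
      · exact Or.inr ⟨by omega, fun t h3 h4 => by rwa [show t = x by omega]⟩
    · intro h i j hij
      rcases hij with ⟨h1, h2⟩ | ⟨h1, h2⟩
      -- The monotone stretch between the two vertices is traversed one step at a time.
      · have : ∀ k (hk : (σ i : ℕ) + k < D.length), (∀ t, (σ i : ℕ) < t → t ≤ σ i + k →
            stepUp D t = true) → i ≤ σ.symm ⟨σ i + k, hk⟩ := by
          intro k
          induction k with
          | zero => intro _ _; simp
          | succ k ih =>
            intro hk ht
            refine (ih (by omega) fun t h3 h4 => ht t h3 (by omega)).trans (h _ _ ?_).le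
            exact Or.inl ⟨rfl, ht _ (by simp) le_rfl⟩
        have h3 := this (σ j - σ i) (by omega) fun t h4 h5 => h2 t h4 (by omega)
        rwa [show (⟨(σ i : ℕ) + (σ j - σ i), by omega⟩ : Fin D.length) = σ j from
          Fin.ext (by simp; omega), σ.symm_apply_apply] at h3
      · have : ∀ k (hk : (σ j : ℕ) + k < D.length), (∀ t, (σ j : ℕ) < t → t ≤ σ j + k →
            stepUp D t = false) → σ.symm ⟨σ j + k, hk⟩ ≤ j := by
          intro k
          induction k with
          | zero => intro _ _; simp
          | succ k ih =>
            intro hk ht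
            refine (h _ _ ?_).le.trans (ih (by omega) fun t h3 h4 => ht t h3 (by omega))
            exact Or.inr ⟨rfl, ht _ (by simp) le_rfl⟩
        have h3 := this (σ i - σ j) (by omega) fun t h4 h5 => h2 t h4 (by omega)
        rwa [show (⟨(σ j : ℕ) + (σ i - σ j), by omega⟩ : Fin D.length) = σ i from
          Fin.ext (by simp; omega), σ.symm_apply_apply] at h3
  have h1 : (zigzag D).W = relW (Fintype.card (zigzag D).carrier)
      (fun i j : Fin D.length => stepRel (stepUp D) i j) fun i => D[i].1 := by
    rw [TwoPoset.W, relW]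
    refine Finset.sum_congr (Finset.ext fun σ => ?_) fun _ _ => rfl
    rw [TwoPoset.linearExtensions, Finset.mem_filter]
    refine Iff.trans ?_ (@Finset.mem_filter _ _ (_) Finset.univ _).symm
    exact ⟨fun h => ⟨Finset.mem_univ _, (key _ σ).1 h.2⟩,
      fun h => ⟨Finset.mem_univ _, (key _ σ).2 h.2⟩⟩
  rw [h1, hcard, zigzagSum]

theorem stepUp_append_left {P : List (Fin 2 × Bool)} (Q : List (Fin 2 × Bool)) {i : ℕ}
    (h : i < P.length) : stepUp (P ++ Q) i = stepUp P i := by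
  rw [stepUp, List.getElem?_append_left h, stepUp]

theorem stepUp_append_right (P Q : List (Fin 2 × Bool)) (i : ℕ) :
    stepUp (P ++ Q) (P.length + i) = stepUp Q i := by
  rw [stepUp, List.getElem?_append_right (by omega), stepUp, Nat.add_sub_cancel_left]

theorem stepUp_cons_succ (v : Fin 2 × Bool) (Q : List (Fin 2 × Bool)) (i : ℕ) :
    stepUp (v :: Q) (i + 1) = stepUp Q i := by
  simp [stepUp]

/-- No step leads to the first vertex, so its direction is never consulted. -/
theorem zigzagSum_head (a : Fin 2) (s s' : Bool) (Q : List (Fin 2 × Bool)) :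
    zigzagSum ((a, s) :: Q) = zigzagSum ((a, s') :: Q) := by
  refine relW_congr (fun i j => ?_) fun i => ?_
  · refine or_congr (and_congr_right fun h => ?_) (and_congr_right fun h => ?_)
    · rw [h, stepUp_cons_succ, stepUp_cons_succ]
    · rw [h, stepUp_cons_succ, stepUp_cons_succ]
  · obtain ⟨i, hi⟩ := i
    cases i <;> rfl

/-- A zigzag cut into two at one of its steps. -/
theorem zigzagSum_cut {P : List (Fin 2 × Bool)} (hP : P ≠ []) (a : Fin 2) (s : Bool)
    (Q : List (Fin 2 × Bool)) :
    shuffle (zigzagSum P) (zigzagSum ((a, s) :: Q)) =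
      zigzagSum (P ++ (a, true) :: Q) + zigzagSum (P ++ (a, false) :: Q) := by
  have hpos : 0 < P.length := List.length_pos_iff.2 hP
  let last : Fin P.length := ⟨P.length - 1, by omega⟩
  let first : Fin ((a, s) :: Q).length := ⟨0, by simp⟩
  -- The shuffle product is the sum over the disjoint union. Deciding the order of the last vertex
  -- of `P` and the vertex `a` produces the two zigzags.
  rw [zigzagSum, zigzagSum, ← relW_sum _ _ (Fintype.card_fin _) (Fintype.card_fin _),
    relW_split (a := Sum.inl last) (b := Sum.inr first) _ _ (by simp)]
  have hlen : ∀ s', P.length + ((a, s) :: Q).length = (P ++ (a, s') :: Q).length := by simp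
  let E : ∀ s' : Bool, Fin P.length ⊕ Fin ((a, s) :: Q).length ≃ Fin (P ++ (a, s') :: Q).length :=
    fun s' => finSumFinEquiv.trans (finCongr (hlen s'))
  have El : ∀ s' i, (E s' (Sum.inl i) : ℕ) = i := fun s' i => by simp [E]
  have Er : ∀ s' i, (E s' (Sum.inr i) : ℕ) = P.length + i := fun s' i => by simp [E]
  have hlab : ∀ s' x, Sum.elim (fun i : Fin P.length => P[i].1)
      (fun i : Fin ((a, s) :: Q).length => ((a, s) :: Q)[i].1) x =
      ((P ++ (a, s') :: Q)[E s' x]).1 := by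
    rintro s' (i | i)
    · simp [El]
    · have h := i.2
      obtain ⟨i, hi⟩ := i
      cases i with
      | zero => simp [Er, List.getElem_append_right]
      | succ i =>
        simp only [Sum.elim_inr, Fin.getElem_fin, Er]
        rw [List.getElem_append_right (by omega)]
        simp
  have hup0 : ∀ s', stepUp (P ++ (a, s') :: Q) P.length = s' := by
    intro s'
    have := stepUp_append_right P ((a, s') :: Q) 0
    rw [add_zero] at this
    rw [this]
    simp [stepUp]
  have hup : ∀ s' k, stepUp (P ++ (a, s') :: Q) (P.length + (k + 1)) =
      stepUp ((a, s) :: Q) (k + 1) := by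
    intro s' k
    rw [stepUp_append_right, stepUp_cons_succ, stepUp_cons_succ]
  have hll : ∀ s' (i j : Fin P.length), stepRel (stepUp P) i j ↔
      stepRel (stepUp (P ++ (a, s') :: Q)) i j := by
    intro s' i j
    rw [stepRel, stepRel, stepUp_append_left _ i.2, stepUp_append_left _ j.2]
  have hrr : ∀ s' (i j : ℕ), stepRel (stepUp ((a, s) :: Q)) i j ↔
      stepRel (stepUp (P ++ (a, s') :: Q)) (P.length + i) (P.length + j) := by
    intro s' i j
    refine or_congr ?_ ?_
    · constructor
      · rintro ⟨rfl, h⟩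
        exact ⟨by omega, by rw [hup]; exact h⟩
      · rintro ⟨h1, h2⟩
        obtain rfl : j = i + 1 := by omega
        exact ⟨rfl, by rwa [hup] at h2⟩
    · constructor
      · rintro ⟨rfl, h⟩
        exact ⟨by omega, by rw [hup]; exact h⟩
      · rintro ⟨h1, h2⟩
        obtain rfl : i = j + 1 := by omega
        exact ⟨rfl, by rwa [hup] at h2⟩
  have hlr : ∀ s' (i : Fin P.length) (j : Fin ((a, s) :: Q).length),
      stepRel (stepUp (P ++ (a, s') :: Q)) i (P.length + j) ↔
        (s' = true ∧ i = last ∧ j = first) := by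
    intro s' i j
    have hi := i.2
    simp only [stepRel, last, first, Fin.ext_iff]
    constructor
    · rintro (⟨h1, h2⟩ | ⟨h1, h2⟩)
      · rw [show P.length + (j : ℕ) = P.length by omega, hup0] at h2
        exact ⟨h2, by omega, by omega⟩
      · omega
    · rintro ⟨rfl, h1, h2⟩
      refine Or.inl ⟨by omega, ?_⟩
      rw [h2, add_zero, hup0]
  have hrl : ∀ s' (i : Fin P.length) (j : Fin ((a, s) :: Q).length),
      stepRel (stepUp (P ++ (a, s') :: Q)) (P.length + j) i ↔
        (s' = false ∧ i = last ∧ j = first) := by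
    intro s' i j
    have hi := i.2
    simp only [stepRel, last, first, Fin.ext_iff]
    constructor
    · rintro (⟨h1, h2⟩ | ⟨h1, h2⟩)
      · omega
      · rw [show P.length + (j : ℕ) = P.length by omega, hup0] at h2
        exact ⟨h2, by omega, by omega⟩
    · rintro ⟨rfl, h1, h2⟩
      refine Or.inr ⟨by omega, ?_⟩
      rw [h2, add_zero, hup0]
  congr 1
  · refine relW_equiv_of_eq (hlen true) (E true) ?_ (hlab true)
    rintro (i | i) (j | j)
    · simp [El, ← hll]
    · simp [El, Er, hlr]
    · simp [El, Er, hrl]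
    · simp [Er, ← hrr]
  · refine relW_equiv_of_eq (hlen false) (E false) ?_ (hlab false)
    rintro (i | i) (j | j)
    · simp [El, ← hll]
    · simp [El, Er, hlr]
    · simp [El, Er, hrl, and_comm]
    · simp [Er, ← hrr]

/-- A chain has one linear extension: the only order automorphism of `Fin n` is the identity. -/
theorem relW_chain (n : ℕ) (δ : Fin n → Fin 2) :
    relW n (fun i j : Fin n => (j : ℕ) = i + 1) δ = word (List.ofFn δ) := by
  classical
  rw [relW, Finset.sum_eq_single (Equiv.refl _)]
  · rfl
  · intro σ hσ hne
    exfalso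
    apply hne
    simp only [Finset.mem_filter, Finset.mem_univ, true_and] at hσ
    have hmono : StrictMono σ.symm := by
      cases n with
      | zero => exact fun i => i.elim0
      | succ n => exact Fin.strictMono_iff_lt_succ.2 fun i => hσ _ _ (by simp)
    have h : ⇑σ.symm = id := congrArg DFunLike.coe (Subsingleton.elim
      (hmono.orderIsoOfSurjective _ σ.symm.surjective) (OrderIso.refl _))
    ext i
    have := congrFun h (σ i)
    simp at this
    simp [← this]
  · intro h
    refine absurd ?_ h
    simp only [Finset.mem_filter, Finset.mem_univ, true_and]
    intro x y hxy
    simp only [Equiv.refl_symm, Equiv.refl_apply, Fin.lt_def]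
    omega

theorem zigzagSum_up (L : List (Fin 2)) : zigzagSum (L.map fun a => (a, true)) = word L := by
  have hlen : (L.map fun a => (a, true)).length = L.length := by simp
  have h := relW_chain L.length fun i => L[(i : ℕ)]
  rw [List.ofFn_getElem] at h
  rw [← h]
  refine relW_equiv_of_eq hlen (finCongr hlen) (fun i j => ?_) fun i => by simp
  have hu : ∀ k, stepUp (L.map fun a => (a, true)) k = true := by
    intro k
    simp only [stepUp, List.getElem?_map]
    cases L[k]? <;> rfl
  simp [stepRel, hu]

theorem zigzagSum_down (L : List (Fin 2)) :
    zigzagSum (L.map fun a => (a, false)) = word L.reverse := by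
  have hlen : (L.map fun a => (a, false)).length = L.reverse.length := by simp
  have h := relW_chain L.reverse.length fun i => L.reverse[(i : ℕ)]
  rw [List.ofFn_getElem] at h
  rw [← h]
  refine relW_equiv_of_eq hlen ((finCongr hlen).trans Fin.revPerm) (fun i j => ?_) fun i => ?_
  · have hu : ∀ k, k < L.length → stepUp (L.map fun a => (a, false)) k = false := by
      intro k hk
      simp [stepUp, List.getElem?_eq_getElem hk]
    have hi : (i : ℕ) < L.length := by simpa using i.2
    have hj : (j : ℕ) < L.length := by simpa using j.2
    simp only [stepRel, hu _ hi, hu _ hj]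
    simp [Fin.val_rev]
    omega
  · have hi : (i : ℕ) < L.length := by simpa using i.2
    simp [Fin.val_rev]
    congr 1
    omega

end Zigzag

end MZV

namespace MZV

/-! ### The two products of `𝔥¹` and removal of a trailing `e₁` -/

section Strip

variable {S M : Type*} [AddCommSemigroup S] [DecidableEq S] [AddCommGroup M] [Module ℚ M]
  (b : Module.Basis (List S) ℚ M) (c : ℚ) (a₀ : S)

/-- Removal of the last letter of a word if it is `a₀`; the other words are mapped to `0`. -/
noncomputable def stripL {S M : Type*} [DecidableEq S] [AddCommGroup M] [Module ℚ M]
    (b : Module.Basis (List S) ℚ M) (a₀ : S) : M →ₗ[ℚ] M :=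
  b.constr ℚ fun w => if w.getLast? = some a₀ then b w.dropLast else 0

@[simp] theorem stripL_nil {S M : Type*} [DecidableEq S] [AddCommGroup M] [Module ℚ M]
    (b : Module.Basis (List S) ℚ M) (a₀ : S) : stripL b a₀ (b []) = 0 := by
  simp [stripL]

@[simp] theorem stripL_snoc {S M : Type*} [DecidableEq S] [AddCommGroup M] [Module ℚ M]
    (b : Module.Basis (List S) ℚ M) (a₀ a : S) (w : List S) :
    stripL b a₀ (b (w ++ [a])) = if a = a₀ then b w else 0 := by
  simp [stripL]

theorem stripL_snocL {S M : Type*} [DecidableEq S] [AddCommGroup M] [Module ℚ M]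
    (b : Module.Basis (List S) ℚ M) (a₀ a : S) (x : M) :
    stripL b a₀ (snocL b a x) = if a = a₀ then x else 0 := by
  induction x using word_induction b with
  | basis w => simp
  | add x y hx hy => simp only [map_add, hx, hy]; split_ifs <;> simp
  | smul q x hx => simp only [map_smul, hx]; split_ifs <;> simp

/-- By the recursion at the end of words, only the merging term could spoil the Leibniz rule. It is
absent if `c = 0`, as for shuffles, and is killed if `a₀` is not a sum, as for `a₀ = 1` among
positive integers. -/
theorem stripL_qmul (h : c = 0 ∨ ∀ x y : S, x + y ≠ a₀) (x y : M) :
    stripL b a₀ (qmul b c x y) = qmul b c (stripL b a₀ x) y + qmul b c x (stripL b a₀ y) := by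
  induction x using word_induction b with
  | basis v =>
    induction y using word_induction b with
    | basis w =>
      rcases List.eq_nil_or_concat v with rfl | ⟨v, a, rfl⟩
      · simp
      rcases List.eq_nil_or_concat w with rfl | ⟨w, a', rfl⟩
      · simp
      simp only [List.concat_eq_append]
      have h0 : c • stripL b a₀ (snocL b (a + a') (qmul b c (b v) (b w))) = 0 := by
        rcases h with rfl | h
        · simp
        · rw [stripL_snocL, if_neg (h _ _), smul_zero]
      rw [qmul_basis_snoc, map_add, map_add, map_smul, h0, stripL_snocL, stripL_snocL, stripL_snoc,
        stripL_snoc]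
      split_ifs <;> simp
    | add y z hy hz => simp only [map_add, hy, hz]; abel
    | smul q y hy => simp only [map_smul, hy, smul_add]
  | add y z hy hz => simp only [map_add, LinearMap.add_apply, hy, hz]; abel
  | smul q y hy => simp only [map_smul, LinearMap.smul_apply, hy, smul_add]

theorem stripL_nilpotent {S M : Type*} [DecidableEq S] [AddCommGroup M] [Module ℚ M]
    (b : Module.Basis (List S) ℚ M) (a₀ : S) (x : M) : ∃ N, (stripL b a₀ ^ N) x = 0 := by
  induction x using word_induction b with
  | basis w =>
    induction w using List.reverseRecOn with
    | nil => exact ⟨1, by simp⟩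
    | append_singleton w a ih =>
      obtain ⟨N, hN⟩ := ih
      refine ⟨N + 1, ?_⟩
      rw [pow_succ, Module.End.mul_apply, stripL_snoc]
      split_ifs <;> simp [hN]
  | add x y hx hy =>
    obtain ⟨N, hN⟩ := hx
    obtain ⟨K, hK⟩ := hy
    refine ⟨N + K, ?_⟩
    rw [map_add, pow_add, Module.End.mul_apply, Module.End.mul_apply, hK, ← Module.End.mul_apply,
      ← pow_add, add_comm N K, pow_add, Module.End.mul_apply, hN]
    simp
  | smul q x hx =>
    obtain ⟨N, hN⟩ := hx
    exact ⟨N, by rw [map_smul, hN, smul_zero]⟩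

end Strip

/-! ### The shuffle and harmonic products as quasi-shuffle products. -/

theorem consL_wordBasis (a : Fin 2) (x : H) : consL wordBasis a x = e a * x := by
  induction x using word_induction wordBasis with
  | basis w => rw [consL_basis, wordBasis_apply, wordBasis_apply, word_cons]
  | add x y hx hy => rw [map_add, hx, hy, mul_add]
  | smul q x hx => rw [map_smul, hx, mul_smul_comm]

theorem snocL_wordBasis (a : Fin 2) (x : H) : snocL wordBasis a x = x * e a := by
  induction x using word_induction wordBasis with
  | basis w => rw [snocL_basis, wordBasis_apply, wordBasis_apply, word_append]; simp
  | add x y hx hy => rw [map_add, hx, hy, add_mul]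
  | smul q x hx => rw [map_smul, hx, smul_mul_assoc]

/-- The addition of letters in `Fin 2` is irrelevant, since its coefficient is 0. -/
theorem shuffle_eq_qmul : shuffle = qmul wordBasis 0 := by
  refine wordBasis.ext fun v => wordBasis.ext fun w => ?_
  rw [qmul_basis, wordBasis_apply, wordBasis_apply, shuffle_word]
  induction v, w using words_induction with
  | nil_left w => rw [shuffleWord, qword, wordBasis_apply]
  | nil_right v => rw [shuffleWord_nil_right]; cases v <;> rw [qword, wordBasis_apply]
  | cons a v a' w h1 h2 h3 =>
    rw [shuffleWord, qword, h1, h2, consL_wordBasis, consL_wordBasis, zero_smul, add_zero]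

@[simp] theorem consL_mono (k : ℕ+) (w : List ℕ+) :
    consL indexBasis k (mono w) = mono (k :: w) := by
  rw [← indexBasis_apply, consL_basis, indexBasis_apply]

@[simp] theorem snocL_mono (k : ℕ+) (w : List ℕ+) :
    snocL indexBasis k (mono w) = mono (w ++ [k]) := by
  rw [← indexBasis_apply, snocL_basis, indexBasis_apply]

theorem eMul_eq_consL (k : ℕ+) : eMul k = consL indexBasis k :=
  indexBasis.ext fun w => by simp

theorem harmWith_eq_qmul (c : ℚ) : harmWith c = qmul indexBasis c := by
  refine indexBasis.ext fun v => indexBasis.ext fun w => ?_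
  rw [qmul_basis, indexBasis_apply, indexBasis_apply, harmWith_mono]
  induction v, w using words_induction with
  | nil_left w => rw [harmIndex, qword, indexBasis_apply]
  | nil_right v => cases v <;> rw [harmIndex, qword, indexBasis_apply]
  | cons a v a' w h1 h2 h3 => rw [harmIndex, qword, h1, h2, h3]; simp only [eMul_eq_consL]

/-- The shuffle product of `𝔥¹` as a bilinear map. -/
noncomputable def shuffleL : H1 →ₗ[ℚ] H1 →ₗ[ℚ] H1 :=
  LinearMap.mk₂ ℚ shuffle1 (fun x y z => Subtype.ext (by simp [shuffle1]))
    (fun q x y => Subtype.ext (by simp [shuffle1])) (fun x y z => Subtype.ext (by simp [shuffle1]))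
    (fun q x y => Subtype.ext (by simp [shuffle1]))

theorem coe_shuffleL (x y : H1) : (shuffleL x y : H) = shuffle x y := rfl

theorem one_shuffleL (x : H1) : shuffleL (mono []) x = x :=
  Subtype.ext (by simp [coe_shuffleL, one_shuffle])

theorem shuffleL_comm (x y : H1) : shuffleL x y = shuffleL y x :=
  Subtype.ext (by rw [coe_shuffleL, coe_shuffleL, shuffle_eq_qmul, qmul_comm])

theorem shuffleL_assoc (x y z : H1) :
    shuffleL (shuffleL x y) z = shuffleL x (shuffleL y z) :=
  Subtype.ext (by simp only [coe_shuffleL, shuffle_eq_qmul, qmul_assoc])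

/-! ### Removal of a trailing `e₁` as a derivation with kernel 𝔥⁰. -/

theorem indexWord_append (k l : List ℕ+) : indexWord (k ++ l) = indexWord k ++ indexWord l := by
  simp [indexWord]

/-- The derivation of `𝔥¹` which removes a trailing `e₁`. -/
noncomputable def dropOne : H1 →ₗ[ℚ] H1 := stripL indexBasis 1

@[simp] theorem dropOne_nil : dropOne (mono []) = 0 := by
  rw [dropOne, ← indexBasis_apply, stripL_nil]

@[simp] theorem dropOne_snoc (k : List ℕ+) (a : ℕ+) :
    dropOne (mono (k ++ [a])) = if a = 1 then mono k else 0 := by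
  rw [dropOne, ← indexBasis_apply, stripL_snoc, indexBasis_apply]

theorem indexWord_snoc_of_ne_one (k : List ℕ+) {a : ℕ+} (ha : a ≠ 1) :
    ∃ w, indexWord (k ++ [a]) = w ++ [0] := by
  obtain ⟨n, hn⟩ : ∃ n, (a : ℕ) - 1 = n + 1 := ⟨(a : ℕ) - 2, by
    have := a.pos
    have : (a : ℕ) ≠ 1 := fun h => ha (PNat.eq h)
    omega⟩
  refine ⟨indexWord k ++ 1 :: List.replicate n 0, ?_⟩
  rw [indexWord_append, indexWord_cons, letterWord, hn, List.replicate_succ']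
  simp

/-- Among the words of the e_k only that of e₁ ends in the letter 1. Thus one map strips a component
of an index and a letter of a word, and is a derivation for both products. -/
theorem coe_dropOne (x : H1) : (dropOne x : H) = stripL wordBasis 1 (x : H) := by
  induction x using word_induction indexBasis with
  | basis k =>
    rw [indexBasis_apply]
    rcases List.eq_nil_or_concat k with rfl | ⟨k, a, rfl⟩
    · rw [dropOne_nil, coe_mono, indexWord_nil, ← wordBasis_apply, stripL_nil]; rfl
    · rw [List.concat_eq_append, dropOne_snoc, coe_mono, ← wordBasis_apply]
      by_cases ha : a = 1
      · subst ha
        have : indexWord (k ++ [1]) = indexWord k ++ [1] := by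
          simp [indexWord_append, letterWord]
        rw [if_pos rfl, this, stripL_snoc, if_pos rfl, wordBasis_apply, coe_mono]
      · obtain ⟨w, hw⟩ := indexWord_snoc_of_ne_one k ha
        rw [if_neg ha, hw, stripL_snoc, if_neg (by decide)]
        rfl
  | add x y hx hy => simp [hx, hy]
  | smul q x hx => simp [hx]

theorem dropOne_shuffleL (x y : H1) :
    dropOne (shuffleL x y) = shuffleL (dropOne x) y + shuffleL x (dropOne y) := by
  apply Subtype.ext
  rw [coe_dropOne, coe_shuffleL, shuffle_eq_qmul, stripL_qmul _ _ _ (Or.inl rfl),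
    ← coe_dropOne, ← coe_dropOne, ← shuffle_eq_qmul]
  rfl

theorem dropOne_harm (x y : H1) :
    dropOne (harm x y) = harm (dropOne x) y + harm x (dropOne y) := by
  rw [harm, harmWith_eq_qmul]
  refine stripL_qmul _ _ _ (Or.inr fun x y h => ?_) x y
  have h1 := x.pos
  have h2 := y.pos
  have h3 := congrArg PNat.val h
  rw [PNat.add_coe, PNat.one_coe] at h3
  omega

theorem dropOne_nilpotent (x : H1) : ∃ N, (dropOne ^ N) x = 0 := stripL_nilpotent _ _ x

theorem dropOne_e1 : dropOne (mono [1]) = mono [] := by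
  simpa using dropOne_snoc [] 1

/-- Subtracting `dropOne x` followed by e₁ from x removes exactly the indices that end in 1. -/
theorem mem_H0_of_dropOne {x : H1} (hx : dropOne x = 0) : (x : H) ∈ H0 := by
  have key : ∀ x : H1, ((x - snocL indexBasis 1 (dropOne x) : H1) : H) ∈ H0 := by
    intro x
    induction x using word_induction indexBasis with
    | basis k =>
      rw [indexBasis_apply]
      rcases List.eq_nil_or_concat k with rfl | ⟨k, a, rfl⟩
      · simpa using one_mem_H0
      · rw [List.concat_eq_append, dropOne_snoc]
        split_ifs with ha
        · rw [← indexBasis_apply k, snocL_basis, ha, indexBasis_apply, sub_self]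
          exact zero_mem _
        · rw [map_zero, sub_zero]
          refine indexWord_mem_H0 fun b hb => ?_
          obtain rfl : a = b := by simpa using hb
          have := a.pos
          have : (a : ℕ) ≠ 1 := fun h => ha (PNat.eq h)
          omega
    | add x y hx hy =>
      have := add_mem hx hy
      rw [← Submodule.coe_add] at this
      convert this using 2
      simp only [map_add]
      abel
    | smul q x hx =>
      have := H0.smul_mem q hx
      rw [← Submodule.coe_smul] at this
      convert this using 2
      simp only [map_smul, smul_sub]
  simpa [hx] using key x

theorem dropOne_incl (x : H0) : dropOne (incl x) = 0 := by
  obtain ⟨x, hx⟩ := x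
  apply Subtype.ext
  rw [coe_dropOne]
  change stripL wordBasis 1 x = 0
  rw [H0_eq_span] at hx
  induction hx using Submodule.span_induction with
  | mem x h =>
    rcases h with rfl | ⟨w, rfl⟩
    · rw [← word_nil, ← wordBasis_apply, stripL_nil]
    · dsimp only
      rw [← wordBasis_apply, ← List.cons_append, stripL_snoc, if_neg (by decide)]
  | zero => simp
  | add x y _ _ hx hy => simp [hx, hy]
  | smul q x _ hx => simp [hx]

theorem exists_incl {x : H1} (hx : dropOne x = 0) : ∃ y : H0, incl y = x :=
  ⟨⟨x, mem_H0_of_dropOne hx⟩, rfl⟩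

theorem one_harm (x : H1) : harm (mono []) x = x := by
  rw [harm, harmWith_eq_qmul, ← indexBasis_apply, one_qmul]

theorem harm_one (x : H1) : harm x (mono []) = x := by
  rw [harm, harmWith_eq_qmul, ← indexBasis_apply, qmul_one]

theorem harm_comm (x y : H1) : harm x y = harm y x := by
  rw [harm, harmWith_eq_qmul, qmul_comm]

theorem harm_assoc (x y z : H1) : harm (harm x y) z = harm x (harm y z) := by
  rw [harm, harmWith_eq_qmul, qmul_assoc]

/-! ### Existence of the two regularizations and their derivatives in T. -/

section Regularization

open Polynomial

variable {Z : H0 →ₗ[ℚ] ℝ}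

theorem exists_extend_H1 (Z : H0 →ₗ[ℚ] ℝ) : ∃ Z' : H1 →ₗ[ℚ] ℝ, ∀ x, Z' (incl x) = Z x := by
  obtain ⟨g, hg⟩ := LinearMap.exists_extend Z
  exact ⟨g ∘ₗ H1.subtype, fun x => LinearMap.congr_fun hg x⟩

theorem isShuffleReg_shuffleReg (hds : DoubleShuffle Z) : IsShuffleReg Z (shuffleReg Z) := by
  obtain ⟨Z', hZ'⟩ := exists_extend_H1 Z
  obtain ⟨f, h1, h2, h3, h4⟩ := exists_extension_of_mul one_shuffleL shuffleL_comm shuffleL_assoc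
    dropOne_shuffleL dropOne_nilpotent dropOne_e1 Z' ((hZ' ⟨1, one_mem_H0⟩).trans hds.map_one)
    (fun x y hx hy => by
      obtain ⟨x, rfl⟩ := exists_incl hx
      obtain ⟨y, rfl⟩ := exists_incl hy
      rw [hZ', hZ', ← hds.map_shuffle, ← hZ']
      rfl)
  exact Classical.epsilon_spec (p := IsShuffleReg Z)
    ⟨f, h1, h2, fun x => by rw [h4 _ (dropOne_incl x), hZ'], h3⟩

theorem isHarmReg_harmReg (hds : DoubleShuffle Z) : IsHarmReg Z (harmReg Z) := by
  obtain ⟨Z', hZ'⟩ := exists_extend_H1 Z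
  obtain ⟨f, h1, h2, h3, h4⟩ := exists_extension_of_mul one_harm harm_comm harm_assoc
    dropOne_harm dropOne_nilpotent dropOne_e1 Z' ((hZ' ⟨1, one_mem_H0⟩).trans hds.map_one)
    (fun x y hx hy => by
      obtain ⟨x, rfl⟩ := exists_incl hx
      obtain ⟨y, rfl⟩ := exists_incl hy
      rw [hZ', hZ', ← hds.map_harm, ← hZ']
      rfl)
  exact Classical.epsilon_spec (p := IsHarmReg Z)
    ⟨f, h1, h2, fun x => by rw [h4 _ (dropOne_incl x), hZ'], h3⟩

theorem IsShuffleReg.derivative {f : H1 →ₗ[ℚ] ℝ[X]} (hf : IsShuffleReg Z f) (x : H1) :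
    Polynomial.derivative (f x) = f (dropOne x) :=
  derivative_extension_of_mul one_shuffleL shuffleL_comm shuffleL_assoc dropOne_shuffleL
    dropOne_nilpotent dropOne_e1 f hf.map_one hf.map_mul hf.map_e1
    (fun x hx => by
      obtain ⟨x, rfl⟩ := exists_incl hx
      exact ⟨_, hf.extends_Z x⟩) x

theorem IsHarmReg.derivative {f : H1 →ₗ[ℚ] ℝ[X]} (hf : IsHarmReg Z f) (x : H1) :
    Polynomial.derivative (f x) = f (dropOne x) :=
  derivative_extension_of_mul one_harm harm_comm harm_assoc dropOne_harm
    dropOne_nilpotent dropOne_e1 f hf.map_one hf.map_mul hf.map_e1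
    (fun x hx => by
      obtain ⟨x, rfl⟩ := exists_incl hx
      exact ⟨_, hf.extends_Z x⟩) x

end Regularization

end MZV

namespace MZV

/-! ### The regularization theorem in terms of convolution -/

section RegConv

open Polynomial

/-- The function on indices with value `A n` at `(1, …, 1)` (`n` times) and `0` elsewhere. -/
def onesFn {R : Type*} [Zero R] (A : ℕ → R) : List ℕ+ → R
  | [] => A 0
  | a :: w => if a = 1 then onesFn (fun n => A (n + 1)) w else 0

theorem onesFn_replicate {R : Type*} [Zero R] (A : ℕ → R) (n : ℕ) :
    onesFn A (List.replicate n 1) = A n := by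
  induction n generalizing A with
  | zero => rfl
  | succ n ih => rw [List.replicate_succ, onesFn, if_pos rfl, ih]

theorem onesFn_append_cons {R : Type*} [Zero R] (A : ℕ → R) (u v : List ℕ+) {c : ℕ+}
    (hc : c ≠ 1) : onesFn A (u ++ c :: v) = 0 := by
  induction u generalizing A with
  | nil => simp [onesFn, hc]
  | cons a u ih => rw [List.cons_append, onesFn, ih, ite_self]

theorem onesFn_snoc {R : Type*} [Zero R] (A : ℕ → R) (w : List ℕ+) (a : ℕ+) :
    onesFn A (w ++ [a]) = if a = 1 then onesFn (fun n => A (n + 1)) w else 0 := by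
  induction w generalizing A with
  | nil => rfl
  | cons b w ih =>
    rw [List.cons_append, onesFn, ih, onesFn]
    split_ifs <;> rfl

/-- The functional `∑ aₙ Tⁿ ↦ ∑ n! Aₙ aₙ`. -/
noncomputable def evalRho (A : ℕ → ℝ) : ℝ[X] →ₗ[ℝ] ℝ :=
  (Polynomial.basisMonomials ℝ).constr ℝ fun n => (n.factorial : ℝ) * A n

theorem evalRho_monomial (A : ℕ → ℝ) (n : ℕ) :
    evalRho A (monomial n 1) = n.factorial * A n := by
  have h : monomial n (1 : ℝ) = Polynomial.basisMonomials ℝ n := by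
    rw [Polynomial.coe_basisMonomials]
  rw [h, evalRho, Module.Basis.constr_basis]

/-- On Tⁿ with n ≥ 1 this is n! Aₙ = n · (n-1)! Aₙ. It allows `evalRho` to be computed by repeated
differentiation. -/
theorem evalRho_eq (A : ℕ → ℝ) (p : ℝ[X]) :
    evalRho A p = A 0 * p.eval 0 + evalRho (fun n => A (n + 1)) (derivative p) := by
  induction p using Polynomial.induction_on' with
  | add p q hp hq => simp only [map_add, eval_add, hp, hq]; ring
  | monomial n a =>
    have h : monomial n a = a • monomial n (1 : ℝ) := by rw [smul_monomial, smul_eq_mul, mul_one]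
    rw [h, map_smul, evalRho_monomial, eval_smul, derivative_smul, map_smul, derivative_monomial]
    cases n with
    | zero => simp; ring
    | succ n =>
      have h' : monomial (n + 1 - 1) ((1 : ℝ) * ((n + 1 : ℕ) : ℝ)) =
          ((n + 1 : ℕ) : ℝ) • monomial n (1 : ℝ) := by
        rw [smul_monomial, smul_eq_mul, mul_comm]; rfl
      rw [h', map_smul, evalRho_monomial]
      simp [Nat.factorial_succ]
      left
      ring

variable (Z : H0 →ₗ[ℚ] ℝ)

theorem rho_monomial (n : ℕ) :
    rho Z (monomial n 1) = (n.factorial : ℝ) •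
      ∑ p ∈ Finset.HasAntidiagonal.antidiagonal n,
        (PowerSeries.coeff p.1 (A Z) / (p.2.factorial : ℝ)) • (X : ℝ[X]) ^ p.2 := by
  have h : monomial n (1 : ℝ) = Polynomial.basisMonomials ℝ n := by
    rw [Polynomial.coe_basisMonomials]
  rw [h, rho, Module.Basis.constr_basis]

/-- At T = 0 only the summand with T⁰ survives in ρ_Z(Tⁿ). -/
theorem eval_rho (p : ℝ[X]) :
    (rho Z p).eval 0 = evalRho (fun n => PowerSeries.coeff n (A Z)) p := by
  induction p using Polynomial.induction_on' with
  | add p q hp hq => simp only [map_add, eval_add, hp, hq]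
  | monomial n a =>
    have h : monomial n a = a • monomial n (1 : ℝ) := by rw [smul_monomial, smul_eq_mul, mul_one]
    rw [h, map_smul, map_smul, evalRho_monomial, rho_monomial, eval_smul, eval_smul, eval_finsetSum,
      Finset.sum_eq_single (n, 0)]
    · simp
    · rintro ⟨i, j⟩ _ hij
      have : j ≠ 0 := by
        rintro rfl
        simp_all
      simp [this]
    · intro h
      simp at h

/-- The map ρ_Z is the differential operator A_Z(d/dT) with constant coefficients. -/
theorem derivative_rho (p : ℝ[X]) : derivative (rho Z p) = rho Z (derivative p) := by
  induction p using Polynomial.induction_on' with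
  | add p q hp hq => simp only [map_add, hp, hq]
  | monomial n a =>
    have h : monomial n a = a • monomial n (1 : ℝ) := by rw [smul_monomial, smul_eq_mul, mul_one]
    rw [h, map_smul, derivative_smul, derivative_smul, map_smul, derivative_monomial]
    congr 1
    cases n with
    | zero => rw [rho_monomial]; simp
    | succ n =>
      have h' : monomial (n + 1 - 1) ((1 : ℝ) * ((n + 1 : ℕ) : ℝ)) =
          ((n + 1 : ℕ) : ℝ) • monomial n (1 : ℝ) := by
        rw [smul_monomial, smul_eq_mul, mul_comm]; rfl
      rw [h', map_smul, rho_monomial, rho_monomial, derivative_smul, derivative_sum,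
        Finset.Nat.sum_antidiagonal_succ', smul_smul]
      simp only [derivative_smul, derivative_X_pow, pow_zero, derivative_one, smul_zero, zero_add]
      rw [Nat.factorial_succ, Nat.cast_mul]
      congr 1
      refine Finset.sum_congr rfl fun p _ => ?_
      rw [Nat.add_sub_cancel, ← smul_eq_C_mul, smul_smul]
      congr 1
      have : (p.2.factorial : ℝ) ≠ 0 := by exact_mod_cast p.2.factorial_ne_zero
      rw [Nat.factorial_succ]
      push_cast
      field_simp

/-- The constant term of a polynomial-valued linear map. -/
noncomputable def constTerm (f : H1 →ₗ[ℚ] ℝ[X]) : H1 →ₗ[ℚ] ℝ :=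
  ((Polynomial.leval (0 : ℝ)).restrictScalars ℚ) ∘ₗ f

theorem constTerm_apply (f : H1 →ₗ[ℚ] ℝ[X]) (x : H1) : constTerm f x = (f x).eval 0 := rfl

/-- Each derivative strips a trailing 1, so the iteration runs through the decompositions whose
second factor is (1, …, 1). -/
theorem evalRho_mono {f : H1 →ₗ[ℚ] ℝ[X]} (hf : ∀ x, derivative (f x) = f (dropOne x))
    (A : ℕ → ℝ) (k : List ℕ+) :
    evalRho A (f (mono k)) = conv (fun w => constTerm f (mono w)) (onesFn A) k := by
  induction k using List.reverseRecOn generalizing A with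
  | nil =>
    rw [evalRho_eq, hf, dropOne_nil, map_zero, map_zero, conv_nil, constTerm_apply]
    simp [onesFn, mul_comm]
  | append_singleton k a ih =>
    rw [evalRho_eq, hf, dropOne_snoc, conv_concat, constTerm_apply]
    simp only [onesFn_snoc]
    by_cases ha : a = 1
    · simp only [if_pos ha, ih]
      rw [onesFn]
      ring
    · simp only [if_neg ha, map_zero, conv_zero_right]
      rw [onesFn]
      ring

variable {Z}

/-- Both sides of Reg have the derivative belonging to the stripped index. By induction on the
length, Reg therefore reduces to the constant terms. -/
theorem reg_iff (hds : DoubleShuffle Z) : Reg Z ↔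
    (fun w => constTerm (shuffleReg Z) (mono w)) = conv (fun w => constTerm (harmReg Z) (mono w))
      (onesFn fun n => PowerSeries.coeff n (A Z)) := by
  have hs := (isShuffleReg_shuffleReg hds).derivative
  have hh := (isHarmReg_harmReg hds).derivative
  constructor
  · intro h
    funext k
    rw [constTerm_apply, h k, eval_rho, evalRho_mono hh]
  · intro h k
    induction k using List.reverseRecOn with
    | nil =>
      have h0 := congrFun h []
      rw [← evalRho_mono hh, ← eval_rho, constTerm_apply] at h0
      rw [(isShuffleReg_shuffleReg hds).map_one, (isHarmReg_harmReg hds).map_one] at *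
      have := rho_monomial Z 0
      rw [monomial_zero_one] at this
      rw [this] at h0 ⊢
      simp at h0 ⊢
      rw [← h0, one_smul]
    | append_singleton k a ih =>
      have h0 := congrFun h (k ++ [a])
      rw [← evalRho_mono hh, ← eval_rho, constTerm_apply] at h0
      refine sub_eq_zero.1 ?_
      have hd : derivative (shuffleReg Z (mono (k ++ [a])) - rho Z (harmReg Z (mono (k ++ [a]))))
          = 0 := by
        rw [derivative_sub, derivative_rho, hs, hh, dropOne_snoc]
        split_ifs
        · rw [ih, sub_self]
        · simp
      have hc := derivative_eq_zero.1 hd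
      rw [eq_C_of_natDegree_eq_zero hc, coeff_zero_eq_eval_zero, eval_sub, h0, sub_self, C_0]

end RegConv

/-! ### The regularization theorem and the integral-series identity for functions on words -/

section Abstract

variable {R : Type*} [CommRing R]

theorem conv_replicate (f g : List ℕ+ → R) (n : ℕ) :
    conv f g (List.replicate n 1) = ∑ p ∈ Finset.HasAntidiagonal.antidiagonal n,
      f (List.replicate p.1 1) * g (List.replicate p.2 1) := by
  induction n generalizing f with
  | zero => simp
  | succ n ih =>
    rw [List.replicate_succ, conv_cons, ih, Finset.Nat.sum_antidiagonal_succ]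
    rfl

/-- On the indices (1, …, 1) convolution is multiplication of generating series. -/
theorem mk_conv_replicate (f g : List ℕ+ → R) :
    PowerSeries.mk (fun n => conv f g (List.replicate n 1)) =
      PowerSeries.mk (fun n => f (List.replicate n 1)) *
        PowerSeries.mk (fun n => g (List.replicate n 1)) := by
  ext n
  rw [PowerSeries.coeff_mk, PowerSeries.coeff_mul, conv_replicate]
  simp

variable {fs fh σs σh α : List ℕ+ → R}

theorem conv_twist_inverse (hh1 : fh [] = 1) (hα : fs = conv fh α)
    (hs : conv (signTwist fs) σs = convOne) (hh : conv (signTwist fh) σh = convOne) :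
    conv (signTwist α) σs = σh := by
  refine conv_left_cancel (f := signTwist fh) (by simp [hh1]) ?_
  rw [← conv_assoc, ← signTwist_conv, ← hα, hs, hh]

/-- A cut of (u, c, w) before c contributes nothing, as `onesFn A` vanishes on indices containing c.
So the factor `onesFn A` splits off on the right, and its twist is absorbed by `σs`. -/
theorem conv_eq_of_reg {A : ℕ → R} (hh1 : fh [] = 1) (hα : fs = conv fh (onesFn A))
    (hs : conv (signTwist fs) σs = convOne) (hh : conv (signTwist fh) σh = convOne)
    (u : List ℕ+) {c : ℕ+} (hc : c ≠ 1) :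
    conv (signTwist fun w => fs (u ++ c :: w)) σs =
      conv (signTwist fun w => fh (u ++ c :: w)) σh := by
  have h : (fun w => fs (u ++ c :: w)) = conv (fun w => fh (u ++ c :: w)) (onesFn A) := by
    funext w
    rw [hα, conv_append]
    simp only [onesFn_append_cons A _ _ hc, conv_zero_right, zero_add]
  rw [h, signTwist_conv, conv_assoc, conv_twist_inverse hh1 hα hs hh]

/-- The quotient β of the twists of `fs` and `fh` is determined in two steps: `H` controls indices
with a component different from 1, and the generating series of the values at (1, …, 1) control the
others. -/
theorem reg_of_conv_eq [IsDomain R] {A : ℕ → R} (hs1 : fs [] = 1) (hh1 : fh [] = 1)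
    (hs : conv (signTwist fs) σs = convOne) (hh : conv (signTwist fh) σh = convOne)
    (hones : ∀ n, fs (List.replicate (n + 1) 1) = 0)
    (hA : PowerSeries.mk (fun n => fh (List.replicate n 1)) * PowerSeries.mk A = 1)
    (H : ∀ (u : List ℕ+) (c : ℕ+), c ≠ 1 → conv (signTwist fun w => fs (u ++ c :: w)) σs =
      conv (signTwist fun w => fh (u ++ c :: w)) σh) : fs = conv fh (onesFn A) := by
  let β := conv σh (signTwist fs)
  have hs' := conv_eq_one_comm (by simp [hs1]) hs
  have hβ : conv (signTwist fh) β = signTwist fs := by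
    rw [← conv_assoc, hh, convOne_conv]
  have hsign : ∀ (f : List ℕ+ → R) (u : List ℕ+) (c : ℕ+) (v : List ℕ+),
      signTwist f (u ++ c :: v) =
        (-1) ^ (u.length + 1) * signTwist (fun w => f (u ++ c :: w)) v := by
    intro f u c v
    simp only [signTwist, List.length_append, List.length_cons]
    ring
  -- By `H`, the cuts after c already account for the whole value of the twist of `fs` at (u, c, v).
  -- The cuts before c then sum to zero for every u, and the twist of `fh` is cancelled.
  have hzero : ∀ (u v : List ℕ+) (c : ℕ+), c ≠ 1 → β (u ++ c :: v) = 0 := by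
    intro u v c hc
    refine eq_zero_of_conv_eq_zero (f := signTwist fh) (h := fun x => β (x ++ c :: v))
      (by simp [hh1]) (fun u => ?_) u
    have h1 := congrFun hβ (u ++ c :: v)
    have h2 : conv (signTwist fun w => fh (u ++ c :: w)) β =
        signTwist fun w => fs (u ++ c :: w) := by
      rw [← conv_assoc, ← H u c hc, conv_assoc, hs', conv_convOne]
    rw [conv_append, hsign fs] at h1
    simp only [hsign fh, conv_mul_left, h2] at h1
    exact add_eq_right.1 h1
  have hone : (fun n => conv fh (onesFn A) (List.replicate n 1)) =
      fun n => fs (List.replicate n 1) := by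
    have h1 := mk_conv_replicate fh (onesFn A)
    simp only [onesFn_replicate] at h1
    have h2 : PowerSeries.mk A = PowerSeries.mk (fun n => A n) := rfl
    rw [← h2, hA] at h1
    funext n
    have := congrArg (PowerSeries.coeff n) h1
    rw [PowerSeries.coeff_mk, PowerSeries.coeff_one] at this
    rw [this]
    cases n with
    | zero => simp [hs1]
    | succ n => rw [hones, if_neg (by omega)]
  have hβα : β = signTwist (onesFn A) := by
    have h1 := mk_conv_replicate (signTwist fh) β
    have h2 := mk_conv_replicate (signTwist fh) (signTwist (onesFn A))
    have h3 : ∀ n, signTwist (conv fh (onesFn A)) (List.replicate n 1) =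
        signTwist fs (List.replicate n 1) := fun n => by
      rw [signTwist, signTwist, congrFun hone n]
    rw [← signTwist_conv] at h2
    simp only [h3] at h2
    rw [hβ, h2] at h1
    -- The generating series has constant term 1, so it can be cancelled in the domain of power
    -- series.
    have hne : PowerSeries.mk (fun n => signTwist fh (List.replicate n 1)) ≠ 0 := by
      intro h
      have := congrArg (PowerSeries.coeff 0) h
      simp [hh1] at this
    have h4 := mul_left_cancel₀ hne h1
    funext w
    by_cases hw : ∃ c ∈ w, c ≠ 1
    · obtain ⟨c, hcw, hc⟩ := hw
      obtain ⟨u, v, rfl⟩ := List.append_of_mem hcw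
      rw [hzero _ _ _ hc, signTwist, onesFn_append_cons _ _ _ hc, mul_zero]
    · push Not at hw
      rw [List.eq_replicate_of_mem hw]
      have := congrArg (PowerSeries.coeff w.length) h4
      rw [PowerSeries.coeff_mk, PowerSeries.coeff_mk] at this
      exact this.symm
  rw [hβα, ← signTwist_conv] at hβ
  rw [← signTwist_signTwist fs, ← hβ, signTwist_signTwist]

end Abstract

end MZV

namespace MZV

/-! ### Star sums and the circled harmonic product -/

section Series

/-- The map `w e_c ↦ (v * w) e_c` on `e₁ 𝔥`, extended by `0` to `𝔥¹`. -/
noncomputable def capMul (v : H1) : H1 →ₗ[ℚ] H1 :=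
  indexBasis.constr ℚ fun w => match w.getLast? with
    | some c => snocL indexBasis c (harm v (mono w.dropLast))
    | none => 0

@[simp] theorem capMul_nil (v : H1) : capMul v (mono []) = 0 := by
  rw [capMul, ← indexBasis_apply, Module.Basis.constr_basis]
  rfl

@[simp] theorem capMul_snoc (v : H1) (w : List ℕ+) (c : ℕ+) :
    capMul v (mono (w ++ [c])) = snocL indexBasis c (harm v (mono w)) := by
  rw [capMul, ← indexBasis_apply, Module.Basis.constr_basis]
  simp

/-- The map `x ↦ (v * x) e_b + (v * w) e_{b+c}`, where `x = w e_c`. -/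
noncomputable def joinMul (b : ℕ+) (v : H1) : H1 →ₗ[ℚ] H1 :=
  harm (snocL indexBasis b v) - capMul (snocL indexBasis b v)

theorem joinMul_apply (b : ℕ+) (v x : H1) :
    joinMul b v x = harm (snocL indexBasis b v) x - capMul (snocL indexBasis b v) x := rfl

@[simp] theorem joinMul_nil (b : ℕ+) (v : H1) :
    joinMul b v (mono []) = snocL indexBasis b v := by
  rw [joinMul_apply, harm_one, capMul_nil, sub_zero]

/-- Of the three terms of the recursion for (v e_b) * (w e_c) at the end, subtracting `capMul`
removes the one ending in e_c. -/
theorem joinMul_snoc (b : ℕ+) (v : H1) (w : List ℕ+) (c : ℕ+) :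
    joinMul b v (mono (w ++ [c])) = snocL indexBasis b (harm v (mono (w ++ [c]))) +
      snocL indexBasis (b + c) (harm v (mono w)) := by
  rw [joinMul_apply, capMul_snoc, ← snocL_mono, harm, harmWith_eq_qmul, qmul_snoc_snoc, one_smul]
  abel

theorem capMul_joinMul (v : H1) (b : ℕ+) (x : H1) :
    capMul v (joinMul b (mono []) x) = joinMul b v x := by
  induction x using word_induction indexBasis with
  | basis w =>
    rw [indexBasis_apply]
    rcases List.eq_nil_or_concat w with rfl | ⟨w, c, rfl⟩
    · rw [joinMul_nil, joinMul_nil, snocL_mono, capMul_snoc, harm_one]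
    · rw [List.concat_eq_append, joinMul_snoc, joinMul_snoc, one_harm, one_harm, map_add,
        snocL_mono, snocL_mono, capMul_snoc, capMul_snoc]
  | add x y hx hy => simp only [map_add, hx, hy]
  | smul q x hx => simp only [map_smul, hx]

theorem star_mono (k : List ℕ+) : star (mono k) = ((merges k).map mono).sum := by
  rw [star, ← indexBasis_apply, Module.Basis.constr_basis]

theorem star_nil : star (mono []) = mono [] := by
  rw [star_mono, merges]
  simp

theorem ne_nil_of_mem_merges (a : ℕ+) (k m : List ℕ+) (h : m ∈ merges (a :: k)) : m ≠ [] := by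
  induction k generalizing a m with
  | nil =>
    rw [merges] at h
    simp at h
    simp [h]
  | cons b k ih =>
    rw [merges, List.mem_append, List.mem_map] at h
    rcases h with ⟨m', -, rfl⟩ | h
    · simp
    · exact ih _ _ h

theorem star_cons_cons (a b : ℕ+) (k : List ℕ+) :
    star (mono (a :: b :: k)) =
      consL indexBasis a (star (mono (b :: k))) + star (mono ((a + b) :: k)) := by
  rw [star_mono, merges, List.map_append, List.sum_append, ← star_mono, star_mono (b :: k),
    map_list_sum, List.map_map, List.map_map]
  congr 3
  funext m
  simp

theorem joinMul_consL_star (a b c : ℕ+) (k : List ℕ+) :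
    joinMul b (mono []) (consL indexBasis a (star (mono (c :: k)))) =
      consL indexBasis a (joinMul b (mono []) (star (mono (c :: k)))) := by
  rw [star_mono]
  have h := ne_nil_of_mem_merges c k
  generalize merges (c :: k) = L at h
  induction L with
  | nil => simp
  | cons m L ih =>
    simp only [List.map_cons, List.sum_cons, map_add]
    rw [ih fun m hm => h m (List.mem_cons_of_mem _ hm)]
    congr 1
    obtain ⟨w, d, rfl⟩ := (List.eq_nil_or_concat m).resolve_left (h m List.mem_cons_self)
    rw [List.concat_eq_append, consL_mono, ← List.cons_append, joinMul_snoc, joinMul_snoc]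
    simp [one_harm]

/-- The last comma either stays or becomes a plus sign. The induction is on the length because
`merges` works at the front and alters the first component. -/
theorem star_snoc (k : List ℕ+) (b : ℕ+) :
    star (mono (k ++ [b])) = joinMul b (mono []) (star (mono k)) := by
  obtain ⟨n, hn⟩ : ∃ n, k.length = n := ⟨_, rfl⟩
  induction n generalizing k with
  | zero =>
    obtain rfl := List.length_eq_zero_iff.1 hn
    rw [star_nil, joinMul_nil, snocL_mono, star_mono, List.nil_append, merges]
    simp
  | succ n ih =>
    match k, hn with
    | [a], _ =>
      have h1 : star (mono [a]) = mono ([] ++ [a]) := by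
        rw [star_mono, merges]; simp
      have h2 : star (mono [b]) = mono [b] := by
        rw [star_mono, merges]; simp
      have h3 : star (mono [a + b]) = mono [a + b] := by
        rw [star_mono, merges]; simp
      rw [List.cons_append, List.nil_append, star_cons_cons, h1, h2, h3, joinMul_snoc, one_harm,
        one_harm, snocL_mono, snocL_mono, consL_mono, add_comm a b]
      rfl
    | a :: c :: k, hn =>
      rw [List.cons_append, List.cons_append, star_cons_cons, star_cons_cons, map_add,
        joinMul_consL_star, ← ih (c :: k) (by simpa using hn), ← ih ((a + c) :: k)
        (by simpa using hn)]
      rfl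

theorem coe_snocL (k : ℕ+) (x : H1) : (snocL indexBasis k x : H) = x * eK k := by
  induction x using word_induction indexBasis with
  | basis w =>
    rw [indexBasis_apply, snocL_mono, coe_mono, indexWord_append, word_append, coe_mono]
    simp [word_letterWord]
  | add x y hx hy => simp [hx, hy, add_mul]
  | smul q x hx => simp [hx]

/-- The two last components enter only through their sum a + b, which is why Int-Ser can be indexed
by one component c ≥ 2. -/
theorem incl_circ (u l : List ℕ+) (a b : ℕ+) :
    incl (circ (mono (u ++ [a])) (star (mono (l ++ [b])))) =
      joinMul (a + b) (mono u) (star (mono l)) := by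
  rw [star_snoc]
  generalize star (mono l) = x
  have h : ∀ w c, incl (circ (mono (u ++ [a])) (mono (w ++ [c]))) =
      snocL indexBasis (a + c) (harm (mono u) (mono w)) := fun w c =>
    Subtype.ext ((circ_mono u w a c).trans (coe_snocL _ _).symm)
  induction x using word_induction indexBasis with
  | basis w =>
    rw [indexBasis_apply]
    rcases List.eq_nil_or_concat w with rfl | ⟨w, c, rfl⟩
    · rw [joinMul_nil, joinMul_nil, snocL_mono, h, harm_one]
    · rw [List.concat_eq_append, joinMul_snoc, joinMul_snoc, one_harm, one_harm, map_add, map_add,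
        snocL_mono, snocL_mono, h, h, add_assoc]
  | add x y hx hy => simp only [map_add, hx, hy]
  | smul q x hx => simp only [map_smul, hx]

/-- Writing `joinMul` as a product minus `capMul` moves the last component from the starred index to
the end of u, with a sign. Iteration gives the alternating sum; `t` is reversed so that this
component is its head. -/
theorem map_joinMul_star {φ : H1 →ₗ[ℚ] ℝ} (hφ : ∀ x y, φ (harm x y) = φ x * φ y)
    (u : List ℕ+) (c : ℕ+) (t : List ℕ+) :
    φ (joinMul c (mono u) (star (mono t.reverse))) =
      conv (signTwist fun w => φ (mono (u ++ c :: w))) (fun t => φ (star (mono t.reverse))) t := by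
  induction t generalizing u c with
  | nil =>
    rw [conv_nil, signTwist_nil, List.reverse_nil, star_nil, joinMul_nil, snocL_mono, ← hφ, harm_one]
  | cons b t ih =>
    rw [conv_cons, joinMul_apply, List.reverse_cons, star_snoc, capMul_joinMul, map_sub, hφ,
      snocL_mono, ih (u ++ [c])]
    simp only [signTwist_cons _ b, conv_neg_left, List.append_assoc, List.singleton_append,
      signTwist_nil]
    ring

/-- The antipode relation of the harmonic algebra: up to sign and reversal the antipode is the star
map. -/
theorem conv_star_eq_one {φ : H1 →ₗ[ℚ] ℝ} (hφ1 : φ (mono []) = 1)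
    (hφ : ∀ x y, φ (harm x y) = φ x * φ y) :
    conv (signTwist fun w => φ (mono w)) (fun t => φ (star (mono t.reverse))) = convOne := by
  funext t
  cases t with
  | nil => simp [star_nil, hφ1]
  | cons b t =>
    rw [conv_cons]
    simp only [signTwist_cons, conv_neg_left, signTwist_nil, hφ1, one_mul, convOne_cons]
    rw [List.reverse_cons, star_snoc, map_joinMul_star hφ]
    simp

end Series

/-! ### Newton's identity -/

section Newton

/-- The sum of all indices with one component `i` and `m` components `1`. -/
noncomputable def insertOnes (i : ℕ+) : ℕ → H1
  | 0 => mono [i]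
  | m + 1 => mono (i :: List.replicate (m + 1) 1) + consL indexBasis 1 (insertOnes i m)

/-- The letter e_i is either inserted between the ones or merged with one of them. -/
theorem harm_singleton_ones (i : ℕ+) (m : ℕ) :
    harm (mono [i]) (mono (List.replicate (m + 1) 1)) =
      insertOnes i (m + 1) + insertOnes (i + 1) m := by
  have hrec : ∀ m, harm (mono [i]) (mono (List.replicate (m + 1) 1)) =
      mono (i :: List.replicate (m + 1) 1) +
      consL indexBasis 1 (harm (mono [i]) (mono (List.replicate m 1))) +
      mono ((i + 1) :: List.replicate m 1) := by
    intro m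
    have := qmul_basis_cons indexBasis 1 i 1 [] (List.replicate m 1)
    simp only [one_smul, indexBasis_apply] at this
    rw [← harmWith_eq_qmul, ← harm] at this
    rw [List.replicate_succ]
    simpa only [one_harm, consL_mono] using this
  induction m with
  | zero =>
    rw [hrec]
    simp [insertOnes, harm_one]
  | succ m ih =>
    rw [hrec, ih]
    simp only [insertOnes, map_add]
    abel

theorem insertOnes_one (m : ℕ) :
    insertOnes 1 m = ((m : ℚ) + 1) • mono (List.replicate (m + 1) 1) := by
  induction m with
  | zero => simp [insertOnes]
  | succ m ih =>
    rw [insertOnes, ih, map_smul, consL_mono, ← List.replicate_succ]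
    push_cast
    module

/-- `harm_singleton_ones` is solved for its first summand and iterated, each time lowering m and
raising i. -/
theorem map_insertOnes {φ : H1 →ₗ[ℚ] ℝ} (hφ : ∀ x y, φ (harm x y) = φ x * φ y)
    (hφ1 : φ (mono []) = 1) (m i : ℕ) :
    φ (insertOnes i.succPNat m) = ∑ p ∈ Finset.HasAntidiagonal.antidiagonal m,
      φ (mono (List.replicate p.1 1)) * ((-1) ^ p.2 * φ (mono [(i + p.2).succPNat])) := by
  induction m generalizing i with
  | zero => simp [insertOnes, hφ1]
  | succ m ih =>
    have h := congrArg φ (harm_singleton_ones i.succPNat m)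
    have hi : i.succPNat + 1 = (i + 1).succPNat := rfl
    rw [hφ, map_add, hi, ih] at h
    rw [Finset.Nat.sum_antidiagonal_succ', ← sub_eq_iff_eq_add.2 h, add_comm,
      mul_comm (φ (mono [_])), sub_eq_add_neg, ← Finset.sum_neg_distrib]
    congr 1
    · simp
    · refine Finset.sum_congr rfl fun p _ => ?_
      rw [add_right_comm i 1, ← add_assoc, pow_succ]
      ring

/-- Newton's identity gives P' = PG for the generating series P of the values at (1, …, 1), while A'
= -AG. So PA has derivative zero and constant term 1. -/
theorem mk_ones_mul_A {Z : H0 →ₗ[ℚ] ℝ} {φ : H1 →ₗ[ℚ] ℝ}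
    (hφ : ∀ x y, φ (harm x y) = φ x * φ y) (hφ1 : φ (mono []) = 1)
    (hφZ : ∀ x, φ (incl x) = Z x) (hφe : φ (mono [1]) = 0) :
    PowerSeries.mk (fun n => φ (mono (List.replicate n 1))) * A Z = 1 := by
  set P := PowerSeries.mk fun n => φ (mono (List.replicate n 1)) with hP
  set G := PowerSeries.mk fun n => (-1) ^ n * φ (mono [n.succPNat]) with hG
  have h1 : PowerSeries.derivative ℝ P = P * G := by
    ext n
    rw [PowerSeries.coeff_derivative, PowerSeries.coeff_mul, hP, hG, PowerSeries.coeff_mk]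
    have := map_insertOnes hφ hφ1 n 0
    rw [show (0 : ℕ).succPNat = 1 from rfl, insertOnes_one, map_smul] at this
    simp only [PowerSeries.coeff_mk]
    simp only [zero_add] at this
    rw [← this, Algebra.smul_def]
    simp [mul_comm]
  -- The coefficients of u⁰ agree because `logA` starts at u² and φ(e₁) = 0.
  have h2 : PowerSeries.derivative ℝ (logA Z) = -G := by
    ext n
    rw [PowerSeries.coeff_derivative, logA, hG, map_neg, PowerSeries.coeff_mk, PowerSeries.coeff_mk]
    cases n with
    | zero => simp [show (0 : ℕ).succPNat = 1 from rfl, hφe]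
    | succ n =>
      rw [dif_pos (by omega), ← hφZ]
      have : incl ⟨word (indexWord [⟨n + 1 + 1, by omega⟩]), indexWord_mem_H0
          (admissible_singleton (by omega))⟩ = mono [(n + 1).succPNat] := rfl
      rw [this]
      have : (n : ℝ) + 1 + 1 ≠ 0 := by positivity
      push_cast
      field_simp
      ring
  have h3 : PowerSeries.derivative ℝ (A Z) = A Z * -G := by
    rw [A, PowerSeries.derivative_subst (hasSubst_logA Z), PowerSeries.derivative_exp, h2]
  have h4 : PowerSeries.constantCoeff (A Z) = 1 := by
    have h0 : PowerSeries.constantCoeff (logA Z) = 0 := by simp [logA]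
    have h := PowerSeries.constantCoeff_subst_eq_zero (a := logA Z) h0
      (PowerSeries.exp ℝ - 1) (by simp)
    rw [← PowerSeries.coe_substAlgHom (hasSubst_logA Z), map_sub, map_one,
      PowerSeries.coe_substAlgHom] at h
    exact sub_eq_zero.1 ((map_sub _ _ _).symm.trans h)
  refine PowerSeries.derivative.ext ?_ ?_
  · rw [Derivation.leibniz, h1, h3, Derivation.map_one_eq_zero]
    simp only [smul_eq_mul]
    ring
  · rw [map_mul, h4, map_one, mul_one, hP]
    simp [hφ1]

end Newton

end MZV

namespace MZV

/-! ### The integral side -/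

section Integral

theorem word_one_cons_mem (L : List (Fin 2)) : word (1 :: L) ∈ H1 :=
  Submodule.mem_sup_right (mem_e1H.2 ⟨word L, word_cons _ _⟩)

/-- A real-valued character of `(𝔥¹, ш)`, extended linearly to `𝔥`. -/
structure IsShuffleChar (ψ : H →ₗ[ℚ] ℝ) : Prop where
  map_one : ψ 1 = 1
  map_mul : ∀ x ∈ H1, ∀ y ∈ H1, ψ (shuffle x y) = ψ x * ψ y

variable {ψ : H →ₗ[ℚ] ℝ}

theorem squareBlocks_cons (b : ℕ+) (t : List ℕ+) :
    squareBlocks (b :: t) = (1, false) :: (List.replicate ((b : ℕ) - 1) (0, true) ++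
      squareBlocks t) := by
  simp [squareBlocks]

theorem zigzagSum_nil : zigzagSum [] = 1 := zigzagSum_up []

theorem map_letterWord (b : ℕ+) : (letterWord b).map (fun a => (a, true)) =
    (1, true) :: List.replicate ((b : ℕ) - 1) (0, true) := by
  simp [letterWord]

/-- Cutting at the first descending step gives a shuffle product minus the zigzag with that step
reversed, in which the chain is longer by e_b. This is the recursion of `map_joinMul_star`.
Membership in 𝔥¹ is carried along because ψ is multiplicative only there. -/
theorem map_zigzagSum_squareBlocks (hψ : IsShuffleChar ψ) (L : List (Fin 2)) (t : List ℕ+) :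
    zigzagSum ((1 :: L).map (fun a => (a, true)) ++ squareBlocks t) ∈ H1 ∧
    ψ (zigzagSum ((1 :: L).map (fun a => (a, true)) ++ squareBlocks t)) =
      conv (signTwist fun w => ψ (word (1 :: L ++ indexWord w)))
        (fun t => ψ (zigzagSum (squareBlocks t))) t := by
  induction t generalizing L with
  | nil =>
    have h : squareBlocks [] = [] := rfl
    rw [h, List.append_nil, zigzagSum_up, conv_nil, signTwist_nil, h, zigzagSum_nil, hψ.map_one,
      mul_one, indexWord_nil, List.append_nil]
    exact ⟨word_one_cons_mem L, rfl⟩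
  | cons b t ih =>
    have hcut := zigzagSum_cut (P := (1 :: L).map fun a => (a, true)) (by simp) 1 false
      (List.replicate ((b : ℕ) - 1) (0, true) ++ squareBlocks t)
    have e1 : zigzagSum (squareBlocks (b :: t)) =
        zigzagSum ((1 :: List.replicate ((b : ℕ) - 1) 0).map (fun a => (a, true)) ++
          squareBlocks t) := by
      rw [squareBlocks_cons, zigzagSum_head 1 false true]
      simp
    have e2 : (1 :: L).map (fun a => (a, true)) ++ (1, true) ::
        (List.replicate ((b : ℕ) - 1) (0, true) ++ squareBlocks t) =
        (1 :: (L ++ letterWord b)).map (fun a => (a, true)) ++ squareBlocks t := by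
      simp [letterWord]
    rw [← squareBlocks_cons, e2] at hcut
    have h1 := ih (List.replicate ((b : ℕ) - 1) 0)
    have h2 := ih (L ++ letterWord b)
    rw [← e1] at h1
    rw [zigzagSum_up] at hcut
    rw [eq_sub_of_add_eq' hcut.symm]
    refine ⟨sub_mem (shuffle_mem_H1 (word_one_cons_mem L) h1.1) h2.1, ?_⟩
    rw [map_sub, hψ.map_mul _ (word_one_cons_mem L) _ h1.1, h2.2, conv_cons]
    simp only [signTwist_cons, conv_neg_left, signTwist_nil, indexWord_nil, List.append_nil,
      List.cons_append, List.append_assoc, indexWord_cons]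
    ring

theorem conv_squareBlocks_eq_one (hψ : IsShuffleChar ψ) :
    conv (signTwist fun w => ψ (word (indexWord w)))
      (fun t => ψ (zigzagSum (squareBlocks t))) = convOne := by
  funext t
  cases t with
  | nil =>
    have h : squareBlocks [] = [] := rfl
    simp [h, zigzagSum_nil, hψ.map_one]
  | cons b t =>
    have h := (map_zigzagSum_squareBlocks hψ (List.replicate ((b : ℕ) - 1) 0) t).2
    have e1 : zigzagSum (squareBlocks (b :: t)) =
        zigzagSum ((1 :: List.replicate ((b : ℕ) - 1) 0).map (fun a => (a, true)) ++
          squareBlocks t) := by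
      rw [squareBlocks_cons, zigzagSum_head 1 false true]
      simp
    rw [← e1] at h
    rw [conv_cons, h]
    simp only [signTwist_cons, conv_neg_left, signTwist_nil, indexWord_nil, word_nil, hψ.map_one,
      one_mul, convOne_cons, indexWord_cons, letterWord]
    ring

/-- The c further vertices ∘ prolong the last block of the ascending chain, so a and c again enter
only through a + c. -/
theorem muDiagram_eq (u : List ℕ+) (a c : ℕ+) (t : List ℕ+) :
    muDiagram (u ++ [a]) (c :: t) =
      (indexWord (u ++ [a + c])).map (fun a => (a, true)) ++ squareBlocks t := by
  have h1 : ∀ k, roundDiagram k = (indexWord k).map fun a => (a, true) := by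
    intro k
    induction k with
    | nil => rfl
    | cons a k ih =>
      rw [indexWord_cons, List.map_append, ← ih, map_letterWord]
      rfl
  have h2 : indexWord (u ++ [a + c]) = indexWord (u ++ [a]) ++ List.replicate (c : ℕ) 0 := by
    have ha := a.pos
    simp only [indexWord_append, indexWord_cons, indexWord_nil, List.append_nil, List.append_assoc,
      letterWord, List.cons_append, List.replicate_append_replicate, PNat.add_coe]
    rw [show (a : ℕ) + c - 1 = a - 1 + c by omega]
  rw [muDiagram, h1, h2]
  simp

theorem map_mu (hψ : IsShuffleChar ψ) (u : List ℕ+) (a c : ℕ+) (t : List ℕ+) :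
    ψ (muPoset (u ++ [a]) (c :: t).reverse).W =
      conv (signTwist fun w => ψ (word (indexWord (u ++ (a + c) :: w))))
        (fun t => ψ (zigzagSum (squareBlocks t))) t := by
  rw [muPoset, zigzag_W, List.reverse_reverse, muDiagram_eq]
  obtain ⟨L, hL⟩ : ∃ L, indexWord (u ++ [a + c]) = 1 :: L := by
    cases u <;> simp [letterWord]
  rw [hL, (map_zigzagSum_squareBlocks hψ L t).2]
  congr 2
  funext w
  rw [← hL, ← indexWord_append]
  simp

end Integral

/-! ### Equivalence of the regularization theorem and the integral-series identity -/

section Equivalence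

variable {Z : H0 →ₗ[ℚ] ℝ}

/-- The value of the shuffle regularization at `T = 0`, as a function on indices. -/
noncomputable def shuffleFn (Z : H0 →ₗ[ℚ] ℝ) (w : List ℕ+) : ℝ :=
  constTerm (shuffleReg Z) (mono w)

/-- The value of the harmonic regularization at `T = 0`, as a function on indices. -/
noncomputable def harmFn (Z : H0 →ₗ[ℚ] ℝ) (w : List ℕ+) : ℝ :=
  constTerm (harmReg Z) (mono w)

theorem constTerm_shuffleReg_one (hds : DoubleShuffle Z) :
    constTerm (shuffleReg Z) (mono []) = 1 := by
  rw [constTerm_apply, (isShuffleReg_shuffleReg hds).map_one, Polynomial.eval_one]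

theorem constTerm_harmReg_one (hds : DoubleShuffle Z) :
    constTerm (harmReg Z) (mono []) = 1 := by
  rw [constTerm_apply, (isHarmReg_harmReg hds).map_one, Polynomial.eval_one]

theorem constTerm_shuffleReg_mul (hds : DoubleShuffle Z) (x y : H1) :
    constTerm (shuffleReg Z) (shuffle1 x y) =
      constTerm (shuffleReg Z) x * constTerm (shuffleReg Z) y := by
  simp only [constTerm_apply, (isShuffleReg_shuffleReg hds).map_mul, Polynomial.eval_mul]

theorem constTerm_harmReg_mul (hds : DoubleShuffle Z) (x y : H1) :
    constTerm (harmReg Z) (harm x y) = constTerm (harmReg Z) x * constTerm (harmReg Z) y := by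
  simp only [constTerm_apply, (isHarmReg_harmReg hds).map_mul, Polynomial.eval_mul]

theorem constTerm_shuffleReg_incl (hds : DoubleShuffle Z) (x : H0) :
    constTerm (shuffleReg Z) (incl x) = Z x := by
  rw [constTerm_apply, (isShuffleReg_shuffleReg hds).extends_Z, Polynomial.eval_C]

theorem constTerm_harmReg_incl (hds : DoubleShuffle Z) (x : H0) :
    constTerm (harmReg Z) (incl x) = Z x := by
  rw [constTerm_apply, (isHarmReg_harmReg hds).extends_Z, Polynomial.eval_C]

theorem exists_shuffleChar (hds : DoubleShuffle Z) :
    ∃ ψ : H →ₗ[ℚ] ℝ, IsShuffleChar ψ ∧ ∀ x : H1, ψ x = constTerm (shuffleReg Z) x := by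
  obtain ⟨ψ, hψ⟩ := LinearMap.exists_extend (constTerm (shuffleReg Z))
  have h : ∀ x : H1, ψ x = constTerm (shuffleReg Z) x := LinearMap.congr_fun hψ
  refine ⟨ψ, ⟨(h (mono [])).trans (constTerm_shuffleReg_one hds), fun x hx y hy => ?_⟩, h⟩
  rw [h ⟨x, hx⟩, h ⟨y, hy⟩, ← constTerm_shuffleReg_mul hds, ← h]
  rfl

theorem word_e1_shuffle (n : ℕ) :
    shuffle (word [1]) (word (List.replicate n 1)) = ((n : ℚ) + 1) • word (List.replicate (n + 1) 1)
    := by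
  induction n with
  | zero => simp [shuffle_one]
  | succ n ih =>
    have h := shuffle_e_mul 1 1 1 (word (List.replicate n 1))
    rw [one_shuffle, mul_one, ← word_cons] at h
    have h1 : e 1 = word [1] := by simp
    rw [h1, ih, ← h1, mul_smul_comm, ← word_cons, ← word_cons] at h
    rw [List.replicate_succ, ← h1, h, ← List.replicate_succ, ← List.replicate_succ]
    push_cast
    module

/-- The product e₁ ш e₁ⁿ is (n + 1) e₁ⁿ⁺¹, and e₁ is sent to T, which vanishes at T = 0. -/
theorem shuffleFn_replicate (hds : DoubleShuffle Z) (n : ℕ) :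
    shuffleFn Z (List.replicate (n + 1) 1) = 0 := by
  have hw : ∀ n, indexWord (List.replicate n 1) = List.replicate n 1 := by
    intro n
    induction n with
    | zero => rfl
    | succ n ih => simp [List.replicate_succ, ih, letterWord]
  have h1 : shuffle1 (mono [1]) (mono (List.replicate n 1)) =
      ((n : ℚ) + 1) • mono (List.replicate (n + 1) 1) := by
    refine Subtype.ext ?_
    change shuffle (word (indexWord (List.replicate 1 1))) (word (indexWord (List.replicate n 1))) =
      ((n : ℚ) + 1) • word (indexWord (List.replicate (n + 1) 1))
    rw [hw, hw, hw]
    exact word_e1_shuffle n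
  have h2 := constTerm_shuffleReg_mul hds (mono [1]) (mono (List.replicate n 1))
  rw [h1, map_smul, constTerm_apply _ (mono [1]), (isShuffleReg_shuffleReg hds).map_e1,
    Polynomial.eval_X, zero_mul, smul_eq_zero] at h2
  exact h2.resolve_left (by positivity)

theorem intSer_iff (hds : DoubleShuffle Z) {ψ : H →ₗ[ℚ] ℝ} (hψ : IsShuffleChar ψ)
    (hψZ : ∀ x : H1, ψ x = constTerm (shuffleReg Z) x) :
    IntSer Z ↔ ∀ (u : List ℕ+) (c : ℕ+), c ≠ 1 →
      conv (signTwist fun w => shuffleFn Z (u ++ c :: w))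
        (fun t => ψ (zigzagSum (squareBlocks t))) =
      conv (signTwist fun w => harmFn Z (u ++ c :: w))
        (fun t => constTerm (harmReg Z) (star (mono t.reverse))) := by
  have key : ∀ (u : List ℕ+) (a c : ℕ+) (t : List ℕ+) (h1 h2),
      (Z (mu (u ++ [a]) (c :: t).reverse h1 h2) =
        Z (circ (mono (u ++ [a])) (star (mono (c :: t).reverse)))) ↔
      conv (signTwist fun w => shuffleFn Z (u ++ (a + c) :: w))
        (fun t => ψ (zigzagSum (squareBlocks t))) t =
      conv (signTwist fun w => harmFn Z (u ++ (a + c) :: w))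
        (fun t => constTerm (harmReg Z) (star (mono t.reverse))) t := by
    intro u a c t h1 h2
    have e1 := map_mu hψ u a c t
    have e2 := map_joinMul_star (constTerm_harmReg_mul hds) u (a + c) t
    rw [← incl_circ, ← List.reverse_cons, constTerm_harmReg_incl hds] at e2
    have e3 : ψ (muPoset (u ++ [a]) (c :: t).reverse).W =
        Z (mu (u ++ [a]) (c :: t).reverse h1 h2) := by
      rw [← constTerm_shuffleReg_incl hds, ← hψZ]
      rfl
    have e4 : (fun w => ψ (word (indexWord (u ++ (a + c) :: w)))) =
        fun w => shuffleFn Z (u ++ (a + c) :: w) := by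
      funext w
      rw [shuffleFn, ← hψZ]
      rfl
    rw [← e3, e1, e2, e4]
    rfl
  constructor
  · intro h u c hc
    -- Any c ≥ 2 is realized by last components 1 and c - 1.
    obtain ⟨d, hd⟩ : ∃ d : ℕ+, c = 1 + d :=
      ⟨c - 1, (PNat.add_sub_of_lt (lt_of_le_of_ne one_le hc.symm)).symm⟩
    subst hd
    funext t
    exact (key u 1 d t (by simp) (by simp)).1 (h _ _ _ _)
  · intro h k l hk hl
    obtain ⟨u, a, rfl⟩ := (List.eq_nil_or_concat k).resolve_left hk
    obtain ⟨t', c, rfl⟩ := (List.eq_nil_or_concat l).resolve_left hl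
    obtain ⟨t, rfl⟩ : ∃ t, t' = List.reverse t := ⟨t'.reverse, by simp⟩
    simp only [List.concat_eq_append, ← List.reverse_cons]
    refine (key u a c t (by simp) (by simp)).2 (congrFun (h u (a + c) ?_) t)
    intro h
    have h1 := a.pos
    have h2 := c.pos
    have h3 := congrArg PNat.val h
    rw [PNat.add_coe, PNat.one_coe] at h3
    omega

theorem reg_iff_intSer (hds : DoubleShuffle Z) : Reg Z ↔ IntSer Z := by
  obtain ⟨ψ, hψ, hψZ⟩ := exists_shuffleChar hds
  have hs : conv (signTwist (shuffleFn Z)) (fun t => ψ (zigzagSum (squareBlocks t))) = convOne := by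
    rw [← conv_squareBlocks_eq_one hψ]
    congr 2
    funext w
    exact (hψZ _).symm
  have hh := conv_star_eq_one (constTerm_harmReg_one hds) (constTerm_harmReg_mul hds)
  rw [reg_iff hds, intSer_iff hds hψ hψZ]
  constructor
  · intro h u c hc
    exact conv_eq_of_reg (constTerm_harmReg_one hds) h hs hh u hc
  · intro h
    refine reg_of_conv_eq (constTerm_shuffleReg_one hds) (constTerm_harmReg_one hds) hs hh
      (shuffleFn_replicate hds) ?_ h
    have := mk_ones_mul_A (constTerm_harmReg_mul hds) (constTerm_harmReg_one hds)
      (constTerm_harmReg_incl hds)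
      (by rw [constTerm_apply, (isHarmReg_harmReg hds).map_e1, Polynomial.eval_X])
    convert this using 2
    ext n
    simp

end Equivalence

end MZV

namespace MZV

/-! ### Duality and zigzags -/

section Dual

theorem dagger_word (w : List (Fin 2)) : dagger (word w) = word (w.reverse.map (1 - ·)) := by
  induction w with
  | nil => exact dagger_one
  | cons a w ih => rw [word_cons, dagger_mul, ih, dagger_e]; simp

theorem shuffle_mul_e (a a' : Fin 2) (x y : H) :
    shuffle (x * e a) (y * e a') = shuffle x (y * e a') * e a + shuffle (x * e a) y * e a' := by
  have h := qmul_snoc_snoc wordBasis 0 a a' x y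
  rw [← shuffle_eq_qmul] at h
  simpa only [snocL_wordBasis, zero_smul, add_zero] using h

theorem shuffle_assoc (x y z : H) : shuffle (shuffle x y) z = shuffle x (shuffle y z) := by
  rw [shuffle_eq_qmul, qmul_assoc]

theorem dagger_shuffle_word (v w : List (Fin 2)) :
    dagger (shuffle (word v) (word w)) = shuffle (dagger (word v)) (dagger (word w)) := by
  induction v, w using words_induction with
  | nil_left w => rw [word_nil, dagger_one, one_shuffle, one_shuffle]
  | nil_right v => rw [word_nil, dagger_one, shuffle_one, shuffle_one]
  | cons a v a' w h1 h2 h3 =>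
    simp only [word_cons] at h1 h2 ⊢
    rw [shuffle_e_mul, map_add, dagger_mul, dagger_mul, h1, h2, dagger_mul, dagger_mul, dagger_e,
      dagger_e, shuffle_mul_e]

/-- Reversal exchanges the recursions of the shuffle product at the two ends, and renaming the
letters is harmless. -/
theorem dagger_shuffle (x y : H) : dagger (shuffle x y) = shuffle (dagger x) (dagger y) := by
  induction x using word_induction wordBasis with
  | basis v =>
    induction y using word_induction wordBasis with
    | basis w => simpa only [wordBasis_apply] using dagger_shuffle_word v w
    | add y z hy hz => simp only [map_add, hy, hz]
    | smul q y hy => simp only [map_smul, hy]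
  | add y z hy hz => simp only [map_add, LinearMap.add_apply, hy, hz]
  | smul q y hy => simp only [map_smul, LinearMap.smul_apply, hy]

/-- The zigzag whose top element labelled `x` lies above an ascending chain of `•`s and a descending
chain. -/
theorem zigzagSum_peak (p : ℕ) (x : Fin 2) (M : List (Fin 2)) :
    zigzagSum (List.replicate p (1, true) ++ (x, true) :: M.map fun a => (a, false)) =
      shuffle (word (List.replicate p 1)) (word M.reverse) * e x := by
  induction p generalizing x M with
  | zero =>
    have h := zigzagSum_down (x :: M)
    rw [List.map_cons, zigzagSum_head x false true] at h
    rw [List.replicate_zero, List.nil_append, h, List.replicate_zero, word_nil, one_shuffle]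
    simp
  | succ p ih =>
    -- With the step to x reversed, the last • of the chain is the peak and x heads the descending
    -- chain, which is the case p of the induction.
    have hcut := zigzagSum_cut (P := List.replicate (p + 1) (1, true)) (by simp) x false
      (M.map fun a => (a, false))
    have h1 := zigzagSum_down (x :: M)
    rw [List.map_cons] at h1
    have h2 := ih 1 (x :: M)
    have h3 : List.replicate p ((1 : Fin 2), true) ++ (1, true) ::
        (x :: M).map (fun a => (a, false)) = List.replicate (p + 1) (1, true) ++
          (x, false) :: M.map fun a => (a, false) := by
      rw [List.replicate_succ']
      simp
    have h4 : List.replicate (p + 1) ((1 : Fin 2), true) =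
        (List.replicate (p + 1) (1 : Fin 2)).map fun a => (a, true) := by simp
    have h5 : zigzagSum (List.replicate (p + 1) (1, true)) = word (List.replicate (p + 1) 1) := by
      rw [h4, zigzagSum_up]
    have h6 : word (List.replicate (p + 1) 1) = word (List.replicate p 1) * e 1 := by
      rw [List.replicate_succ', word_append]; simp
    have h7 : word (x :: M).reverse = word M.reverse * e x := by simp
    rw [h3] at h2
    rw [eq_sub_of_add_eq hcut.symm, h2, h1, h5, h6, h7, shuffle_mul_e]
    abel

/-- The blocks of the zigzag dual to `μ((1, …, 1), 𝐤^∨)`. -/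
def dualBlocks (t : List ℕ+) : List (Fin 2 × Bool) :=
  t.flatMap fun b => (0, true) :: List.replicate ((b : ℕ) - 1) (1, false)

theorem dualBlocks_cons (b : ℕ+) (t : List ℕ+) :
    dualBlocks (b :: t) = (0, true) :: (List.replicate ((b : ℕ) - 1) (1, false) ++
      dualBlocks t) := by
  simp [dualBlocks]

variable {ψ : H →ₗ[ℚ] ℝ}

/-- The argument of `map_zigzagSum_squareBlocks` with directions exchanged: the cut is at the
ascending step to the next block, and reversing it prolongs the descending chain `M`. The peak
labelled 0 becomes the leading e₁ after †. -/
theorem map_dagger_dualBlocks (hψ : IsShuffleChar ψ) (p : ℕ) (M : List (Fin 2)) (t : List ℕ+) :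
    dagger (zigzagSum (List.replicate p (1, true) ++ (0, true) :: M.map (fun a => (a, false)) ++
      dualBlocks t)) ∈ H1 ∧
    ψ (dagger (zigzagSum (List.replicate p (1, true) ++ (0, true) :: M.map (fun a => (a, false)) ++
      dualBlocks t))) = conv (signTwist fun w => ψ (e 1 * shuffle (word (List.replicate p 0))
        (word (M.map (1 - ·) ++ indexWord w))))
        (fun t => ψ (dagger (zigzagSum (dualBlocks t)))) t := by
  have hpeak : ∀ (p : ℕ) (M : List (Fin 2)), dagger (zigzagSum (List.replicate p (1, true) ++
      (0, true) :: M.map (fun a => (a, false)))) =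
      e 1 * shuffle (word (List.replicate p 0)) (word (M.map (1 - ·))) := by
    intro p M
    rw [zigzagSum_peak, dagger_mul, dagger_e, dagger_shuffle, dagger_word, dagger_word]
    simp
  have hmem : ∀ y : H, e 1 * y ∈ H1 := fun y => Submodule.mem_sup_right (mem_e1H.2 ⟨y, rfl⟩)
  induction t generalizing p M with
  | nil =>
    have h : dualBlocks [] = [] := rfl
    rw [h, List.append_nil, hpeak, conv_nil, signTwist_nil, h, zigzagSum_nil, dagger_one,
      hψ.map_one, mul_one, indexWord_nil, List.append_nil]
    exact ⟨hmem _, rfl⟩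
  | cons b t ih =>
    have hcut := zigzagSum_cut (P := List.replicate p (1, true) ++
      (0, true) :: M.map fun a => (a, false)) (by simp) 0 true
      (List.replicate ((b : ℕ) - 1) (1, false) ++ dualBlocks t)
    have e1 : dualBlocks (b :: t) = List.replicate 0 (1, true) ++ (0, true) ::
        (List.replicate ((b : ℕ) - 1) (1 : Fin 2)).map (fun a => (a, false)) ++ dualBlocks t := by
      rw [dualBlocks_cons]
      simp
    have e2 : List.replicate p (1, true) ++ (0, true) :: M.map (fun a => (a, false)) ++
        (0, false) :: (List.replicate ((b : ℕ) - 1) (1, false) ++ dualBlocks t) =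
        List.replicate p (1, true) ++ (0, true) ::
          (M ++ 0 :: List.replicate ((b : ℕ) - 1) 1).map (fun a => (a, false)) ++
            dualBlocks t := by
      simp
    rw [← dualBlocks_cons, e2] at hcut
    have h1 := ih 0 (List.replicate ((b : ℕ) - 1) 1)
    have h2 := ih p (M ++ 0 :: List.replicate ((b : ℕ) - 1) 1)
    rw [← e1] at h1
    rw [eq_sub_of_add_eq hcut.symm, map_sub, dagger_shuffle, hpeak]
    refine ⟨sub_mem (shuffle_mem_H1 (hmem _) h1.1) h2.1, ?_⟩
    rw [map_sub, hψ.map_mul _ (hmem _) _ h1.1, h2.2, conv_cons]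
    simp only [signTwist_cons, conv_neg_left, signTwist_nil, indexWord_nil, List.append_nil,
      indexWord_cons, letterWord]
    rw [sub_eq_add_neg]
    congr 4
    funext w
    simp

theorem conv_dualBlocks_eq_one (hψ : IsShuffleChar ψ) :
    conv (signTwist fun w => ψ (word (indexWord w)))
      (fun t => ψ (dagger (zigzagSum (dualBlocks t)))) = convOne := by
  funext t
  cases t with
  | nil =>
    have h : dualBlocks [] = [] := rfl
    simp [h, zigzagSum_nil, hψ.map_one, dagger_one]
  | cons b t =>
    have h := (map_dagger_dualBlocks hψ 0 (List.replicate ((b : ℕ) - 1) 1) t).2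
    have e1 : dualBlocks (b :: t) = List.replicate 0 (1, true) ++ (0, true) ::
        (List.replicate ((b : ℕ) - 1) (1 : Fin 2)).map (fun a => (a, false)) ++ dualBlocks t := by
      rw [dualBlocks_cons]
      simp
    rw [← e1] at h
    rw [conv_cons, h]
    simp only [signTwist_cons, conv_neg_left, signTwist_nil, indexWord_nil, word_nil, hψ.map_one,
      one_mul, convOne_cons, indexWord_cons, letterWord, List.replicate_zero, one_shuffle,
      List.map_replicate, List.cons_append, word_cons]
    simp

/-- The functions given by the daggered `dualBlocks` and by `squareBlocks` are inverse to the same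
function, hence equal. -/
theorem map_dagger_dualBlocks_cons (hψ : IsShuffleChar ψ) (p : ℕ) (b : ℕ+) (t : List ℕ+) :
    ψ (dagger (zigzagSum (List.replicate p (1, true) ++ dualBlocks (b :: t)))) =
      conv (signTwist fun w => ψ (e 1 * shuffle (word (List.replicate p 0))
        (word (List.replicate ((b : ℕ) - 1) 0 ++ indexWord w))))
        (fun t => ψ (zigzagSum (squareBlocks t))) t := by
  have h := (map_dagger_dualBlocks hψ p (List.replicate ((b : ℕ) - 1) 1) t).2
  have hσ : (fun t => ψ (dagger (zigzagSum (dualBlocks t)))) =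
      fun t => ψ (zigzagSum (squareBlocks t)) :=
    conv_left_cancel (f := signTwist fun w => ψ (word (indexWord w))) (by simp [hψ.map_one])
      ((conv_dualBlocks_eq_one hψ).trans (conv_squareBlocks_eq_one hψ).symm)
  rw [hσ] at h
  convert h using 1
  · rw [dualBlocks_cons]
    simp
  · simp

/-- The part of the diagram of `μ(𝐤, 𝐥)` which depends on the reversal of `𝐥`. -/
def muTail : List ℕ+ → List (Fin 2 × Bool)
  | [] => []
  | a :: t => List.replicate (a : ℕ) (0, true) ++ squareBlocks t

theorem squareBlocks_append (s t : List ℕ+) :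
    squareBlocks (s ++ t) = squareBlocks s ++ squareBlocks t := by
  simp [squareBlocks]

theorem muTail_append_ones {m : List ℕ+} (hm : m ≠ []) (n : ℕ) :
    muTail (m ++ List.replicate n 1) = muTail m ++ List.replicate n (1, false) := by
  obtain ⟨c, t, rfl⟩ := List.exists_cons_of_ne_nil hm
  have : squareBlocks (List.replicate n 1) = List.replicate n (1, false) := by
    induction n with
    | zero => rfl
    | succ n ih => rw [List.replicate_succ, squareBlocks_cons, ih]; rfl
  rw [List.cons_append, muTail, muTail, squareBlocks_append, this, List.append_assoc]

/-- The first component of the index is drawn last, so increasing it adds one ascending ∘ at the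
right end. -/
theorem muTail_incHead (h : List ℕ+) :
    muTail (incHead h).reverse = muTail h.reverse ++ [(0, true)] := by
  cases h with
  | nil => rfl
  | cons a h =>
    rw [incHead, List.reverse_cons, List.reverse_cons]
    generalize h.reverse = m
    cases m with
    | nil =>
      simp only [List.nil_append, muTail, PNat.add_coe, PNat.one_coe, List.replicate_succ']
      simp [squareBlocks]
    | cons c t =>
      have ha : ((a + 1 : ℕ+) : ℕ) - 1 = (a : ℕ) - 1 + 1 := by
        have := a.pos
        rw [PNat.add_coe, PNat.one_coe]
        omega
      rw [List.cons_append, List.cons_append, muTail, muTail, squareBlocks_append,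
        squareBlocks_append, squareBlocks_cons, squareBlocks_cons, ha, List.replicate_succ']
      simp [squareBlocks]

/-- In the recursion of `hoffmanIndex`, a component a of k adds one ascending ∘ by `incHead` and
then a - 1 descending • by the new components 1. -/
theorem muTail_hoffmanIndex (k : List ℕ+) :
    muTail (hoffmanIndex k).reverse = dualBlocks k.reverse := by
  induction k with
  | nil => rfl
  | cons a k ih =>
    have hne : (incHead (hoffmanIndex k)).reverse ≠ [] := by
      cases hoffmanIndex k <;> simp [incHead]
    rw [hoffmanIndex, List.reverse_append, List.reverse_replicate, muTail_append_ones hne,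
      muTail_incHead, ih]
    simp [dualBlocks]

theorem hoffmanIndex_ne_nil {k : List ℕ+} (hk : k ≠ []) : hoffmanIndex k ≠ [] := by
  obtain ⟨a, k, rfl⟩ := List.exists_cons_of_ne_nil hk
  rw [hoffmanIndex]
  cases hoffmanIndex k <;> simp [incHead]

theorem muDiagram_hoffmanIndex (p : ℕ) {k : List ℕ+} (hk : k ≠ []) :
    muDiagram (List.replicate p 1) (hoffmanIndex k).reverse =
      List.replicate p (1, true) ++ dualBlocks k.reverse := by
  rw [← muTail_hoffmanIndex]
  have hne : (hoffmanIndex k).reverse ≠ [] := by simpa using hoffmanIndex_ne_nil hk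
  obtain ⟨c, t, h⟩ := List.exists_cons_of_ne_nil hne
  have hr : roundDiagram (List.replicate p 1) = List.replicate p (1, true) := by
    induction p with
    | zero => rfl
    | succ p ih =>
      have : roundDiagram (List.replicate (p + 1) 1) =
        (1, true) :: roundDiagram (List.replicate p 1) := rfl
      rw [this, ih, List.replicate_succ]
  rw [h, muDiagram, hr, muTail]

end Dual

end MZV

namespace MZV

/-! ### The derivation which raises components -/

section Delta

/-- The sum `∑ᵢ kᵢ (k₁, …, kᵢ + 1, …, k_r)`. -/
noncomputable def deltaIndex : List ℕ+ → H1
  | [] => 0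
  | a :: w => ((a : ℕ) : ℚ) • mono ((a + 1) :: w) + consL indexBasis a (deltaIndex w)

/-- The derivation of `(𝔥¹, *)` with `e_k ↦ k e_{k+1}`. -/
noncomputable def delta : H1 →ₗ[ℚ] H1 := indexBasis.constr ℚ deltaIndex

theorem delta_mono (w : List ℕ+) : delta (mono w) = deltaIndex w := by
  rw [← indexBasis_apply, delta, Module.Basis.constr_basis]

theorem delta_nil : delta (mono []) = 0 := delta_mono []

theorem delta_consL (a : ℕ+) (x : H1) :
    delta (consL indexBasis a x) = ((a : ℕ) : ℚ) • consL indexBasis (a + 1) x +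
      consL indexBasis a (delta x) := by
  induction x using word_induction indexBasis with
  | basis w => rw [indexBasis_apply, consL_mono, consL_mono, delta_mono, delta_mono, deltaIndex]
  | add x y hx hy => simp only [map_add, hx, hy]; module
  | smul q x hx => simp only [map_smul, hx]; module

theorem delta_cons (a : ℕ+) (w : List ℕ+) :
    delta (mono (a :: w)) = ((a : ℕ) : ℚ) • mono ((a + 1) :: w) +
      consL indexBasis a (delta (mono w)) := by
  rw [← consL_mono, delta_consL, consL_mono]

/-- For the merged letter the Leibniz rule is the additivity of the coefficient: (a + a') e_{a+a'+1}
is the sum of the contributions of e_a and e_{a'}. -/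
theorem delta_harm_mono (v w : List ℕ+) :
    delta (harm (mono v) (mono w)) =
      harm (delta (mono v)) (mono w) + harm (mono v) (delta (mono w)) := by
  induction v, w using words_induction with
  | nil_left w => simp [one_harm, delta_nil]
  | nil_right v => simp [harm_one, delta_nil]
  | cons a v a' w h1 h2 h3 =>
    rw [← consL_mono] at h1 h2 ⊢
    rw [← consL_mono a']
    simp only [harm, harmWith_eq_qmul] at h1 h2 h3 ⊢
    simp only [delta_consL, qmul_cons_cons, map_add, map_smul, LinearMap.add_apply,
      LinearMap.smul_apply, h1, h2, h3, PNat.add_coe, Nat.cast_add, add_right_comm a 1 a',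
      ← add_assoc a a' 1]
    module

theorem delta_harm (x y : H1) : delta (harm x y) = harm (delta x) y + harm x (delta y) := by
  induction x using word_induction indexBasis with
  | basis v =>
    induction y using word_induction indexBasis with
    | basis w => simpa only [indexBasis_apply] using delta_harm_mono v w
    | add y z hy hz => simp only [map_add, hy, hz]; abel
    | smul q y hy => simp only [map_smul, hy, smul_add]
  | add y z hy hz => simp only [map_add, LinearMap.add_apply, hy, hz]; abel
  | smul q y hy => simp only [map_smul, LinearMap.smul_apply, hy, smul_add]

/-- Left multiplication by `e₁`, from `𝔥` to `𝔥¹`. -/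
noncomputable def oneMul : H →ₗ[ℚ] H1 :=
  LinearMap.codRestrict H1 (LinearMap.mulLeft ℚ (e 1))
    fun y => Submodule.mem_sup_right (mem_e1H.2 ⟨y, rfl⟩)

theorem coe_oneMul (y : H) : (oneMul y : H) = e 1 * y := rfl

theorem shuffle_e_pow_mul (a : Fin 2) (n : ℕ) (y : H) :
    shuffle (e a) (e a ^ n * y) = (n : ℚ) • (e a ^ (n + 1) * y) + e a ^ n * shuffle (e a) y := by
  induction n with
  | zero => simp
  | succ n ih =>
    have h := shuffle_e_mul a a 1 (e a ^ n * y)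
    rw [mul_one, one_shuffle, ih, ← mul_assoc, ← pow_succ'] at h
    rw [h, mul_add, mul_smul_comm, ← mul_assoc, ← mul_assoc, ← pow_succ', ← pow_succ']
    push_cast
    module

/-- Inserting a letter e₀ into the block e₁e₀^{k-1} anywhere after its e₁ gives e_{k+1} in k ways.
-/
theorem coe_delta_cons (n : ℕ) (k : List ℕ+) :
    (delta (mono (n.succPNat :: k)) : H) =
      e 1 * shuffle (e 0) (e 0 ^ n * word (indexWord k)) := by
  have hc : ∀ (a : ℕ+) (x : H1), (consL indexBasis a x : H) = eK a * x := fun a x => by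
    rw [← eMul_eq_consL, coe_eMul]
  have h1 : ((n.succPNat + 1 : ℕ+) : ℕ) - 1 = n + 1 := rfl
  rw [delta_cons, ← consL_mono, Submodule.coe_add, Submodule.coe_smul, hc, hc, shuffle_e_pow_mul,
    eK, eK, h1, Nat.succPNat_coe, Nat.succ_sub_one, coe_mono]
  cases k with
  | nil =>
    rw [delta_nil, indexWord_nil, word_nil, shuffle_one]
    simp only [mul_one, mul_add, mul_smul_comm, Submodule.coe_zero, mul_zero, add_zero, ← pow_succ]
    push_cast
    module
  | cons b k =>
    obtain ⟨m, rfl⟩ : ∃ m : ℕ, b = m.succPNat := ⟨b.natPred, (PNat.succPNat_natPred b).symm⟩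
    have h2 : word (indexWord (m.succPNat :: k)) = e 1 * (e 0 ^ m * word (indexWord k)) := by
      rw [indexWord_cons, word_append, word_letterWord, eK, mul_assoc, Nat.succPNat_coe,
        Nat.succ_sub_one]
    have h3 := shuffle_e_mul 0 1 1 (e 0 ^ m * word (indexWord k))
    rw [mul_one, one_shuffle] at h3
    rw [coe_delta_cons m k, h2, h3, mul_add, mul_add, mul_add, ← mul_assoc (e 0 ^ n) (e 0),
      ← pow_succ, mul_smul_comm, ← mul_assoc (e 1) (e 0 ^ (n + 1)), ← mul_assoc (e 1) (e 0 ^ n)]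
    push_cast
    module

theorem delta_oneMul (y : H) : delta (oneMul y) = oneMul (shuffle (e 0) y) := by
  induction y using word_induction wordBasis with
  | basis v =>
    obtain ⟨n, k, rfl⟩ := exists_index v
    have h : oneMul (e 0 ^ n * word (indexWord k)) = mono (n.succPNat :: k) := by
      refine Subtype.ext ?_
      rw [coe_oneMul, coe_mono, indexWord_cons, word_append, word_letterWord, eK, mul_assoc,
        Nat.succPNat_coe, Nat.succ_sub_one]
    rw [wordBasis_apply, word_append, word_replicate, h]
    exact Subtype.ext (coe_delta_cons n k)
  | add y z hy hz => simp only [map_add, hy, hz]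
  | smul q y hy => simp only [map_smul, hy]

/-- The p-th shuffle power of e₀ is p! e₀^p, so the divided power inserts the word e₀^p. -/
theorem divPow_delta_oneMul (p : ℕ) (y : H) :
    divPow delta p (oneMul y) = oneMul (shuffle (word (List.replicate p 0)) y) := by
  induction p with
  | zero => rw [divPow_zero, List.replicate_zero, word_nil, one_shuffle]
  | succ p ih =>
    have h := shuffle_e_pow_mul 0 p 1
    simp only [mul_one, shuffle_one] at h
    rw [divPow_succ, ih, delta_oneMul, ← shuffle_assoc, word_replicate, h, word_replicate, ← pow_succ,
      inv_smul_eq_iff₀ (by positivity), ← map_smul, ← LinearMap.smul_apply, ← map_smul]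
    congr 3
    module

theorem coe_divPow_delta_cons (p : ℕ) (b : ℕ+) (w : List ℕ+) :
    (divPow delta p (mono (b :: w)) : H) = e 1 * shuffle (word (List.replicate p 0))
      (word (List.replicate ((b : ℕ) - 1) 0 ++ indexWord w)) := by
  have h : mono (b :: w) = oneMul (word (List.replicate ((b : ℕ) - 1) 0 ++ indexWord w)) :=
    Subtype.ext (by rw [coe_oneMul, coe_mono, ← word_cons, indexWord_cons]; rfl)
  rw [h, divPow_delta_oneMul, coe_oneMul]

theorem divPow_delta_nil {p : ℕ} (hp : p ≠ 0) : divPow delta p (mono []) = 0 := by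
  obtain ⟨p, rfl⟩ := Nat.exists_eq_succ_of_ne_zero hp
  rw [divPow, LinearMap.smul_apply, pow_succ, Module.End.mul_apply, delta_nil, map_zero, smul_zero]

/-! ### Compatibility of `delta` with convolution. -/

variable {R : Type*} [CommRing R] [Algebra ℚ R]

/-- Every index in the image of `delta` has a component at least 2. -/
theorem ext_onesFn_delta (A : ℕ → R) (w : List ℕ+) :
    ext indexBasis (onesFn A) (delta (mono w)) = 0 := by
  induction w generalizing A with
  | nil => rw [delta_nil, map_zero]
  | cons a w ih =>
    have h : a + 1 ≠ 1 := fun h => by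
      have h1 := congrArg PNat.val h
      rw [PNat.add_coe, PNat.one_coe] at h1
      have := a.pos
      omega
    rw [delta_cons, map_add, map_smul, ext_consL, ← indexBasis_apply, ext_basis, onesFn, if_neg h,
      smul_zero, zero_add]
    simp only [onesFn]
    split_ifs
    · exact ih _
    · have : ext indexBasis (fun _ => (0 : R)) = 0 := indexBasis.ext fun w => by
        rw [ext_basis, LinearMap.zero_apply]
      rw [this, LinearMap.zero_apply]

/-- Acting on one component at a time, `delta` is a coderivation for deconcatenation; the term in
which it hits `onesFn A` vanishes. -/
theorem ext_conv_onesFn_delta (A : ℕ → R) (f : List ℕ+ → R) (w : List ℕ+) :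
    ext indexBasis (conv f (onesFn A)) (delta (mono w)) =
      conv (fun w => ext indexBasis f (delta (mono w))) (onesFn A) w := by
  induction w generalizing f with
  | nil => simp [delta_nil]
  | cons a w ih =>
    have h0 := ext_onesFn_delta A (a :: w)
    rw [delta_cons, map_add, map_smul, ← consL_mono] at h0
    rw [delta_cons, map_add, map_smul, ← consL_mono, ext_conv_consL, ext_conv_consL, ih, conv_cons,
      delta_nil, map_zero, zero_mul, zero_add, ← indexBasis_apply w, ext_basis, indexBasis_apply]
    have h1 : (fun w => ext indexBasis f (delta (mono (a :: w)))) = fun w =>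
        algebraMap ℚ R (a : ℕ) * f ((a + 1) :: w) +
          ext indexBasis (fun w => f (a :: w)) (delta (mono w)) := by
      funext w
      rw [delta_cons, map_add, map_smul, ext_consL, ← indexBasis_apply, ext_basis, Algebra.smul_def]
    rw [h1, conv_add_left, conv_mul_left, Algebra.smul_def]
    rw [Algebra.smul_def] at h0
    linear_combination f [] * h0

theorem map_divPow_delta {A : ℕ → R} {φ χ : H1 →ₗ[ℚ] R}
    (h : (fun w => φ (mono w)) = conv (fun w => χ (mono w)) (onesFn A)) (p : ℕ) :
    (fun w => φ (divPow delta p (mono w))) =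
      conv (fun w => χ (divPow delta p (mono w))) (onesFn A) := by
  have hext : ∀ (φ : H1 →ₗ[ℚ] R) x, ext indexBasis (fun w => φ (mono w)) x = φ x := fun φ x => by
    simpa only [indexBasis_apply] using ext_apply indexBasis φ x
  induction p generalizing φ χ with
  | zero => simpa only [divPow_zero] using h
  | succ p ih =>
    have h1 : (fun w => (φ ∘ₗ delta) (mono w)) =
        conv (fun w => (χ ∘ₗ delta) (mono w)) (onesFn A) := by
      funext w
      have := ext_conv_onesFn_delta A (fun w => χ (mono w)) w
      rw [← h] at this
      simp only [hext] at this
      exact this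
    have h2 := ih h1
    have h3 : ∀ (φ : H1 →ₗ[ℚ] R) x, φ (divPow delta (p + 1) x) =
        algebraMap ℚ R ((p : ℚ) + 1)⁻¹ * (φ ∘ₗ delta) (divPow delta p x) := fun φ x => by
      rw [divPow_succ, map_smul, Algebra.smul_def, LinearMap.comp_apply]
    funext w
    simp only [h3, conv_mul_left]
    rw [← h2]

end Delta

end MZV

namespace MZV

/-! ### Kawashima's relation -/

section Kawashima

/-! ### A generating series that is a character of the star harmonic product. -/

section Coefficients

open PowerSeries

variable {S M R : Type*} [CommRing R]

theorem coeff_ext [AddCommGroup M] [Module ℚ M] [Algebra ℚ R] (b : Module.Basis (List S) ℚ M)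
    (f : List S → R⟦X⟧) (n : ℕ) (x : M) :
    coeff n (ext b f x) = ext b (fun w => coeff n (f w)) x := by
  induction x using word_induction b with
  | basis w => simp
  | add x y hx hy => simp only [map_add, hx, hy]
  | smul q x hx => rw [map_smul (ext b f), map_rat_smul, hx, ← map_smul]

theorem ext_C [AddCommGroup M] [Module ℚ M] [Algebra ℚ R] (b : Module.Basis (List S) ℚ M)
    (f : List S → R) (x : M) : ext b (fun w => (C (f w) : R⟦X⟧)) x = C (ext b f x) := by
  induction x using word_induction b with
  | basis w => simp
  | add x y hx hy => simp only [map_add, hx, hy]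
  | smul q x hx => rw [map_smul, map_smul, map_rat_smul, hx]

theorem coeff_signTwist (f : List S → R⟦X⟧) (n : ℕ) (w : List S) :
    coeff n (signTwist f w) = signTwist (fun w => coeff n (f w)) w := by
  have h : (-1 : R⟦X⟧) ^ w.length = C ((-1) ^ w.length) := by simp
  rw [signTwist, signTwist, h, coeff_C_mul]

theorem coeff_conv_C (f : List S → R⟦X⟧) (g : List S → R) (n : ℕ) (w : List S) :
    coeff n (conv f (fun w => C (g w)) w) = conv (fun w => coeff n (f w)) g w := by
  induction w generalizing f with
  | nil => simp
  | cons a w ih => rw [conv_cons, conv_cons, map_add, ih, coeff_mul_C]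

/-- The generating series of the values of the harmonic regularization at the divided powers of
`delta`. -/
noncomputable def deltaSeries (φ : H1 →ₗ[ℚ] ℝ) (w : List ℕ+) : ℝ⟦X⟧ :=
  mk fun p => φ (divPow delta p (mono w))

/-- By the Leibniz rule for divided powers, exp(uδ) is multiplicative, and so is its composition
with φ. -/
theorem isChar_deltaSeries {φ : H1 →ₗ[ℚ] ℝ} (hφ1 : φ (mono []) = 1)
    (hφ : ∀ x y, φ (harm x y) = φ x * φ y) : IsChar indexBasis 1 (deltaSeries φ) := by
  have h : ∀ n x, ext indexBasis (fun w => coeff n (deltaSeries φ w)) x = φ (divPow delta n x) := by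
    intro n x
    have := ext_apply indexBasis (φ ∘ₗ divPow delta n) x
    simpa only [indexBasis_apply, LinearMap.comp_apply, deltaSeries, coeff_mk] using this
  refine ⟨?_, fun v w => ?_⟩
  · ext n
    rw [deltaSeries, coeff_mk, coeff_one]
    split_ifs with hn
    · rw [hn, divPow_zero, hφ1]
    · rw [divPow_delta_nil hn, map_zero]
  · ext n
    rw [coeff_ext, h, ← harmWith_eq_qmul, indexBasis_apply, indexBasis_apply,
      show harmWith 1 = harm from rfl, divPow_leibniz harm delta delta_harm, map_sum, coeff_mul]
    simp only [hφ, deltaSeries, coeff_mk]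

theorem isChar_mono {φ : H1 →ₗ[ℚ] ℝ} (hφ1 : φ (mono []) = 1)
    (hφ : ∀ x y, φ (harm x y) = φ x * φ y) : IsChar indexBasis 1 fun w => φ (mono w) := by
  refine ⟨hφ1, fun v w => ?_⟩
  have := ext_apply indexBasis φ (qmul indexBasis 1 (indexBasis v) (indexBasis w))
  simp only [indexBasis_apply] at this ⊢
  rw [this, ← hφ, harm, harmWith_eq_qmul]

/-- The generating series of the Kawashima functionals, up to sign. -/
noncomputable def kawashimaSeries (φ : H1 →ₗ[ℚ] ℝ) (w : List ℕ+) : ℝ⟦X⟧ :=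
  conv (signTwist (deltaSeries φ)) (fun t => C (φ (star (mono t.reverse)))) w.reverse

/-- The sign twist turns characters for c = 1 into characters for c = -1. The star factor is the
inverse of such a twist, and reversal preserves characters. -/
theorem isChar_kawashimaSeries {φ : H1 →ₗ[ℚ] ℝ} (hφ1 : φ (mono []) = 1)
    (hφ : ∀ x y, φ (harm x y) = φ x * φ y) : IsChar indexBasis (-1) (kawashimaSeries φ) := by
  have hσ := (isChar_mono hφ1 hφ).signTwist.inv (conv_star_eq_one hφ1 hφ)
  have hC : IsChar indexBasis (-1) fun t => (C (φ (star (mono t.reverse))) : ℝ⟦X⟧) := by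
    refine ⟨(congrArg C hσ.1).trans (map_one C), fun v w => ?_⟩
    rw [ext_C indexBasis (fun t => φ (star (mono t.reverse))), hσ.2, map_mul]
  exact ((isChar_deltaSeries hφ1 hφ).signTwist.conv hC).comp_reverse

theorem coeff_kawashimaSeries (φ : H1 →ₗ[ℚ] ℝ) (p : ℕ) (w : List ℕ+) :
    coeff p (kawashimaSeries φ w) = conv (signTwist fun w => φ (divPow delta p (mono w)))
      (fun t => φ (star (mono t.reverse))) w.reverse := by
  rw [kawashimaSeries, coeff_conv_C]
  simp only [coeff_signTwist, deltaSeries, coeff_mk]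

theorem coeff_zero_kawashimaSeries {φ : H1 →ₗ[ℚ] ℝ} (hφ1 : φ (mono []) = 1)
    (hφ : ∀ x y, φ (harm x y) = φ x * φ y) {w : List ℕ+} (hw : w ≠ []) :
    coeff 0 (kawashimaSeries φ w) = 0 := by
  rw [coeff_kawashimaSeries]
  simp only [divPow_zero]
  rw [conv_star_eq_one hφ1 hφ, convOne, if_neg (by simpa using hw)]

end Coefficients

/-! ### From duality to Kawashima's relation. -/

variable {Z : H0 →ₗ[ℚ] ℝ}

/-- The decomposition with empty first factor contributes nothing, as δ kills the empty index and p
≠ 0. Moving the first letter out of the sign twist accounts for the minus sign. -/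
theorem map_dagger_mu_ones (hds : DoubleShuffle Z) {ψ : H →ₗ[ℚ] ℝ} (hψ : IsShuffleChar ψ)
    (hψZ : ∀ x : H1, ψ x = constTerm (shuffleReg Z) x) {p : ℕ} (hp : p ≠ 0) {k : List ℕ+}
    (hk : k ≠ []) (h1 : List.replicate p (1 : ℕ+) ≠ []) (h2 : hoffmanIndex k ≠ []) :
    Z (dagger0 (mu (List.replicate p 1) (hoffmanIndex k) h1 h2)) =
      -conv (signTwist fun w => constTerm (shuffleReg Z) (divPow delta p (mono w)))
        (fun t => ψ (zigzagSum (squareBlocks t))) k.reverse := by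
  have e1 : Z (dagger0 (mu (List.replicate p 1) (hoffmanIndex k) h1 h2)) =
      ψ (dagger (muPoset (List.replicate p 1) (hoffmanIndex k)).W) := by
    rw [← constTerm_shuffleReg_incl hds, ← hψZ]
    rfl
  obtain ⟨a, t, ht⟩ := List.exists_cons_of_ne_nil (l := k.reverse) (by simpa using hk)
  rw [e1, muPoset, zigzag_W, muDiagram_hoffmanIndex p hk, ht, map_dagger_dualBlocks_cons hψ,
    conv_cons, signTwist_nil, divPow_delta_nil hp, map_zero, zero_mul, zero_add]
  simp only [signTwist_cons, conv_neg_left, neg_neg, ← hψZ, coe_divPow_delta_cons]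

/-- Int-Ser and duality lead to the shuffle side. There Reg splits off `onesFn A`, also after
applying `delta`, and its twist turns the inverse on the shuffle side into the star values. -/
theorem kawashimaTerm_mono (hds : DoubleShuffle Z) (hreg : Reg Z) (hdual : Duality Z) {p : ℕ}
    (hp : p ≠ 0) {k : List ℕ+} (hk : k ≠ []) :
    kawashimaTerm Z p (mono k) =
      -PowerSeries.coeff p (kawashimaSeries (constTerm (harmReg Z)) k) := by
  obtain ⟨ψ, hψ, hψZ⟩ := exists_shuffleChar hds
  have h1 : List.replicate p (1 : ℕ+) ≠ [] := by simpa using hp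
  have h2 := hoffmanIndex_ne_nil hk
  have h3 : hoffman (mono k) = mono (hoffmanIndex k) := by
    rw [hoffman, ← indexBasis_apply k, Module.Basis.constr_basis]
  have hα := (reg_iff hds).1 hreg
  have hs : conv (signTwist fun w => constTerm (shuffleReg Z) (mono w))
      (fun t => ψ (zigzagSum (squareBlocks t))) = convOne := by
    rw [← conv_squareBlocks_eq_one hψ]
    congr 2
    funext w
    exact (hψZ _).symm
  have hh := conv_star_eq_one (constTerm_harmReg_one hds) (constTerm_harmReg_mul hds)
  rw [kawashimaTerm, h3, ← (reg_iff_intSer hds).1 hreg _ _ h1 h2, hdual,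
    map_dagger_mu_ones hds hψ hψZ hp hk, map_divPow_delta hα, signTwist_conv, conv_assoc,
    conv_twist_inverse (constTerm_harmReg_one hds) hα hs hh, coeff_kawashimaSeries]

theorem kawashimaTerm_nil (p : ℕ) : kawashimaTerm Z p (mono []) = 0 := by
  have h1 : hoffman (mono []) = mono [] := by
    rw [hoffman, ← indexBasis_apply, Module.Basis.constr_basis, indexBasis_apply]
    rfl
  have h2 : circ (mono (List.replicate p 1)) (mono []) = 0 := by
    rw [circ, ← indexBasis_apply, ← indexBasis_apply, Module.Basis.constr_basis,
      Module.Basis.constr_basis, circIndex]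
    simp
  rw [kawashimaTerm, h1, star_nil, h2, map_zero]

theorem kawashimaTerm_eq (hds : DoubleShuffle Z) (hreg : Reg Z) (hdual : Duality Z) {p : ℕ}
    (hp : p ≠ 0) (x : H1) :
    kawashimaTerm Z p x =
      -PowerSeries.coeff p (ext indexBasis (kawashimaSeries (constTerm (harmReg Z))) x) := by
  rw [coeff_ext]
  induction x using word_induction indexBasis with
  | basis w =>
    rw [ext_basis, indexBasis_apply]
    by_cases hw : w = []
    · subst hw
      rw [kawashimaTerm_nil, coeff_kawashimaSeries, List.reverse_nil, conv_nil, signTwist_nil,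
        divPow_delta_nil hp, map_zero, zero_mul, neg_zero]
    · exact kawashimaTerm_mono hds hreg hdual hp hw
  | add x y hx hy =>
    rw [kawashimaTerm] at hx hy ⊢
    simp only [map_add, hx, hy]
    ring
  | smul q x hx =>
    rw [kawashimaTerm] at hx ⊢
    simp only [map_smul, hx, smul_neg]

theorem kawashima_of_reg (hds : DoubleShuffle Z) (hreg : Reg Z) (hdual : Duality Z) :
    Kawashima Z := by
  intro k l m hk hl hm
  have hφ1 := constTerm_harmReg_one hds
  have hφ := constTerm_harmReg_mul hds
  have h := (isChar_kawashimaSeries hφ1 hφ).2 k l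
  rw [kawashimaTerm_eq hds hreg hdual (by omega), neg_neg, starHarm, harmWith_eq_qmul,
    ← indexBasis_apply k, ← indexBasis_apply l, h, PowerSeries.coeff_mul, Finset.sum_filter]
  refine Finset.sum_congr rfl fun p _ => ?_
  rw [indexBasis_apply, indexBasis_apply]
  split_ifs with hp
  · rw [kawashimaTerm_mono hds hreg hdual (by omega) hk,
      kawashimaTerm_mono hds hreg hdual (by omega) hl, neg_mul_neg]
  -- The full Cauchy product also contains the terms with p = 0 or q = 0; they vanish because the
  -- series has constant term 0 on non-empty indices.
  · have : p.1 = 0 ∨ p.2 = 0 := by omega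
    rcases this with h0 | h0
    · rw [h0, coeff_zero_kawashimaSeries hφ1 hφ hk, zero_mul]
    · rw [h0, coeff_zero_kawashimaSeries hφ1 hφ hl, mul_zero]

end Kawashima

end MZV

theorem mainTheorem5 (Z : MZV.H0 →ₗ[ℚ] ℝ) (hds : MZV.DoubleShuffle Z) :
    (MZV.Reg Z ↔ MZV.IntSer Z) ∧
      (MZV.Reg Z → MZV.Duality Z → MZV.Kawashima Z) :=
  ⟨MZV.reg_iff_intSer hds, MZV.kawashima_of_reg hds⟩
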